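/- **Setting.** *Language.* Programs are built from labelled statements: $\mathbf{skip}$, $x:=\mathbf{new}()$, $x:=*e$, $*x:=e$, $c:=\mathsf{CoreAlloc}(\bar e)$, $\bar r:=\mathsf{CoreApi}_k(c,\bar e)$ (these six are *simple*), $s_1;s_2$ and $\mathbf{fork}(\bar x)\{s\}$. Expressions are free of side effects; values are $\mathbf{nil}$, integers, booleans, pointers and pairs. A forked thread sees only $\bar x$ and its own variables. A codebase $c$ is a statement in static single assignment form with unique labels, containing at most one $\mathsf{CoreAlloc}$ statement. The Core functions are opaque boxes given by arbitrary input-output relations on memory and I/O permissions, subject only to memory safety of the language (a call touches only memory reachable from its inputs or freshly allocated, and forges no pointers). Dereferencing $\mathbf{nil}$ crashes. Application accesses are data-race free: threads interleave at the granularity of source statements. *Ghost code.* Each thread has ghost sets $\mathsf{slh}$, $\mathsf{sih}$; there are global ghost cells $*\mathsf{sgh}$ (a set) and $*\mathsf{used}$ (a boolean). $s_{\mathrm{init}}$ sets $\mathsf{slh},\mathsf{sih}$ to $\emptyset$ and allocates the cells with contents $\emptyset$ and $\mathsf{false}$. $\cup$ and $\setminus$ ignore $\mathbf{nil}$. With $E=\mathrm{reach}(e)\cap\mathsf{slh}$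 (for writes) or $E=\mathrm{reach}(\bar x)\cap\mathsf{slh}$ (for forks), evaluated when it is first used, $\mathbb A$ is: - $\mathbb A(\mathbf{skip})=\mathbf{skip}$; $\;\mathbb A(x:=\mathbf{new}())=x:=\mathbf{new}();\ \mathsf{slh}\cup\!\!=\{x\}$; $\;\mathbb A(s_1;s_2)=\mathbb A(s_1);\mathbb A(s_2)$; - $\mathbb A(x:=*e)$ is $\mathsf{slh}\setminus\!\!=\{e\};\ x:=*e;\ \mathsf{slh}\cup\!\!=\{e\}$ if $e\in\mathsf{slh}$, else $\mathbf{atomic}\{*\mathsf{sgh}\setminus\!\!=\{e\};\ x:=*e;\ *\mathsf{sgh}\cup\!\!=\{e\}\}$; - $\mathbb A(*x:=e)$ is $\mathsf{slh}\setminus\!\!=\{x\};\ *x:=e;\ \mathsf{slh}\cup\!\!=\{x\}$ if $x\in\mathsf{slh}$, else $\mathbf{atomic}\{*\mathsf{sgh}\setminus\!\!=\{x\};\ \mathsf{slh}\setminus\!\!=E;\ *x:=e;\ *\mathsf{sgh}\cup\!\!=\{x\}\cup E\}$; - $\mathbb A(c:=\mathsf{CoreAlloc}(\bar e))$ is $\mathbf{atomic}\{*\mathsf{used}:=\mathsf{true}\};\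 \mathsf{slh}\setminus\!\!=\bar e;\ c:=\mathsf{CoreAlloc}(\bar e);\ \mathsf{slh}\cup\!\!=\bar e;\ \mathsf{sih}\cup\!\!=\{c\}$; - $\mathbb A(\bar r:=\mathsf{CoreApi}_k(c,\bar e))$ is $\mathsf{sih}\setminus\!\!=\{c\};\ \mathsf{slh}\setminus\!\!=\bar e;\ \bar r:=\mathsf{CoreApi}_k(c,\bar e);\ \mathsf{slh}\cup\!\!=\bar e\cup\bar r;\ \mathsf{sih}\cup\!\!=\{c\}$; - $\mathbb A(\mathbf{fork}(\bar x)\{s\})$ is $\mathsf{slh}\setminus\!\!=E;\ \mathbf{atomic}\{*\mathsf{sgh}\cup\!\!=E\};\ \mathbf{fork}(\bar x)\{\mathsf{slh}:=\emptyset;\ \mathsf{sih}:=\emptyset;\ \mathbb A(s)\}$. A *trace* is an execution of $s_{\mathrm{init}};\mathbb A(c)$ from the empty heap and I/O permissions satisfying the I/O specification $\phi$; a step executes $\mathbb A(s)$ for one simple statement $s$, or one fork. *Assertions.* Separation logic is affine, with fractional permissions; $\mathrm{acc}(l)$ is full permission to $l$; $\mathrm{acc}_{\mathbf{nil}}(x)$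 and $\mathrm{inv}_{\mathbf{nil}}(x)$ mean $x\ne\mathbf{nil}\Rightarrow\mathrm{acc}(x)$ and $x\neq\mathbf{nil}\Rightarrow\mathrm{inv}(x)$, where the Core invariant $\mathrm{inv}$ is an arbitrary predicate; $\mathrm{acc}_{\mathbf{nil}}$ extends to lists by $\star$. The program invariants are $$\Pi_l=\Big(\bigstar_{l\in\mathsf{slh}}\mathrm{acc}(l)\Big)\star\Big(\bigstar_{i\in\mathsf{sih}}\mathrm{inv}(i)\Big),\qquad \Pi_g=\mathrm{acc}(\mathsf{sgh})\star\Big(\bigstar_{g\in *\mathsf{sgh}}\mathrm{acc}(g)\Big)\star\mathrm{acc}(\mathsf{used})\star(\neg{*\mathsf{used}}\Rightarrow\phi).$$ *Side conditions.* $\omega(x:=*e)$: $e\in\mathsf{slh}\cup *\mathsf{sgh}$. $\omega(*x:=e)$: $x\in\mathsf{slh}\cup *\mathsf{sgh}$. $\omega(c:=\mathsf{CoreAlloc}(\bar e))$: $*\mathsf{used}=\mathsf{false}$, the non-nil elements of $\bar e$ lie in $\mathsf{slh}$ and are pairwise different. $\omega(\bar r:=\mathsf{CoreApi}_k(c,\bar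 e))$: the same condition on $\bar e$, and $c\in\mathsf{sih}$ or $c=\mathbf{nil}$. Otherwise $\omega(s)=\mathsf{true}$. (Variables mentioned are defined.) *Proof system.* $J\vdash\{P\}\,s\,\{Q\}$ is derivability in concurrent separation logic with resource invariant $J$: the rules Skip, Assign, Alloc, Read, Write, Seq, conditional, Fork, Frame, Conseq, existential, Share, Atom, and the rule that a Core statement satisfies a triple if it transforms any part of the state satisfying $P$ into one satisfying $Q$ and leaves the rest of the state alone. At the start of the code $\mathbb A(s)$ one may use $\omega(s)$, provided that $\omega(s)$ holds whenever $s$ is executed on a trace of $c$. *Restrictions on the Core specification.* $\mathrm{Pre}_{\mathsf{CoreAlloc}}(\bar e)=\phi\star R$, $\mathrm{Post}_{\mathsf{CoreAlloc}}(c,\bar e)=\mathrm{inv}(c)\star R'$, $\mathrm{Pre}_k(c,\bar e)=\mathrm{inv}_{\mathbf{nil}}(c)\star S_k$, $\mathrm{Post}_k(c,\bar e,\bar r)=\mathrm{inv}_{\mathbf{nil}}(c)\star S'_k$. Here $R$ and $S_k$ only specify permissions for the arguments (there are $F$, $F_k$ with $\mathrm{acc}_{\mathbf{nil}}(\bar e)$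 equivalent to $R\star F$ and to $S_k\star F_k$), $R'\models R$, and $S'_k\models S_k\star\mathrm{acc}_{\mathbf{nil}}(\bar r)$. On every trace, $\bar e$ (before and after the Core statement) and $\bar r$ (after it) are shallow: no location other than the argument itself is reachable from them. *Static analyses.* A location is *accessible* to a thread if it can be reached from the thread's variables by dereferencing; accessibility is monotone along a trace. It is *local* to a thread if it is accessible to this thread only. It is *Application-managed* if it was allocated by an Application statement or has been returned in $\bar r$ by an API call. We are given points-to sets $\mathrm{pts}(e)$ of allocation sites and judgements $\mathrm{local}(e,p)$ at program points $p$, both sound: on all traces, the allocation site of any location to which $e$ evaluates is in $\mathrm{pts}(e)$; and if $\mathrm{local}(e,p)$, then at $p$ the value of $e$, if it points to a location, is local to some thread. Write ${}^\bullet\ell$, $\ell^\bullet$ for the points before and after the statement labelled $\ell$. The judgements $\mathcal J(s)$ for $s$ with label $\ell$ are: - for $x:=*e$ (for $*x:=e$): on all traces, all locations with allocation site in $\mathrm{pts}(e)$ (in $\mathrm{pts}(x)$) are Application-managed at ${}^\bullet\ell$; - for $c:=\mathsf{CoreAlloc}(\bar e)$: the sets $\mathrm{pts}(e)$, $e\in\bar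 e$, are pairwise disjoint, and for $e\in\bar e$ and all locations $h$ with site in $\mathrm{pts}(e)$ on any trace, $\mathrm{local}(e,\ell^\bullet)$ holds and $h$ is Application-managed at ${}^\bullet\ell$; - for $\bar r:=\mathsf{CoreApi}_k(c,\bar e)$: the same for $\bar e$; for all locations $h$ with site in $\mathrm{pts}(c)$ on any trace, $\mathrm{local}(c,{}^\bullet\ell)$ holds and $h$ was returned by an earlier $\mathsf{CoreAlloc}$; and $\mathrm{local}(r,\ell^\bullet)$ for all $r\in\bar r$; - otherwise $\mathcal J(s)$ is true. **Corollary (Proof construction).** In this setting suppose that every statement $s$ of the codebase $c$ satisfies $\mathcal J(s)$, that $$\Pi_g\vdash\{\mathrm{Pre}_{\mathsf{CoreAlloc}}(\bar e)\}\;s\;\{\mathrm{Post}_{\mathsf{CoreAlloc}}(x,\bar e)\}\quad\text{whenever } s \text{ is } x:=\mathsf{CoreAlloc}(\bar e),$$ and that $$\Pi_g\vdash\{\mathrm{Pre}_k(x,\bar e)\}\;s\;\{\mathrm{Post}_k(x,\bar e,\bar r)\}\quad\text{whenever } s \text{ is } \bar r:=\mathsf{CoreApi}_k(x,\bar e).$$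 Then $$\mathbf{emp}\vdash\{\phi\}\;s_{\mathrm{init}};\mathbb A(c)\;\{\mathsf{true}\}.$$ -/

import Mathlib

namespace Diodon

universe u

/-! ### The programming language -/

/-- Addresses of heap locations. -/
abbrev Loc := ℕ
/-- Program variables. -/
abbrev Var := ℕ
/-- Statement labels. -/
abbrev Label := ℕ
/-- Thread identifiers (positions in the thread list of a configuration). -/
abbrev Tid := ℕ

/-- Values: `nil`, integers, booleans, pointers, and pairs (which encode structures). -/
inductive Val where
  | nil
  | int (n : ℤ)
  | bool (b : Bool)
  | loc (l : Loc)
  | pair (v w : Val)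
  deriving DecidableEq

/-- The location a pointer value points to; `none` for `nil` and for non-pointers. -/
def Val.toLoc : Val → Option Loc
  | .loc l => some l
  | _ => none

/-- `v.Mentions l`: the value `v` contains a pointer to `l`. -/
def Val.Mentions : Val → Loc → Prop
  | .loc l', l => l' = l
  | .pair v w, l => v.Mentions l ∨ w.Mentions l
  | _, _ => False

/-- Side-effect free expressions. -/
inductive Expr where
  | var (x : Var)
  | nil
  | int (n : ℤ)
  | bool (b : Bool)
  | pair (a b : Expr)
  | fst (a : Expr)
  | snd (a : Expr)
  | add (a b : Expr)
  | mul (a b : Expr)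
  | lt (a b : Expr)
  | eq (a b : Expr)
  | and (a b : Expr)
  | not (a : Expr)

/-- Variables occurring in an expression. -/
def Expr.vars : Expr → Set Var
  | .var x => {x}
  | .nil | .int _ | .bool _ => ∅
  | .fst a | .snd a | .not a => a.vars
  | .pair a b | .add a b | .mul a b | .lt a b | .eq a b | .and a b => a.vars ∪ b.vars

/-- Evaluation; `none` if a variable is undefined or an operand has the wrong shape. -/
def Expr.eval (σ : Var → Option Val) : Expr → Option Val
  | .var x => σ x
  | .nil => some .nil
  | .int n => some (.int n)
  | .bool b => some (.bool b)
  | .pair a b => match a.eval σ, b.eval σ with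
    | some v, some w => some (.pair v w)
    | _, _ => none
  | .fst a => match a.eval σ with
    | some (.pair v _) => some v
    | _ => none
  | .snd a => match a.eval σ with
    | some (.pair _ w) => some w
    | _ => none
  | .add a b => match a.eval σ, b.eval σ with
    | some (.int m), some (.int n) => some (.int (m + n))
    | _, _ => none
  | .mul a b => match a.eval σ, b.eval σ with
    | some (.int m), some (.int n) => some (.int (m * n))
    | _, _ => none
  | .lt a b => match a.eval σ, b.eval σ with
    | some (.int m), some (.int n) => some (.bool (decide (m < n)))
    | _, _ => none
  | .eq a b => match a.eval σ, b.eval σ with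
    | some v, some w => some (.bool (decide (v = w)))
    | _, _ => none
  | .and a b => match a.eval σ, b.eval σ with
    | some (.bool p), some (.bool q) => some (.bool (p && q))
    | _, _ => none
  | .not a => match a.eval σ with
    | some (.bool p) => some (.bool (!p))
    | _ => none

/-- Values of a list of expressions; `none` as soon as one of them is undefined. -/
def evals (σ : Var → Option Val) : List Expr → Option (List Val)
  | [] => some []
  | e :: es => match e.eval σ, evals σ es with
    | some v, some vs => some (v :: vs)
    | _, _ => none

/-- Labelled statements of the source language. -/
inductive Stmt where
  /-- `skip` -/
  | skip (ℓ : Label)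
  /-- `x := new()` -/
  | alloc (ℓ : Label) (x : Var)
  /-- `x := *e` -/
  | read (ℓ : Label) (x : Var) (e : Expr)
  /-- `*x := e` -/
  | write (ℓ : Label) (x : Var) (e : Expr)
  /-- `c := CoreAlloc(es)` -/
  | coreAlloc (ℓ : Label) (c : Var) (es : List Expr)
  /-- `rs := CoreApi_k(c, es)` -/
  | coreCall (ℓ : Label) (k : ℕ) (c : Var) (es : List Expr) (rs : List Var)
  /-- `s₁; s₂` -/
  | seq (ℓ : Label) (s₁ s₂ : Stmt)
  /-- `fork (xs) { s }` -/
  | fork (ℓ : Label) (xs : List Var) (s : Stmt)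

namespace Stmt

def label : Stmt → Label
  | skip ℓ | alloc ℓ _ | read ℓ _ _ | write ℓ _ _ | coreAlloc ℓ _ _
  | coreCall ℓ _ _ _ _ | seq ℓ _ _ | fork ℓ _ _ => ℓ

/-- Simple statements: everything except sequential composition and `fork`. -/
def IsSimple : Stmt → Prop
  | seq _ _ _ | fork _ _ _ => False
  | _ => True

def isCoreAlloc : Stmt → Bool
  | coreAlloc _ _ _ => true
  | _ => false

/-- All statements occurring in a statement, itself and the bodies of forks included. -/
def subs : Stmt → List Stmt
  | seq ℓ s₁ s₂ => seq ℓ s₁ s₂ :: (s₁.subs ++ s₂.subs)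
  | fork ℓ xs s => fork ℓ xs s :: s.subs
  | s => [s]

/-- The simple statements and forks that a thread running `s` executes, in order. -/
def flatten : Stmt → List Stmt
  | seq _ s₁ s₂ => s₁.flatten ++ s₂.flatten
  | s => [s]

/-- Variables assigned by the thread that executes `s` (not by the threads it forks). -/
def threadDefs : Stmt → List Var
  | alloc _ x => [x]
  | read _ x _ => [x]
  | coreAlloc _ c _ => [c]
  | coreCall _ _ _ _ rs => rs
  | seq _ s₁ s₂ => s₁.threadDefs ++ s₂.threadDefs
  | _ => []

/-- Variables assigned anywhere in `s`. -/
def allDefs : Stmt → List Var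
  | alloc _ x => [x]
  | read _ x _ => [x]
  | coreAlloc _ c _ => [c]
  | coreCall _ _ _ _ rs => rs
  | seq _ s₁ s₂ => s₁.allDefs ++ s₂.allDefs
  | fork _ _ s => s.allDefs
  | _ => []

/-- `s` uses only variables that are already defined (initially those in `Δ`) and never reassigns
a defined variable; a forked thread sees only the variables passed to it and its own ones. -/
def Scoped : Set Var → Stmt → Prop
  | _, skip _ => True
  | Δ, alloc _ x => x ∉ Δ
  | Δ, read _ x e => x ∉ Δ ∧ e.vars ⊆ Δ
  | Δ, write _ x e => x ∈ Δ ∧ e.vars ⊆ Δ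
  | Δ, coreAlloc _ c es => c ∉ Δ ∧ ∀ e ∈ es, e.vars ⊆ Δ
  | Δ, coreCall _ _ c es rs => c ∈ Δ ∧ (∀ e ∈ es, e.vars ⊆ Δ) ∧ ∀ r ∈ rs, r ∉ Δ
  | Δ, seq _ s₁ s₂ => Scoped Δ s₁ ∧ Scoped (Δ ∪ {x | x ∈ s₁.threadDefs}) s₂
  | Δ, fork _ xs s => (∀ x ∈ xs, x ∈ Δ) ∧ Scoped {x | x ∈ xs} s

/-- A codebase in static single assignment form: labels are unique, every variable has one
assignment in the program text, and assignments precede uses. -/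
def SSA (c : Stmt) : Prop :=
  (c.subs.map label).Nodup ∧ c.allDefs.Nodup ∧ Scoped ∅ c

/-- The codebase contains at most one Core allocation statement. -/
def AtMostOneCoreAlloc (c : Stmt) : Prop := c.subs.countP isCoreAlloc ≤ 1

end Stmt

/-! ### Programs with ghost code and the algorithm `𝔸` -/

/-- Statements with ghost code. `slh`, `sih` are thread-local ghost sets, `*sgh` and `*used` are
global ghost cells, and `esc` is a thread-local ghost variable that stores the value of an
expression `reachable(es) ∩ slh` for the statements that remove it from one ghost set and add it to
another one. Sets are updated with the locations that expressions point to; `nil` is ignored. -/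
inductive GCmd where
  | skip
  | alloc (ℓ : Label) (x : Var)
  | read (x : Var) (e : Expr)
  | write (x : Var) (e : Expr)
  | coreAlloc (c : Var) (es : List Expr)
  | coreCall (k : ℕ) (c : Var) (es : List Expr) (rs : List Var)
  /-- `slh := ∅` -/
  | slhInit
  /-- `sih := ∅` -/
  | sihInit
  /-- `slh := slh \ es` -/
  | slhRem (es : List Expr)
  /-- `slh := slh ∪ es` -/
  | slhAdd (es : List Expr)
  /-- `sih := sih \ {c}` -/
  | sihRem (c : Var)
  /-- `sih := sih ∪ {c}` -/
  | sihAdd (c : Var)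
  /-- `esc := reachable(es) ∩ slh` -/
  | escSet (es : List Expr)
  /-- `slh := slh \ esc` -/
  | slhRemEsc
  /-- allocates the ghost cell `sgh` with content `∅` -/
  | sghNew
  /-- allocates the ghost cell `used` with content `false` -/
  | usedNew
  /-- `*sgh := *sgh \ es` -/
  | sghRem (es : List Expr)
  /-- `*sgh := *sgh ∪ es` -/
  | sghAdd (es : List Expr)
  /-- `*sgh := *sgh ∪ esc` -/
  | sghAddEsc
  /-- `*used := true` -/
  | usedSet
  /-- `C₁` if `e ∈ slh`, and `C₂` otherwise -/
  | ifLocal (e : Expr) (C₁ C₂ : GCmd)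
  | seq (C₁ C₂ : GCmd)
  /-- an atomic block, tagged with the source statement it belongs to -/
  | atomic (s : Stmt) (C : GCmd)
  /-- a tag: here starts the code for the source statement `s` -/
  | point (s : Stmt) (C : GCmd)
  | fork (xs : List Var) (C : GCmd)

infixr:65 " ;; " => GCmd.seq

/-- The ghost code that precedes the `fork` in `𝔸(fork (xs) { s })`. -/
def forkPrefix (s : Stmt) (xs : List Var) : GCmd :=
  .escSet (xs.map .var) ;; .slhRemEsc ;; .atomic s .sghAddEsc

/-- The algorithm `𝔸`, which inserts the ghost code. -/
def ghost : Stmt → GCmd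
  | .skip _ => .skip
  | .alloc ℓ x => .alloc ℓ x ;; .slhAdd [.var x]
  | .read ℓ x e => .point (.read ℓ x e)
      (.ifLocal e
        (.slhRem [e] ;; .read x e ;; .slhAdd [e])
        (.atomic (.read ℓ x e) (.sghRem [e] ;; .read x e ;; .sghAdd [e])))
  | .write ℓ x e => .point (.write ℓ x e)
      (.ifLocal (.var x)
        (.slhRem [.var x] ;; .write x e ;; .slhAdd [.var x])
        (.atomic (.write ℓ x e)
          (.sghRem [.var x] ;; .escSet [e] ;; .slhRemEsc ;; .write x e ;;
            .sghAdd [.var x] ;; .sghAddEsc)))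
  | .coreAlloc ℓ c es => .point (.coreAlloc ℓ c es)
      (.atomic (.coreAlloc ℓ c es) .usedSet ;; .slhRem es ;; .coreAlloc c es ;;
        .slhAdd es ;; .sihAdd c)
  | .coreCall ℓ k c es rs => .point (.coreCall ℓ k c es rs)
      (.sihRem c ;; .slhRem es ;; .coreCall k c es rs ;;
        .slhAdd (es ++ rs.map .var) ;; .sihAdd c)
  | .seq _ s₁ s₂ => ghost s₁ ;; ghost s₂
  | .fork ℓ xs s => forkPrefix (.fork ℓ xs s) xs ;; .fork xs (.slhInit ;; .sihInit ;; ghost s)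

/-- The ghost code `s_init`. -/
def sInit : GCmd := .slhInit ;; .sihInit ;; .sghNew ;; .usedNew

/-! ### Operational semantics -/

/-- Local state of a thread: its variables and its ghost variables. -/
structure LState where
  store : Var → Option Val
  slh : Finset Loc
  sih : Finset Loc
  esc : Finset Loc

namespace LState

def set (st : LState) (x : Var) (v : Val) : LState :=
  { st with store := Function.update st.store x (some v) }

def setMany (st : LState) : List Var → List Val → LState
  | x :: xs, v :: vs => (st.set x v).setMany xs vs
  | _, _ => st

/-- The locations to which the expressions `es` point. -/
def locs (st : LState) (es : List Expr) : Finset Loc :=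
  (es.filterMap fun e => (e.eval st.store).bind Val.toLoc).toFinset

/-- Initial store of a forked thread, to which the variables `xs` are passed. -/
def passed (st : LState) (xs : List Var) : Var → Option Val :=
  fun x => if x ∈ xs then st.store x else none

end LState

/-- Allocation sites: labels of statements of the Application, or inside the Core. -/
inductive Site where
  | app (ℓ : Label)
  | core (a : ℕ)

/-- The memory: heap, allocation sites of the locations, and the available I/O permissions. -/
structure Phys (Perm : Type u) where
  heap : Loc → Option Val
  site : Loc → Option Site
  perms : Multiset Perm

/-- Shared state: the memory and the ghost cells `sgh` and `used` (once allocated). -/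
structure Global (Perm : Type u) where
  phys : Phys Perm
  sgh : Option (Finset Loc)
  used : Option Bool

/-- `Reach h v l`: the location `l` is transitively reachable from the value `v` in the heap `h`. -/
inductive Reach (h : Loc → Option Val) (v : Val) : Loc → Prop
  | base {l : Loc} : v.Mentions l → Reach h v l
  | step {l l' : Loc} {w : Val} : Reach h v l → h l = some w → w.Mentions l' → Reach h v l'

/-- What the Core functions do: input-output relations of the constructor
(arguments, memory before, memory after, result) and of the `k`-th API function
(index, Core instance, arguments, memory before, memory after, results). -/
structure CoreImpl (Perm : Type u) where
  alloc : List Val → Phys Perm → Phys Perm → Val → Prop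
  call : ℕ → Val → List Val → Phys Perm → Phys Perm → List Val → Prop

/-- A function of the memory-safe language called with the values `ins` and returning `outs` does
not free memory, modifies only memory reachable from `ins` or freshly allocated by it, and does
not forge pointers. What it allocates has an allocation site inside the Core. -/
structure Confined {Perm : Type u} (ins : List Val) (m m' : Phys Perm) (outs : List Val) :
    Prop where
  grow : ∀ l, m.heap l ≠ none → m'.heap l ≠ none
  unreached : ∀ l, m.heap l ≠ none → (¬ ∃ v ∈ ins, Reach m.heap v l) → m'.heap l = m.heap l
  contents : ∀ l w l', m'.heap l = some w → ((∃ v ∈ ins, Reach m.heap v l) ∨ m.heap l = none) →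
    w.Mentions l' → (∃ v ∈ ins, Reach m.heap v l') ∨ (m.heap l' = none ∧ m'.heap l' ≠ none)
  results : ∀ w ∈ outs, ∀ l', w.Mentions l' →
    (∃ v ∈ ins, Reach m.heap v l') ∨ (m.heap l' = none ∧ m'.heap l' ≠ none)
  oldSites : ∀ l, m.heap l ≠ none ∨ m'.heap l = none → m'.site l = m.site l
  newSites : ∀ l, m.heap l = none → m'.heap l ≠ none → ∃ a, m'.site l = some (.core a)

section Semantics

variable {Perm : Type u} (K : CoreImpl Perm)

/-- Execution of `c := CoreAlloc(es)`. -/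
inductive CoreAllocStep (c : Var) (es : List Expr) :
    LState → Global Perm → LState → Global Perm → Prop
  | mk {st : LState} {g : Global Perm} {m' : Phys Perm} {vs : List Val} {v : Val} :
      evals st.store es = some vs → K.alloc vs g.phys m' v → Confined vs g.phys m' [v] →
      CoreAllocStep c es st g (st.set c v) { g with phys := m' }

/-- Execution of `rs := CoreApi_k(c, es)`. -/
inductive CoreCallStep (k : ℕ) (c : Var) (es : List Expr) (rs : List Var) :
    LState → Global Perm → LState → Global Perm → Prop
  | mk {st : LState} {g : Global Perm} {m' : Phys Perm} {vc : Val} {vs ws : List Val} :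
      st.store c = some vc → evals st.store es = some vs → ws.length = rs.length →
      K.call k vc vs g.phys m' ws → Confined (vc :: vs) g.phys m' ws →
      CoreCallStep k c es rs st g (st.setMany rs ws) { g with phys := m' }

/-- Execution of fork-free code by a thread without interruption. An access through a pointer that
is `nil` crashes, i.e. there is no execution. Tags and atomic blocks have no effect here. -/
inductive Exec : GCmd → LState → Global Perm → LState → Global Perm → Prop
  | skip {st g} : Exec .skip st g st g
  | alloc {ℓ x st l} {g : Global Perm} : g.phys.heap l = none →
      Exec (.alloc ℓ x) st g (st.set x (.loc l))
        { g with phys := { g.phys with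
            heap := Function.update g.phys.heap l (some .nil)
            site := Function.update g.phys.site l (some (.app ℓ)) } }
  | read {x e st l v} {g : Global Perm} : e.eval st.store = some (.loc l) →
      g.phys.heap l = some v → Exec (.read x e) st g (st.set x v) g
  | write {x e st l v w} {g : Global Perm} : st.store x = some (.loc l) →
      g.phys.heap l = some v → e.eval st.store = some w →
      Exec (.write x e) st g st
        { g with phys := { g.phys with heap := Function.update g.phys.heap l (some w) } }
  | coreAlloc {c es st g st' g'} : CoreAllocStep K c es st g st' g' →
      Exec (.coreAlloc c es) st g st' g'
  | coreCall {k c es rs st g st' g'} : CoreCallStep K k c es rs st g st' g' →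
      Exec (.coreCall k c es rs) st g st' g'
  | slhInit {st g} : Exec .slhInit st g { st with slh := ∅ } g
  | sihInit {st g} : Exec .sihInit st g { st with sih := ∅ } g
  | slhRem {es st g} : Exec (.slhRem es) st g { st with slh := st.slh \ st.locs es } g
  | slhAdd {es st g} : Exec (.slhAdd es) st g { st with slh := st.slh ∪ st.locs es } g
  | sihRem {c st g} : Exec (.sihRem c) st g { st with sih := st.sih \ st.locs [.var c] } g
  | sihAdd {c st g} : Exec (.sihAdd c) st g { st with sih := st.sih ∪ st.locs [.var c] } g
  | escSet {es st T} {g : Global Perm} :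
      (∀ l, l ∈ T ↔ l ∈ st.slh ∧
        ∃ e ∈ es, ∃ v, e.eval st.store = some v ∧ Reach g.phys.heap v l) →
      Exec (.escSet es) st g { st with esc := T } g
  | slhRemEsc {st g} : Exec .slhRemEsc st g { st with slh := st.slh \ st.esc } g
  | sghNew {st} {g : Global Perm} : g.sgh = none →
      Exec .sghNew st g st { g with sgh := some ∅ }
  | usedNew {st} {g : Global Perm} : g.used = none →
      Exec .usedNew st g st { g with used := some false }
  | sghRem {es st S} {g : Global Perm} : g.sgh = some S →
      Exec (.sghRem es) st g st { g with sgh := some (S \ st.locs es) }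
  | sghAdd {es st S} {g : Global Perm} : g.sgh = some S →
      Exec (.sghAdd es) st g st { g with sgh := some (S ∪ st.locs es) }
  | sghAddEsc {st S} {g : Global Perm} : g.sgh = some S →
      Exec .sghAddEsc st g st { g with sgh := some (S ∪ st.esc) }
  | usedSet {st b} {g : Global Perm} : g.used = some b →
      Exec .usedSet st g st { g with used := some true }
  | ifLocalThen {e C₁ C₂ st g st' g' l} : e.eval st.store = some (.loc l) → l ∈ st.slh →
      Exec C₁ st g st' g' → Exec (.ifLocal e C₁ C₂) st g st' g'
  | ifLocalElse {e C₁ C₂ st g st' g'} :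
      (¬ ∃ l, e.eval st.store = some (.loc l) ∧ l ∈ st.slh) →
      Exec C₂ st g st' g' → Exec (.ifLocal e C₁ C₂) st g st' g'
  | seq {C₁ C₂ st g st' g' st'' g''} : Exec C₁ st g st' g' → Exec C₂ st' g' st'' g'' →
      Exec (C₁ ;; C₂) st g st'' g''
  | atomic {s C st g st' g'} : Exec C st g st' g' → Exec (.atomic s C) st g st' g'
  | point {s C st g st' g'} : Exec C st g st' g' → Exec (.point s C) st g st' g'

/-- A thread: its local state and the statements it still has to execute. -/
structure Thread where
  st : LState
  cont : List Stmt

structure Config (Perm : Type u) where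
  threads : List Thread
  g : Global Perm

/-- An execution step on a trace: thread `tid` executed (the ghost-augmented version of) the source
statement `stmt` between the configurations `pre` and `post`. -/
structure Event (Perm : Type u) where
  tid : Tid
  stmt : Stmt
  pre : Config Perm
  post : Config Perm

/-- Threads are interleaved at the granularity of source statements (application memory accesses
are free of data races, hence linearizable, and Core functions are opaque boxes). A thread that
executes a simple statement `s` runs `𝔸(s)`. -/
inductive Step : Event Perm → Prop
  | simple {t : Tid} {s : Stmt} {k : List Stmt} {st st' : LState} {κ : Config Perm}
      {g' : Global Perm} :
      κ.threads[t]? = some ⟨st, s :: k⟩ → s.IsSimple → Exec K (ghost s) st κ.g st' g' →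
      Step ⟨t, s, κ, ⟨κ.threads.set t ⟨st', k⟩, g'⟩⟩
  | fork {t : Tid} {ℓ : Label} {xs : List Var} {b : Stmt} {k : List Stmt} {st st' : LState}
      {κ : Config Perm} {g' : Global Perm} :
      κ.threads[t]? = some ⟨st, .fork ℓ xs b :: k⟩ →
      Exec K (forkPrefix (.fork ℓ xs b) xs) st κ.g st' g' →
      Step ⟨t, .fork ℓ xs b, κ,
        ⟨κ.threads.set t ⟨st', k⟩ ++ [⟨⟨st'.passed xs, ∅, ∅, ∅⟩, b.flatten⟩], g'⟩⟩

/-- Initial configurations of a codebase `c`: the empty heap, I/O permissions satisfying the I/O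
specification `φ`, and one thread that has executed `s_init` and is about to execute `c`. -/
def Initial (φ : Multiset Perm → Prop) (c : Stmt) (κ : Config Perm) : Prop :=
  ∃ perms st g, φ perms ∧
    Exec K sInit ⟨fun _ => none, ∅, ∅, ∅⟩ ⟨⟨fun _ => none, fun _ => none, perms⟩, none, none⟩ st g ∧
    κ = ⟨[⟨st, c.flatten⟩], g⟩

/-- `Run K φ c τ κ`: the steps `τ` (latest first) form a trace of `s_init; 𝔸(c)` ending in `κ`. -/
inductive Run (φ : Multiset Perm → Prop) (c : Stmt) : List (Event Perm) → Config Perm → Prop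
  | init {κ} : Initial K φ c κ → Run φ c [] κ
  | step {τ ev} : Run φ c τ ev.pre → Step K ev → Run φ c (ev :: τ) ev.post

/-- Program points: before and after the statement with a given label. -/
inductive Point where
  | pre (ℓ : Label)
  | post (ℓ : Label)

/-- `AtPoint K φ c p τ κ`: `τ` is the part of a trace up to the program point `p`, and `κ` is the
configuration there. (The language has no loops: a label is executed at most once per trace.) -/
def AtPoint (φ : Multiset Perm → Prop) (c : Stmt) :
    Point → List (Event Perm) → Config Perm → Prop
  | .pre ℓ, τ, κ => ∃ ev, Run K φ c (ev :: τ) ev.post ∧ ev.stmt.label = ℓ ∧ ev.pre = κ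
  | .post ℓ, τ, κ => Run K φ c τ κ ∧ ∃ ev τ', τ = ev :: τ' ∧ ev.stmt.label = ℓ

end Semantics

/-! ### Notions on traces -/

section Traces

variable {Perm : Type u}

/-- `v` is the value of the expression `e` (unique in static single assignment form). -/
def ValueOf (κ : Config Perm) (e : Expr) (v : Val) : Prop :=
  ∃ th ∈ κ.threads, e.eval th.st.store = some v

/-- `h` has been returned by a Core allocation statement on the trace. -/
def PassedCore (τ : List (Event Perm)) (h : Loc) : Prop :=
  ∃ ev ∈ τ, ∃ ℓ c es, ev.stmt = .coreAlloc ℓ c es ∧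
    ∃ th, ev.post.threads[ev.tid]? = some th ∧ th.st.store c = some (.loc h)

/-- `h` has been returned by a Core API call on the trace. -/
def PassedReturn (τ : List (Event Perm)) (h : Loc) : Prop :=
  ∃ ev ∈ τ, ∃ ℓ k c es rs, ev.stmt = .coreCall ℓ k c es rs ∧
    ∃ th, ev.post.threads[ev.tid]? = some th ∧ ∃ r ∈ rs, th.st.store r = some (.loc h)

/-- Application-managed locations: allocated by the Application or returned by an API call. -/
def AppManaged (τ : List (Event Perm)) (κ : Config Perm) (h : Loc) : Prop :=
  (∃ ℓ, κ.g.phys.site h = some (.app ℓ)) ∨ PassedReturn τ h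

/-- `Accessible τ κ t h`: thread `t` may access `h`, through its variables or by dereferencing
accessible locations. What is accessible remains accessible. -/
inductive Accessible : List (Event Perm) → Config Perm → Tid → Loc → Prop
  | var {τ κ t th x v h} : κ.threads[t]? = some th → th.st.store x = some v → v.Mentions h →
      Accessible τ κ t h
  | deref {τ κ t h w h'} : Accessible τ κ t h → κ.g.phys.heap h = some w → w.Mentions h' →
      Accessible τ κ t h'
  | mono {τ ev t h} : Accessible τ ev.pre t h → Accessible (ev :: τ) ev.post t h

/-- `h` is local to thread `t`: `t` is the only thread that may access it. -/
def LocalTo (τ : List (Event Perm)) (κ : Config Perm) (t : Tid) (h : Loc) : Prop :=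
  Accessible τ κ t h ∧ ∀ t', t' ≠ t → ¬ Accessible τ κ t' h

end Traces

/-! ### Static analyses -/

/-- Results of the static analyses: the may-point-to sets and the locality judgements. -/
structure Analysis where
  pts : Expr → Set Site
  isLocal : Expr → Point → Prop

section Analyses

variable {Perm : Type u} (K : CoreImpl Perm) (φ : Multiset Perm → Prop) (c : Stmt)

/-- Soundness of the pointer analysis. -/
def Analysis.PointerSound (an : Analysis) : Prop :=
  ∀ e τ κ h, Run K φ c τ κ → ValueOf κ e (.loc h) → ∃ a ∈ an.pts e, κ.g.phys.site h = some a

/-- Soundness of the escape analysis. -/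
def Analysis.EscapeSound (an : Analysis) : Prop :=
  ∀ e p, an.isLocal e p → ∀ τ κ h, AtPoint K φ c p τ κ → ValueOf κ e (.loc h) →
    ∃ t, LocalTo τ κ t h

/-- The arguments point to locations with different allocation sites. -/
def Analysis.DisjointSites (an : Analysis) (es : List Expr) : Prop :=
  es.Pairwise fun e e' => an.pts e ∩ an.pts e' = ∅

/-- Whatever the arguments may point to is local after the statement with label `ℓ` and
Application-managed before it. -/
def Analysis.LocalAppManaged (an : Analysis) (es : List Expr) (ℓ : Label) : Prop :=
  ∀ e ∈ es, ∀ τ κ, AtPoint K φ c (.pre ℓ) τ κ → ∀ h, ∀ a ∈ an.pts e, κ.g.phys.site h = some a →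
    an.isLocal e (.post ℓ) ∧ AppManaged τ κ h

/-- Whatever `x` may point to is a local Core instance before the statement with label `ℓ`. -/
def Analysis.LocalCore (an : Analysis) (x : Var) (ℓ : Label) : Prop :=
  ∀ τ κ, AtPoint K φ c (.pre ℓ) τ κ → ∀ h, ∀ a ∈ an.pts (.var x), κ.g.phys.site h = some a →
    an.isLocal (.var x) (.pre ℓ) ∧ PassedCore τ h

/-- Whatever `e` may point to is Application-managed before the statement with label `ℓ`. -/
def Analysis.AppAccess (an : Analysis) (e : Expr) (ℓ : Label) : Prop :=
  ∀ τ κ, AtPoint K φ c (.pre ℓ) τ κ → ∀ h, ∀ a ∈ an.pts e, κ.g.phys.site h = some a →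
    AppManaged τ κ h

/-- The judgements of the static analyses for a statement of the codebase `c`. -/
def Analysis.Judgements (an : Analysis) : Stmt → Prop
  | .read ℓ _ e => an.AppAccess K φ c e ℓ
  | .write ℓ x _ => an.AppAccess K φ c (.var x) ℓ
  | .coreAlloc ℓ _ es => an.DisjointSites es ∧ an.LocalAppManaged K φ c es ℓ
  | .coreCall ℓ _ x es rs =>
      an.DisjointSites es ∧ an.LocalAppManaged K φ c es ℓ ∧ an.LocalCore K φ c x ℓ ∧
        ∀ r ∈ rs, an.isLocal (.var r) (.post ℓ)
  | _ => True

/-- From the value `v` no location is reachable, except the one to which it points itself. -/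
def Shallow (κ : Config Perm) (v : Val) : Prop := ∀ l, Reach κ.g.phys.heap v l → v = .loc l

/-- Arguments and results of Core functions are shallow. -/
def ShallowArguments : Prop :=
  (∀ ℓ x es, Stmt.coreAlloc ℓ x es ∈ c.subs → ∀ e ∈ es, ∀ p ∈ [Point.pre ℓ, Point.post ℓ],
    ∀ τ κ v, AtPoint K φ c p τ κ → ValueOf κ e v → Shallow κ v) ∧
  (∀ ℓ k x es rs, Stmt.coreCall ℓ k x es rs ∈ c.subs →
    (∀ e ∈ es, ∀ p ∈ [Point.pre ℓ, Point.post ℓ],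
      ∀ τ κ v, AtPoint K φ c p τ κ → ValueOf κ e v → Shallow κ v) ∧
    (∀ r ∈ rs, ∀ τ κ v, AtPoint K φ c (.post ℓ) τ κ → ValueOf κ (.var r) v → Shallow κ v))

/-- The side condition `ω(s)`, evaluated in a local state of a thread and for the contents `S` and
`u` of the ghost cells `sgh` and `used`. -/
def omega : Stmt → LState → Finset Loc → Bool → Prop
  | .read _ _ e, st, S, _ => ∃ l, e.eval st.store = some (.loc l) ∧ l ∈ st.slh ∪ S
  | .write _ x _, st, S, _ => ∃ l, st.store x = some (.loc l) ∧ l ∈ st.slh ∪ S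
  | .coreAlloc _ _ es, st, _, u => u = false ∧
      ∃ vs, evals st.store es = some vs ∧
        (∀ l ∈ vs.filterMap Val.toLoc, l ∈ st.slh) ∧ (vs.filterMap Val.toLoc).Nodup
  | .coreCall _ _ x es _, st, _, _ =>
      (∃ vs, evals st.store es = some vs ∧
        (∀ l ∈ vs.filterMap Val.toLoc, l ∈ st.slh) ∧ (vs.filterMap Val.toLoc).Nodup) ∧
      ∃ v, st.store x = some v ∧ ∀ l, v = .loc l → l ∈ st.sih
  | _, _, _, _ => True

/-- The side condition `ω(s)` holds whenever `s` is executed on a trace of the codebase. -/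
def SideCondition (s : Stmt) : Prop :=
  ∀ τ ev, Run K φ c (ev :: τ) ev.post → ev.stmt = s →
    ∃ th S u, ev.pre.threads[ev.tid]? = some th ∧ ev.pre.g.sgh = some S ∧
      ev.pre.g.used = some u ∧ omega s th.st S u

end Analyses

/-! ### Separation logic -/

/-- Resources: fractional permissions to heap locations together with the values stored there,
possibly the ghost cells, and I/O permissions. -/
structure Res (Perm : Type u) where
  perm : Loc → ℚ≥0
  val : Loc → Val
  perm_le : ∀ l, perm l ≤ 1
  val_nil : ∀ l, perm l = 0 → val l = .nil
  sgh : Option (Finset Loc)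
  used : Option Bool
  perms : Multiset Perm

/-- Composition of exclusive optional resources. -/
def OptJoin {α : Type} (a b c : Option α) : Prop := (a = none ∧ c = b) ∨ (b = none ∧ c = a)

/-- `r` is the composition of the compatible resources `r₁` and `r₂`. -/
structure Join {Perm : Type u} (r₁ r₂ r : Res Perm) : Prop where
  perm : ∀ l, r.perm l = r₁.perm l + r₂.perm l
  val_left : ∀ l, r₁.perm l ≠ 0 → r.val l = r₁.val l
  val_right : ∀ l, r₂.perm l ≠ 0 → r.val l = r₂.val l
  sgh : OptJoin r₁.sgh r₂.sgh r.sgh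
  used : OptJoin r₁.used r₂.used r.used
  perms : r.perms = r₁.perms + r₂.perms

/-- All resources in a global state. -/
def Global.res {Perm : Type u} (g : Global Perm) : Res Perm where
  perm l := match g.phys.heap l with
    | none => 0
    | some _ => 1
  val l := (g.phys.heap l).getD .nil
  perm_le l := by split <;> simp
  val_nil l h := by
    cases hl : g.phys.heap l with
    | none => rfl
    | some v => simp [hl] at h
  sgh := g.sgh
  used := g.used
  perms := g.phys.perms

/-- Assertions that do not depend on the local state of a thread. -/
abbrev RProp (Perm : Type u) := Res Perm → Prop

/-- Assertions. -/
abbrev Assn (Perm : Type u) := LState → RProp Perm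

section Assertions

variable {Perm : Type u}

/-- `emp` -/
def emp : RProp Perm := fun r =>
  (∀ l, r.perm l = 0) ∧ r.sgh = none ∧ r.used = none ∧ r.perms = 0

/-- Separating conjunction. -/
def rstar (A B : RProp Perm) : RProp Perm := fun r => ∃ r₁ r₂, Join r₁ r₂ r ∧ A r₁ ∧ B r₂

/-- Separating conjunction of assertions. -/
def star (P Q : Assn Perm) : Assn Perm := fun st => rstar (P st) (Q st)

/-- An assertion that does not depend on the local state. -/
def lift (A : RProp Perm) : Assn Perm := fun _ => A

/-- Entailment. The logic is affine: resources may be dropped, so that more permissions entail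
fewer permissions. -/
def REntails (A B : RProp Perm) : Prop := ∀ r, A r → ∃ r₁ r₂, Join r₁ r₂ r ∧ B r₁

/-- Entailment of assertions. -/
def Entails (P Q : Assn Perm) : Prop := ∀ st, REntails (P st) (Q st)

/-- Permission `q` to the location `l`, which stores `v`. -/
def cell (l : Loc) (q : ℚ≥0) (v : Val) : RProp Perm := fun r =>
  q ≠ 0 ∧ (∀ l', r.perm l' = if l' = l then q else 0) ∧ r.val l = v ∧
    r.sgh = none ∧ r.used = none ∧ r.perms = 0

/-- Full permission `acc(l)`. -/
def acc (l : Loc) : RProp Perm := fun r => ∃ v, cell l 1 v r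

/-- The ghost cell `sgh`, with content `S`. -/
def sghCell (S : Finset Loc) : RProp Perm := fun r =>
  (∀ l, r.perm l = 0) ∧ r.sgh = some S ∧ r.used = none ∧ r.perms = 0

/-- The ghost cell `used`, with content `b`. -/
def usedCell (b : Bool) : RProp Perm := fun r =>
  (∀ l, r.perm l = 0) ∧ r.sgh = none ∧ r.used = some b ∧ r.perms = 0

/-- The I/O specification as an assertion. -/
def spec (φ : Multiset Perm → Prop) : RProp Perm := fun r =>
  (∀ l, r.perm l = 0) ∧ r.sgh = none ∧ r.used = none ∧ φ r.perms

/-- Iterated separating conjunction over a list. -/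
def starList (As : List (RProp Perm)) : RProp Perm := As.foldr rstar emp

/-- Iterated separating conjunction over a finite set. -/
noncomputable def starSet (S : Finset Loc) (A : Loc → RProp Perm) : RProp Perm :=
  starList (S.toList.map A)

/-- `v ≠ nil ⟹ acc(v)`; no permission is specified for `nil` and for non-pointers. -/
def accNilable : Val → RProp Perm
  | .loc l => acc l
  | _ => emp

def accNilables (vs : List Val) : RProp Perm := starList (vs.map accNilable)

/-- `v ≠ nil ⟹ inv(v)` -/
def invNilable (inv : Val → RProp Perm) : Val → RProp Perm
  | .loc l => inv (.loc l)
  | _ => emp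

/-- The local program invariant `Π_l`. -/
noncomputable def PiL (inv : Val → RProp Perm) : Assn Perm := fun st =>
  rstar (starSet st.slh acc) (starSet st.sih fun i => inv (.loc i))

/-- The global program invariant `Π_g`. -/
noncomputable def PiG (φ : Multiset Perm → Prop) : RProp Perm := fun r =>
  ∃ S b, rstar (sghCell S) (rstar (starSet S acc)
    (rstar (usedCell b) (if b = true then emp else spec φ))) r

end Assertions

/-! ### Specifications of the Core functions -/

/-- The parts of the specification of the Core: the Core invariant, and the assertions in the
preconditions (`R`, `S k`) and in the postconditions (`R'`, `S' k`) of the constructor and of the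
API functions; they refer to the values of the Core instance, of the arguments and of the
results. -/
structure CoreSpec (Perm : Type u) where
  inv : Val → RProp Perm
  R : List Val → RProp Perm
  R' : Val → List Val → RProp Perm
  S : ℕ → List Val → RProp Perm
  S' : ℕ → Val → List Val → List Val → RProp Perm

namespace CoreSpec

variable {Perm : Type u} (sp : CoreSpec Perm)

/-- `A` specifies nothing but (some of the) permissions for the arguments `vs`: together with the
remaining permissions `F` it amounts to `accNilables vs`. -/
def PermissionsOnly (vs : List Val) (A : RProp Perm) : Prop :=
  ∃ F, REntails (accNilables vs) (rstar A F) ∧ REntails (rstar A F) (accNilables vs)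

/-- The restrictions on the specifications of the Core functions: preconditions specify only
permissions for the arguments, and postconditions return at least these permissions and provide
full permission for the results of API functions. -/
structure Restricted : Prop where
  preAlloc : ∀ vs, PermissionsOnly vs (sp.R vs)
  postAlloc : ∀ v vs, REntails (sp.R' v vs) (sp.R vs)
  preCall : ∀ k vs, PermissionsOnly vs (sp.S k vs)
  postCall : ∀ k v vs ws,
    REntails (sp.S' k v vs ws) (rstar (sp.S k vs) (accNilables ws))

/-- Precondition `φ ⋆ R` of `CoreAlloc(es)`. -/
def preAllocAssn (φ : Multiset Perm → Prop) (es : List Expr) : Assn Perm := fun st r =>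
  ∃ vs, evals st.store es = some vs ∧ rstar (spec φ) (sp.R vs) r

/-- Postcondition `inv(c) ⋆ R'` of `c := CoreAlloc(es)`. -/
def postAllocAssn (c : Var) (es : List Expr) : Assn Perm := fun st r =>
  ∃ v vs, st.store c = some v ∧ evals st.store es = some vs ∧
    rstar (sp.inv v) (sp.R' v vs) r

/-- Precondition `(c ≠ nil ⟹ inv(c)) ⋆ S_k` of `CoreApi_k(c, es)`. -/
def preCallAssn (k : ℕ) (c : Var) (es : List Expr) : Assn Perm := fun st r =>
  ∃ v vs, st.store c = some v ∧ evals st.store es = some vs ∧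
    rstar (invNilable sp.inv v) (sp.S k vs) r

/-- Postcondition `(c ≠ nil ⟹ inv(c)) ⋆ S'_k` of `rs := CoreApi_k(c, es)`. -/
def postCallAssn (k : ℕ) (c : Var) (es : List Expr) (rs : List Var) : Assn Perm := fun st r =>
  ∃ v vs ws, st.store c = some v ∧ evals st.store es = some vs ∧
    evals st.store (rs.map .var) = some ws ∧
    rstar (invNilable sp.inv v) (sp.S' k v vs ws) r

end CoreSpec

/-! ### The proof system -/

/-- Variables and ghost variables of a thread. -/
inductive LVar where
  | var (x : Var)
  | slh
  | sih
  | esc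

/-- Thread-local variables that a statement modifies. -/
def GCmd.mods : GCmd → Set LVar
  | .alloc _ x => {.var x}
  | .read x _ => {.var x}
  | .coreAlloc c _ => {.var c}
  | .coreCall _ _ _ rs => {y | ∃ r ∈ rs, y = .var r}
  | .slhInit | .slhRem _ | .slhAdd _ | .slhRemEsc => {.slh}
  | .sihInit | .sihRem _ | .sihAdd _ => {.sih}
  | .escSet _ => {.esc}
  | .ifLocal _ C₁ C₂ => C₁.mods ∪ C₂.mods
  | .seq C₁ C₂ => C₁.mods ∪ C₂.mods
  | .atomic _ C => C.mods
  | .point _ C => C.mods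
  | _ => ∅

/-- The states agree on all variables outside `M`. -/
def AgreeOff (M : Set LVar) (st st' : LState) : Prop :=
  (∀ x, LVar.var x ∉ M → st.store x = st'.store x) ∧ (LVar.slh ∉ M → st.slh = st'.slh) ∧
    (LVar.sih ∉ M → st.sih = st'.sih) ∧ (LVar.esc ∉ M → st.esc = st'.esc)

/-- A Core statement with behaviour `step` satisfies the triple `{P} _ {Q}`: it transforms a part of
the global state that satisfies `P` into one that satisfies `Q`, whatever the rest of the global
state is, and leaves this rest alone. -/
def CoreValid {Perm : Type u} (step : LState → Global Perm → LState → Global Perm → Prop)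
    (P Q : Assn Perm) : Prop :=
  ∀ st g st' g' r rF, P st r → Join r rF g.res → step st g st' g' →
    ∃ r', Q st' r' ∧ Join r' rF g'.res

/-- `Prov K φ c J P C Q` is the judgement `J ⊢ {P} C {Q}` of concurrent separation logic: the thread
that executes `C` shares the resource described by the invariant `J` with other threads. The side
conditions `ω(s)` may be used at the start of the code `𝔸(s)` for a statement `s` of the codebase
`c` (rules `point` and `atom`; whenever `𝔸(s)` contains an atomic block and `ω(s)` is nontrivial,
the atomic block is the first thing that it executes), provided that they hold
on all traces of `c`. -/
inductive Prov {Perm : Type u} (K : CoreImpl Perm) (φ : Multiset Perm → Prop) (c : Stmt) :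
    RProp Perm → Assn Perm → GCmd → Assn Perm → Prop
  /- structural rules -/
  | conseq {J P P' C Q Q'} : Entails P P' → Prov K φ c J P' C Q' → Entails Q' Q →
      Prov K φ c J P C Q
  | frame {J P C Q} (F : Assn Perm) : (∀ st st', AgreeOff C.mods st st' → F st = F st') →
      Prov K φ c J P C Q → Prov K φ c J (star P F) C (star Q F)
  | ex {J C Q} (Ps : Set (Assn Perm)) : (∀ P ∈ Ps, Prov K φ c J P C Q) →
      Prov K φ c J (fun st r => ∃ P ∈ Ps, P st r) C Q
  | share {J P C Q} (A : RProp Perm) : Prov K φ c (rstar J A) P C Q →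
      Prov K φ c J (star P (lift A)) C (star Q (lift A))
  | point {J P C Q} (s : Stmt) : SideCondition K φ c s →
      Prov K φ c J (fun st r => P st r ∧ ∃ S u, omega s st S u) C Q →
      Prov K φ c J P (.point s C) Q
  | atom {J P C Q} (s : Stmt) : SideCondition K φ c s →
      Prov K φ c emp
        (fun st r => star P (lift J) st r ∧
          ∀ S u, r.sgh = some S → r.used = some u → omega s st S u)
        C (star Q (lift J)) →
      Prov K φ c J P (.atomic s C) Q
  /- control -/
  | skip {J P} : Prov K φ c J P .skip P
  | seq {J P C₁ M C₂ Q} : Prov K φ c J P C₁ M → Prov K φ c J M C₂ Q →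
      Prov K φ c J P (C₁ ;; C₂) Q
  | ifLocal {J P e C₁ C₂ Q} :
      Prov K φ c J
        (fun st r => P st r ∧ ∃ l, e.eval st.store = some (.loc l) ∧ l ∈ st.slh) C₁ Q →
      Prov K φ c J
        (fun st r => P st r ∧ ¬ ∃ l, e.eval st.store = some (.loc l) ∧ l ∈ st.slh) C₂ Q →
      Prov K φ c J P (.ifLocal e C₁ C₂) Q
  | fork {J P P' C Q' xs} :
      (∀ st r, P st r → ∀ st' : LState, st'.store = st.passed xs → P' st' r) →
      Prov K φ c J P' C Q' → Prov K φ c J P (.fork xs C) (lift emp)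
  /- memory -/
  | alloc {J ℓ x} : Prov K φ c J (lift emp) (.alloc ℓ x)
      (fun st r => ∃ l, st.store x = some (.loc l) ∧ acc l r)
  | read {J x e} (l : Loc) (q : ℚ≥0) (v : Val) :
      Prov K φ c J (fun st r => e.eval st.store = some (.loc l) ∧ cell l q v r) (.read x e)
        (fun st r => st.store x = some v ∧ cell l q v r)
  | write {J x e} (l : Loc) :
      Prov K φ c J (fun st r => st.store x = some (.loc l) ∧ acc l r) (.write x e)
        (fun st r => ∃ w, e.eval st.store = some w ∧ cell l 1 w r)
  /- Core functions -/
  | coreAlloc {J P Q x es} : CoreValid (CoreAllocStep K x es) P Q →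
      Prov K φ c J P (.coreAlloc x es) Q
  | coreCall {J P Q k x es rs} : CoreValid (CoreCallStep K k x es rs) P Q →
      Prov K φ c J P (.coreCall k x es rs) Q
  /- assignments to thread-local ghost variables -/
  | slhInit {J P} : Prov K φ c J (fun st => P { st with slh := ∅ }) .slhInit P
  | sihInit {J P} : Prov K φ c J (fun st => P { st with sih := ∅ }) .sihInit P
  | slhRem {J P es} : Prov K φ c J
      (fun st => P { st with slh := st.slh \ st.locs es }) (.slhRem es) P
  | slhAdd {J P es} : Prov K φ c J
      (fun st => P { st with slh := st.slh ∪ st.locs es }) (.slhAdd es) P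
  | sihRem {J P x} : Prov K φ c J
      (fun st => P { st with sih := st.sih \ st.locs [.var x] }) (.sihRem x) P
  | sihAdd {J P x} : Prov K φ c J
      (fun st => P { st with sih := st.sih ∪ st.locs [.var x] }) (.sihAdd x) P
  | escSet {J P es} : Prov K φ c J
      (fun st r => ∀ T, T ⊆ st.slh → P { st with esc := T } r) (.escSet es) P
  | slhRemEsc {J P} : Prov K φ c J
      (fun st => P { st with slh := st.slh \ st.esc }) .slhRemEsc P
  /- ghost cells -/
  | sghNew {J} : Prov K φ c J (lift emp) .sghNew (lift (sghCell ∅))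
  | usedNew {J} : Prov K φ c J (lift emp) .usedNew (lift (usedCell false))
  | sghRem {J es} (S : Finset Loc) : Prov K φ c J (lift (sghCell S)) (.sghRem es)
      (fun st => sghCell (S \ st.locs es))
  | sghAdd {J es} (S : Finset Loc) : Prov K φ c J (lift (sghCell S)) (.sghAdd es)
      (fun st => sghCell (S ∪ st.locs es))
  | sghAddEsc {J} (S : Finset Loc) : Prov K φ c J (lift (sghCell S)) .sghAddEsc
      (fun st => sghCell (S ∪ st.esc))
  | usedSet {J} (b : Bool) : Prov K φ c J (lift (usedCell b)) .usedSet (lift (usedCell true))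

end Diodon

namespace Diodon

universe u

variable {Perm : Type u}

/-! ### The algebra of resources -/

/-! The proof has two layers, joined by the side conditions ω: a derivation that may use them, and
an analysis of traces which shows that they hold.

In the logic, `prov_ghost` derives the triple with `PiL` before and after `𝔸(s)` and with resource
invariant `PiG`, by induction on `s`. If an accessed location is in `slh`, its permission is in
`PiL`; otherwise ω puts it into `*sgh`, and the atomic block opens `PiG`. When locations escape,
their permissions pass from one invariant to the other together with their names. Setting `used`
relieves `PiG` of φ, which pays for the precondition of the Core constructor. The restrictions on
the Core specification allow its preconditions to be carved out of `PiL` and `PiL` to be rebuilt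
from the postconditions (`CoreSpec.PermissionsOnly.split`). After `sInit` the ghost sets are empty
and φ is unspent, so both invariants hold and `prov_program` concludes by the sharing rule.

On traces, ω follows from an invariant `TraceInv`: members of `slh` are local to their thread,
members of `*sgh` are accessible to two threads, and each Application-managed location belongs to
one of these sets. Hence a managed location that a thread can reach lies in its own `slh` or in
`*sgh` (`TraceInv.local_or_global`), and in its own `slh` if it is local (`TraceInv.mem_slh`). The
static judgements say which locations are managed and local.

The difficulty is that Core statements preserve this invariant. Confinement to reachable memory is
too weak, since a Core function could alter what other threads can reach through its own data.
Therefore the assumed triples are used a second time, semantically: by `Prov.core_valid`, a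
derivable triple forces a Core statement to leave alone what its precondition does not describe. To
apply this to the next call, the trace invariant carries a part of memory that satisfies `inv` for
the existing instance and is separate from all managed locations (`CoreOwned`). Another thread
reaches unmanaged memory only through the Core instance, which is impossible while that instance is
local to the caller; and in a call without an instance the memory of the Core belongs to the frame.
There is no circularity: ω for a step comes from the invariant before it and the static judgements,
and a derivation for a Core statement cannot use ω at all. -/

theorem Res.ext_fields {r s : Res Perm} (hp : ∀ l, r.perm l = s.perm l) (hv : ∀ l, r.val l = s.val l)
    (hs : r.sgh = s.sgh) (hu : r.used = s.used) (hq : r.perms = s.perms) : r = s := by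
  cases r; cases s
  obtain rfl := funext hp
  obtain rfl := funext hv
  simp only at hs hu hq
  subst hs hu hq
  rfl

theorem OptJoin.comm {α : Type} {a b c : Option α} (h : OptJoin a b c) : OptJoin b a c :=
  Or.symm h

theorem OptJoin.unique {α : Type} {a b c c' : Option α} (h : OptJoin a b c) (h' : OptJoin a b c') :
    c = c' := by
  rcases h with ⟨rfl, rfl⟩ | ⟨rfl, rfl⟩ <;> rcases h' with ⟨h1, rfl⟩ | ⟨h1, rfl⟩ <;> simp_all

/-- Ghost cells are exclusive, so at most one of `a`, `b`, `c` is present, and `b.or c` is whichever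
of the last two it is. -/
theorem OptJoin.assoc {α : Type} {a b ab c d : Option α} (h : OptJoin a b ab)
    (h' : OptJoin ab c d) : OptJoin b c (b.or c) ∧ OptJoin a (b.or c) d := by
  rcases h with ⟨rfl, rfl⟩ | ⟨rfl, rfl⟩ <;> rcases h' with ⟨rfl, rfl⟩ | ⟨rfl, rfl⟩ <;>
    simp [OptJoin]

theorem OptJoin.eq_of_right {α : Type} {a c : Option α} {b : α} (h : OptJoin a (some b) c) :
    a = none ∧ c = some b := by
  rcases h with ⟨rfl, rfl⟩ | ⟨h, _⟩
  · simp
  · simp at h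

theorem OptJoin.eq_of_left {α : Type} {b c : Option α} {a : α} (h : OptJoin (some a) b c) :
    b = none ∧ c = some a :=
  h.comm.eq_of_right

theorem OptJoin.eq_of_none {α : Type} {b c : Option α} (h : OptJoin none b c) : c = b := by
  rcases h with ⟨_, rfl⟩ | ⟨rfl, rfl⟩ <;> rfl

theorem Join.comm {a b r : Res Perm} (h : Join a b r) : Join b a r where
  perm l := by rw [h.perm, add_comm]
  val_left := h.val_right
  val_right := h.val_left
  sgh := h.sgh.comm
  used := h.used.comm
  perms := by rw [h.perms, add_comm]

theorem Join.unique {a b r r' : Res Perm} (h : Join a b r) (h' : Join a b r') : r = r' := by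
  refine Res.ext_fields (fun l => by rw [h.perm, h'.perm]) (fun l => ?_) (h.sgh.unique h'.sgh)
    (h.used.unique h'.used) (by rw [h.perms, h'.perms])
  by_cases ha : a.perm l = 0
  · by_cases hb : b.perm l = 0
    · rw [r.val_nil l (by rw [h.perm, ha, hb, add_zero]),
        r'.val_nil l (by rw [h'.perm, ha, hb, add_zero])]
    · rw [h.val_right l hb, h'.val_right l hb]
  · rw [h.val_left l ha, h'.val_left l ha]

/-- The resources `b` and `c` are compatible because both sit inside `r`: their permissions add up
to at most those of `r`, and where both have permission `r` records the value of each. -/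
theorem Join.assoc {a b ab c r : Res Perm} (h : Join a b ab) (h' : Join ab c r) :
    ∃ bc, Join b c bc ∧ Join a bc r := by
  have hle : ∀ l, b.perm l + c.perm l ≤ 1 := fun l => by
    refine le_trans ?_ (r.perm_le l)
    rw [h'.perm, h.perm, add_assoc]
    exact le_add_of_nonneg_left (zero_le)
  have hab : ∀ l, b.perm l ≠ 0 → ab.perm l ≠ 0 := fun l hb h0 => by
    rw [h.perm] at h0
    exact hb (add_eq_zero.1 h0).2
  have hcompat : ∀ l, b.perm l ≠ 0 → c.perm l ≠ 0 → b.val l = c.val l := fun l hb hc => by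
    rw [← h'.val_right l hc, h'.val_left l (hab l hb), h.val_right l hb]
  refine ⟨⟨fun l => b.perm l + c.perm l, fun l => if b.perm l = 0 then c.val l else b.val l, hle,
    fun l hl => ?_, b.sgh.or c.sgh, b.used.or c.used, b.perms + c.perms⟩, ?_, ?_⟩
  · obtain ⟨h1, h2⟩ := add_eq_zero.1 hl
    simp [h1, c.val_nil l h2]
  · refine ⟨fun l => rfl, fun l hl => by simp [hl], fun l hl => ?_, (h.sgh.assoc h'.sgh).1,
      (h.used.assoc h'.used).1, rfl⟩
    by_cases hb : b.perm l = 0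
    · simp [hb]
    · simp [hb, hcompat l hb hl]
  · refine ⟨fun l => by rw [h'.perm, h.perm, add_assoc], fun l hl => ?_, fun l hl => ?_,
      (h.sgh.assoc h'.sgh).2, (h.used.assoc h'.used).2, by rw [h'.perms, h.perms, add_assoc]⟩
    · rw [h'.val_left l, h.val_left l hl]
      rw [h.perm]
      exact fun h0 => hl (add_eq_zero.1 h0).1
    · by_cases hb : b.perm l = 0
      · have hc : c.perm l ≠ 0 := fun h0 => hl (by simp [hb, h0])
        simp [hb, h'.val_right l hc]
      · simp [hb, h'.val_left l (hab l hb), h.val_right l hb]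

theorem Join.assoc' {a b c bc r : Res Perm} (h : Join b c bc) (h' : Join a bc r) :
    ∃ ab, Join a b ab ∧ Join ab c r := by
  obtain ⟨x, h1, h2⟩ := h.comm.assoc h'.comm
  exact ⟨x, h1.comm, h2.comm⟩

/-- The empty resource. -/
def Res.zero : Res Perm := ⟨fun _ => 0, fun _ => .nil, by simp, by simp, none, none, 0⟩

theorem emp_zero : emp (Res.zero : Res Perm) := ⟨fun _ => rfl, rfl, rfl, rfl⟩

theorem emp.eq_zero {r : Res Perm} (h : emp r) : r = Res.zero :=
  Res.ext_fields h.1 (fun l => r.val_nil l (h.1 l)) h.2.1 h.2.2.1 h.2.2.2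

theorem Join.zero_left (r : Res Perm) : Join Res.zero r r where
  perm l := by simp [Res.zero]
  val_left l h := by simp [Res.zero] at h
  val_right l h := rfl
  sgh := Or.inl ⟨rfl, rfl⟩
  used := Or.inl ⟨rfl, rfl⟩
  perms := by simp [Res.zero]

theorem Join.zero_right (r : Res Perm) : Join r Res.zero r := (Join.zero_left r).comm

/-- `s` is a part of the resource `r`. -/
def Sub (s r : Res Perm) : Prop := ∃ t, Join s t r

theorem Sub.refl (r : Res Perm) : Sub r r := ⟨_, Join.zero_right r⟩

theorem Join.sub_left {a b r : Res Perm} (h : Join a b r) : Sub a r := ⟨_, h⟩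

theorem Join.sub_right {a b r : Res Perm} (h : Join a b r) : Sub b r := ⟨_, h.comm⟩

theorem Sub.trans {a b r : Res Perm} (h : Sub a b) (h' : Sub b r) : Sub a r := by
  obtain ⟨_, h⟩ := h
  obtain ⟨_, h'⟩ := h'
  obtain ⟨_, _, h⟩ := h.assoc h'
  exact ⟨_, h⟩

theorem Sub.perm_le {a r : Res Perm} (h : Sub a r) (l : Loc) : a.perm l ≤ r.perm l := by
  obtain ⟨_, h⟩ := h
  rw [h.perm]
  exact le_self_add

theorem Sub.val_eq {a r : Res Perm} (h : Sub a r) {l : Loc} (hl : a.perm l ≠ 0) :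
    r.val l = a.val l := by
  obtain ⟨_, h⟩ := h
  exact h.val_left l hl

theorem Sub.perms_le {a r : Res Perm} (h : Sub a r) : a.perms ≤ r.perms := by
  obtain ⟨_, h⟩ := h
  rw [h.perms]
  exact Multiset.le_add_right _ _

theorem Sub.sgh_eq {a r : Res Perm} (h : Sub a r) {S : Finset Loc} (hS : a.sgh = some S) :
    r.sgh = some S := by
  obtain ⟨_, h⟩ := h
  have := h.sgh
  rw [hS] at this
  exact this.eq_of_left.2

theorem Sub.used_eq {a r : Res Perm} (h : Sub a r) {b : Bool} (hb : a.used = some b) :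
    r.used = some b := by
  obtain ⟨_, h⟩ := h
  have := h.used
  rw [hb] at this
  exact this.eq_of_left.2

theorem Sub.perm_one {a r : Res Perm} (h : Sub a r) {l : Loc} (hl : a.perm l = 1) :
    r.perm l = 1 :=
  le_antisymm (r.perm_le l) (hl ▸ h.perm_le l)

/-- Enlarging one part of a composition. -/
theorem Sub.join_left {a a' b r : Res Perm} (h : Join a b r) (hs : Sub a' a) :
    ∃ r', Join a' b r' ∧ Sub r' r := by
  obtain ⟨t, ht⟩ := hs
  obtain ⟨x, h1, h2⟩ := ht.comm.assoc h
  exact ⟨x, h1, h2.sub_right⟩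

/-- Permissions never add up to more than 1, so full permission is exclusive. All disjointness facts
below come from here. -/
theorem Join.perm_zero_of_one {a b r : Res Perm} (h : Join a b r) {l : Loc} (hl : a.perm l = 1) :
    b.perm l = 0 := by
  have h1 := r.perm_le l
  rw [h.perm, hl] at h1
  have h2 : b.perm l ≤ 0 := by
    by_contra hb
    push Not at hb
    exact absurd h1 (not_le.2 (lt_add_of_pos_right 1 hb))
  exact le_antisymm h2 (zero_le)

/-! ### Cutting a resource along a finite set of locations -/

section Restrict

open scoped Classical in
/-- The permissions of `r` for the locations in `T`. -/
noncomputable def Res.restrict (r : Res Perm) (T : Finset Loc) : Res Perm where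
  perm l := if l ∈ T then r.perm l else 0
  val l := if l ∈ T then r.val l else .nil
  perm_le l := by split <;> simp [r.perm_le]
  val_nil l h := by
    by_cases hl : l ∈ T
    · simp only [hl, if_true] at h ⊢
      exact r.val_nil l h
    · simp [hl]
  sgh := none
  used := none
  perms := 0

open scoped Classical in
/-- The part of `r` besides the permissions for the locations in `T`. -/
noncomputable def Res.remove (r : Res Perm) (T : Finset Loc) : Res Perm where
  perm l := if l ∈ T then 0 else r.perm l
  val l := if l ∈ T then .nil else r.val l
  perm_le l := by split <;> simp [r.perm_le]
  val_nil l h := by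
    by_cases hl : l ∈ T
    · simp [hl]
    · simp only [hl, if_false] at h ⊢
      exact r.val_nil l h
  sgh := r.sgh
  used := r.used
  perms := r.perms

theorem Res.join_restrict_remove (r : Res Perm) (T : Finset Loc) :
    Join (r.restrict T) (r.remove T) r where
  perm l := by by_cases h : l ∈ T <;> simp [Res.restrict, Res.remove, h]
  val_left l := by by_cases h : l ∈ T <;> simp [Res.restrict, h]
  val_right l := by by_cases h : l ∈ T <;> simp [Res.remove, h]
  sgh := Or.inl ⟨rfl, rfl⟩
  used := Or.inl ⟨rfl, rfl⟩
  perms := by simp [Res.restrict, Res.remove]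

end Restrict

/-- Full permission for all locations in `T`. -/
def Owns (T : Finset Loc) (r : Res Perm) : Prop := ∀ l ∈ T, r.perm l = 1

theorem Owns.mono {T : Finset Loc} {r s : Res Perm} (h : Owns T r) (hs : Sub r s) : Owns T s :=
  fun l hl => hs.perm_one (h l hl)

/-- Full permission for the locations in `T`, and nothing else. -/
def OwnsExactly (T : Finset Loc) (r : Res Perm) : Prop :=
  (∀ l, r.perm l = if l ∈ T then 1 else 0) ∧ r.sgh = none ∧ r.used = none ∧ r.perms = 0

theorem OwnsExactly.owns {T : Finset Loc} {r : Res Perm} (h : OwnsExactly T r) : Owns T r :=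
  fun l hl => by simp [h.1, hl]

theorem Owns.restrict {T : Finset Loc} {r : Res Perm} (h : Owns T r) :
    OwnsExactly T (r.restrict T) := by
  refine ⟨fun l => ?_, rfl, rfl, rfl⟩
  by_cases hl : l ∈ T
  · simp [Res.restrict, hl, h l hl]
  · simp [Res.restrict, hl]

theorem Owns.remove {T U : Finset Loc} {r : Res Perm} (h : Owns U r) :
    Owns (U \ T) (r.remove T) := fun l hl => by
  rw [Finset.mem_sdiff] at hl
  simp [Res.remove, hl.2, h l hl.1]

theorem ownsExactly_empty_iff {r : Res Perm} : OwnsExactly ∅ r ↔ emp r := by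
  simp [OwnsExactly, emp]

theorem acc_iff {l : Loc} {r : Res Perm} : acc l r ↔ OwnsExactly {l} r := by
  simp [acc, cell, OwnsExactly]

theorem OwnsExactly.join {T U : Finset Loc} {a b r : Res Perm} (ha : OwnsExactly T a)
    (hb : OwnsExactly U b) (h : Join a b r) : Disjoint T U ∧ OwnsExactly (T ∪ U) r := by
  have hd : Disjoint T U := by
    rw [Finset.disjoint_left]
    intro l hT hU
    have h1 := h.perm_zero_of_one (ha.owns l hT)
    rw [hb.owns l hU] at h1
    exact one_ne_zero h1
  refine ⟨hd, fun l => ?_, ?_, ?_, ?_⟩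
  · rw [h.perm, ha.1, hb.1]
    by_cases hT : l ∈ T
    · simp [hT, Finset.disjoint_left.1 hd hT]
    · simp [hT]
  · have := h.sgh
    rw [ha.2.1, hb.2.1] at this
    exact this.eq_of_none
  · have := h.used
    rw [ha.2.2.1, hb.2.2.1] at this
    exact this.eq_of_none
  · rw [h.perms, ha.2.2.2, hb.2.2.2, add_zero]

theorem OwnsExactly.split {T U : Finset Loc} {r : Res Perm} (hd : Disjoint T U)
    (h : OwnsExactly (T ∪ U) r) :
    ∃ a b, Join a b r ∧ OwnsExactly T a ∧ OwnsExactly U b := by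
  refine ⟨_, _, r.join_restrict_remove T,
    Owns.restrict fun l hl => h.owns l (Finset.mem_union_left _ hl), fun l => ?_, h.2⟩
  by_cases hT : l ∈ T
  · simp [Res.remove, hT, Finset.disjoint_left.1 hd hT]
  · simp [Res.remove, hT, h.1]

/-! ### Separating conjunction as a commutative monoid, and its iterations -/

theorem rstar_comm (A B : RProp Perm) : rstar A B = rstar B A := by
  funext r
  exact propext ⟨fun ⟨a, b, h, ha, hb⟩ => ⟨b, a, h.comm, hb, ha⟩,
    fun ⟨a, b, h, ha, hb⟩ => ⟨b, a, h.comm, hb, ha⟩⟩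

theorem rstar_assoc (A B C : RProp Perm) : rstar (rstar A B) C = rstar A (rstar B C) := by
  funext r
  refine propext ⟨?_, ?_⟩
  · rintro ⟨_, c, h', ⟨a, b, h, ha, hb⟩, hc⟩
    obtain ⟨bc, h1, h2⟩ := h.assoc h'
    exact ⟨a, bc, h2, ha, b, c, h1, hb, hc⟩
  · rintro ⟨a, _, h', ha, b, c, h, hb, hc⟩
    obtain ⟨ab, h1, h2⟩ := h.assoc' h'
    exact ⟨ab, c, h2, ⟨a, b, h1, ha, hb⟩, hc⟩

theorem rstar_emp (A : RProp Perm) : rstar A emp = A := by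
  funext r
  refine propext ⟨?_, fun h => ⟨r, _, Join.zero_right r, h, emp_zero⟩⟩
  rintro ⟨a, b, h, ha, hb⟩
  obtain rfl := hb.eq_zero
  rwa [← (Join.zero_right a).unique h]

theorem emp_rstar (A : RProp Perm) : rstar emp A = A := by rw [rstar_comm, rstar_emp]

/-- Frees `starSet` from the arbitrary order in which `Finset.toList` lists a set. -/
theorem starList_perm {As Bs : List (RProp Perm)} (h : As.Perm Bs) : starList As = starList Bs :=
  h.foldr_eq' (fun a _ b _ c => by rw [← rstar_assoc, ← rstar_assoc, rstar_comm b a]) _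

theorem starSet_insert {l : Loc} {S : Finset Loc} (h : l ∉ S) (A : Loc → RProp Perm) :
    starSet (insert l S) A = rstar (A l) (starSet S A) :=
  starList_perm ((Finset.toList_insert h).map A)

theorem starSet_empty (A : Loc → RProp Perm) : starSet ∅ A = emp := by
  simp [starSet, starList]

/-- Replaces an iterated conjunction by a pointwise statement about permissions, which is the form
in which the program invariants are handled from here on. -/
theorem starSet_acc {S : Finset Loc} {r : Res Perm} : starSet S acc r ↔ OwnsExactly S r := by
  classical
  induction S using Finset.induction_on generalizing r with
  | empty => rw [starSet_empty, ownsExactly_empty_iff]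
  | insert l S hl ih =>
    rw [starSet_insert hl, Finset.insert_eq]
    constructor
    · rintro ⟨a, b, h, ha, hb⟩
      exact ((acc_iff.1 ha).join (ih.1 hb) h).2
    · intro h
      obtain ⟨a, b, h, ha, hb⟩ := h.split (by simpa using hl)
      exact ⟨a, b, h, acc_iff.2 ha, ih.2 hb⟩

/-- The locations to which the values `vs` point. -/
def valLocs (vs : List Val) : Finset Loc := (vs.filterMap Val.toLoc).toFinset

theorem mem_valLocs {vs : List Val} {l : Loc} : l ∈ valLocs vs ↔ Val.loc l ∈ vs := by
  simp only [valLocs, List.mem_toFinset, List.mem_filterMap]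
  constructor
  · rintro ⟨v, hv, h⟩
    cases v <;> simp [Val.toLoc] at h
    subst h
    exact hv
  · exact fun h => ⟨_, h, rfl⟩

/-- Each pointer in the list takes full permission to its target, so no target may occur twice. This
is why ω asks that the arguments be pairwise different. -/
theorem accNilables_iff {vs : List Val} {r : Res Perm} :
    accNilables vs r ↔ (vs.filterMap Val.toLoc).Nodup ∧ OwnsExactly (valLocs vs) r := by
  induction vs generalizing r with
  | nil => simp [accNilables, starList, valLocs, ownsExactly_empty_iff]
  | cons v vs ih =>
    change rstar (accNilable v) (accNilables vs) r ↔ _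
    cases v with
    | loc l =>
      have hv : valLocs (.loc l :: vs) = {l} ∪ valLocs vs := by
        ext l'
        simp [mem_valLocs]
      have hn : ((Val.loc l :: vs).filterMap Val.toLoc).Nodup ↔
          l ∉ valLocs vs ∧ (vs.filterMap Val.toLoc).Nodup := by
        simp only [Val.toLoc, List.filterMap_cons, List.nodup_cons, valLocs, List.mem_toFinset]
      rw [hv, hn]
      constructor
      · rintro ⟨a, b, h, ha, hb⟩
        obtain ⟨hn', hb⟩ := ih.1 hb
        obtain ⟨hd, hr⟩ := (acc_iff.1 ha).join hb h
        exact ⟨⟨by simpa using hd, hn'⟩, hr⟩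
      · rintro ⟨⟨hl, hn'⟩, hr⟩
        obtain ⟨a, b, h, ha, hb⟩ := hr.split (by simpa using hl)
        exact ⟨a, b, h, acc_iff.2 ha, ih.2 ⟨hn', hb⟩⟩
    | _ =>
      change rstar emp (accNilables vs) r ↔ _
      rw [emp_rstar, ih]
      exact Iff.rfl

theorem starSet_erase {l : Loc} {S : Finset Loc} (h : l ∈ S) (A : Loc → RProp Perm) :
    starSet S A = rstar (A l) (starSet (S.erase l) A) := by
  rw [← starSet_insert (Finset.notMem_erase l S), Finset.insert_erase h]

/-- Adding an element to an iterated conjunction; if it is a member already, its part is dropped. -/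
theorem starSet_add (l : Loc) (S : Finset Loc) (A : Loc → RProp Perm) {a b r : Res Perm}
    (h : Join a b r) (ha : A l a) (hb : starSet S A b) :
    ∃ r', starSet (insert l S) A r' ∧ Sub r' r := by
  by_cases hl : l ∈ S
  · exact ⟨b, by rwa [Finset.insert_eq_of_mem hl], h.sub_right⟩
  · exact ⟨r, by rw [starSet_insert hl]; exact ⟨a, b, h, ha, hb⟩, Sub.refl r⟩

/-! ### Assertions up to dropping resources -/

/-- Some part of the resource satisfies `A`. -/
def Up (A : RProp Perm) : RProp Perm := fun r => ∃ r', A r' ∧ Sub r' r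

theorem REntails.up {A B : RProp Perm} (h : REntails A B) {r : Res Perm} (hr : Up A r) : Up B r := by
  obtain ⟨r', hA, hs⟩ := hr
  obtain ⟨a, b, hj, hB⟩ := h r' hA
  exact ⟨a, hB, hj.sub_left.trans hs⟩

theorem up_of {A : RProp Perm} {r : Res Perm} (h : A r) : Up A r := ⟨r, h, Sub.refl r⟩

theorem REntails.of_up {A B : RProp Perm} (h : ∀ r, A r → Up B r) : REntails A B := fun r hr => by
  obtain ⟨r', hB, t, ht⟩ := h r hr
  exact ⟨r', t, ht, hB⟩

theorem Up.rstar {A B : RProp Perm} {a b r : Res Perm} (h : Join a b r) (ha : Up A a) (hb : Up B b) :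
    Up (rstar A B) r := by
  obtain ⟨a', ha, hs⟩ := ha
  obtain ⟨b', hb, hs'⟩ := hb
  obtain ⟨x, hx, hxr⟩ := Sub.join_left h hs
  obtain ⟨y, hy, hyx⟩ := Sub.join_left hx.comm hs'
  exact ⟨y, ⟨a', b', hy.comm, ha, hb⟩, hyx.trans hxr⟩

theorem Up.owns_of_accNilables {vs : List Val} {r : Res Perm} (h : Up (accNilables vs) r) :
    Owns (valLocs vs) r := by
  obtain ⟨r', h, hs⟩ := h
  exact (accNilables_iff.1 h).2.owns.mono hs

/-! ### The footprint of Core statements -/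

/-- The permissions for arguments that are specified by `A` can be split off, and when `A` is
returned, full permissions for the arguments are obtained again. -/
theorem CoreSpec.PermissionsOnly.split {vs : List Val} {A : RProp Perm}
    (hA : CoreSpec.PermissionsOnly vs A) (hn : (vs.filterMap Val.toLoc).Nodup) {r : Res Perm}
    (ho : Owns (valLocs vs) r) :
    ∃ a f, Join a f r ∧ A a ∧ ∀ a' r', A a' → Join a' f r' →
      Owns (valLocs vs) r' ∧ Sub (r.remove (valLocs vs)) r' := by
  obtain ⟨F, h1, h2⟩ := hA
  obtain ⟨u, t, hj, a, f₀, haf, ha, hf⟩ := h1 _ (accNilables_iff.2 ⟨hn, ho.restrict⟩)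
  -- The frame `z` collects the complementary permissions `f₀`, what the entailment dropped, and
  -- everything outside the arguments.
  obtain ⟨y, hy1, hy2⟩ := hj.assoc (r.join_restrict_remove (valLocs vs))
  obtain ⟨z, hz1, hz2⟩ := haf.assoc hy2
  refine ⟨a, z, hz2, ha, fun a' r' ha' hj' => ⟨?_, ?_⟩⟩
  · obtain ⟨w, hw, hwr⟩ := Sub.join_left hj'.comm hz1.sub_left
    exact (Up.owns_of_accNilables (h2.up (up_of ⟨a', f₀, hw.comm, ha', hf⟩))).mono hwr
  · exact (hy1.sub_right.trans hz1.sub_right).trans hj'.sub_right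

section CoreSplit

variable {sp : CoreSpec Perm} (hspec : sp.Restricted)
include hspec

/-- Because `R'` entails `R`, any postcondition composed with the unchanged frame `q` gives back
full permission for the arguments. No execution and no derivation is mentioned, so that the
statement serves both the derivation for `𝔸` and the analysis of traces. -/
theorem CoreSpec.Restricted.coreAlloc_split {φ : Multiset Perm → Prop} {x : Var} {es : List Expr}
    {st : LState} {vs : List Val} (hvs : evals st.store es = some vs)
    (hn : (vs.filterMap Val.toLoc).Nodup) {rφ rA r : Res Perm} (hj : Join rφ rA r)
    (hφ : spec φ rφ) (ho : Owns (valLocs vs) rA) :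
    ∃ p q, Join p q r ∧ sp.preAllocAssn φ es st p ∧ ∀ st' p' r', evals st'.store es = some vs →
      sp.postAllocAssn x es st' p' → Join p' q r' →
        ∃ v rI rA', st'.store x = some v ∧ Join rI rA' r' ∧ sp.inv v rI ∧ Owns (valLocs vs) rA' ∧
          Sub (rA.remove (valLocs vs)) rA' := by
  obtain ⟨a, f, haf, ha, hback⟩ := (hspec.preAlloc vs).split hn ho
  obtain ⟨p, hp, hq⟩ := haf.assoc' hj
  refine ⟨p, f, hq, ⟨vs, hvs, rφ, a, hp, hφ, ha⟩, ?_⟩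
  rintro st' p' r' hvs' ⟨v, vs', hv, hvs'', rI, rp, hI, hinv, hR⟩ hj'
  obtain rfl : vs = vs' := by simpa [hvs'] using hvs''
  obtain ⟨rA', h1, h2⟩ := hI.assoc hj'
  obtain ⟨r1, t, ht, hr1⟩ := hspec.postAlloc v vs rp hR
  obtain ⟨y, hy, hyr⟩ := Sub.join_left h1 ht.sub_left
  obtain ⟨g1, g2⟩ := hback r1 y hr1 hy
  exact ⟨v, rI, rA', hv, h2, hinv, g1.mono hyr, g2.trans hyr⟩

theorem CoreSpec.Restricted.coreCall_split {k : ℕ} {x : Var} {es : List Expr} {rs : List Var}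
    {st : LState} {v : Val} {vs : List Val} (hv : st.store x = some v)
    (hvs : evals st.store es = some vs) (hn : (vs.filterMap Val.toLoc).Nodup) {rI rA r : Res Perm}
    (hj : Join rI rA r) (hinv : invNilable sp.inv v rI) (ho : Owns (valLocs vs) rA) :
    ∃ p q, Join p q r ∧ sp.preCallAssn k x es st p ∧ ∀ st' p' r', st'.store x = some v →
      evals st'.store es = some vs → sp.postCallAssn k x es rs st' p' → Join p' q r' →
        ∃ ws rI' rA', evals st'.store (rs.map .var) = some ws ∧ Join rI' rA' r' ∧
          invNilable sp.inv v rI' ∧ Owns (valLocs vs) rA' ∧ Owns (valLocs ws) rA' ∧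
          Sub (rA.remove (valLocs vs)) rA' := by
  obtain ⟨a, f, haf, ha, hback⟩ := (hspec.preCall k vs).split hn ho
  obtain ⟨p, hp, hq⟩ := haf.assoc' hj
  refine ⟨p, f, hq, ⟨v, vs, hv, hvs, rI, a, hp, hinv, ha⟩, ?_⟩
  rintro st' p' r' hv' hvs' ⟨v', vs', ws, hv'', hvs'', hws, rI', rp, hI, hinv', hS⟩ hj'
  obtain rfl : v = v' := by simpa [hv'] using hv''
  obtain rfl : vs = vs' := by simpa [hvs'] using hvs''
  obtain ⟨rA', h1, h2⟩ := hI.assoc hj'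
  obtain ⟨u, t, ht, s, w, hsw, hs, hw⟩ := hspec.postCall k v vs ws rp hS
  obtain ⟨y, hy, hyr⟩ := Sub.join_left h1 (hsw.sub_left.trans ht.sub_left)
  obtain ⟨g1, g2⟩ := hback s y hs hy
  exact ⟨ws, rI', rA', hws, h2, hinv', g1.mono hyr,
    Up.owns_of_accNilables ⟨w, hw, (hsw.sub_right.trans ht.sub_left).trans h1.sub_left⟩,
    g2.trans hyr⟩

end CoreSplit

/-! ### The program invariants up to dropping resources -/

/-- Full permission for the locations in `T`, and the Core invariant for the instances in `I`. -/
def HasLocal (inv : Val → RProp Perm) (T I : Finset Loc) : RProp Perm := fun r =>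
  ∃ rI rA, Join rI rA r ∧ starSet I (fun i => inv (.loc i)) rI ∧ Owns T rA

theorem HasLocal.of_piL {inv : Val → RProp Perm} {st : LState} {r : Res Perm} (h : PiL inv st r) :
    HasLocal inv st.slh st.sih r := by
  obtain ⟨a, b, hj, ha, hb⟩ := h
  exact ⟨b, a, hj.comm, hb, (starSet_acc.1 ha).owns⟩

/-- Unlike the exact assertion `PiL`, `HasLocal` tolerates surplus resources and survives
enlargement; the surplus is dropped only here. -/
theorem HasLocal.up_piL {inv : Val → RProp Perm} {st : LState} {r : Res Perm}
    (h : HasLocal inv st.slh st.sih r) : Up (PiL inv st) r := by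
  obtain ⟨rI, rA, hj, hI, hA⟩ := h
  exact Up.rstar hj.comm ⟨_, starSet_acc.2 hA.restrict, (rA.join_restrict_remove _).sub_left⟩
    (up_of hI)

/-- A resource without permissions for heap locations. -/
def Res.token (s : Option (Finset Loc)) (b : Option Bool) (p : Multiset Perm) : Res Perm :=
  ⟨fun _ => 0, fun _ => .nil, by simp, by simp, s, b, p⟩

/-- The resource with another content of the ghost cell `sgh`. -/
def Res.withSgh (r : Res Perm) (s : Option (Finset Loc)) : Res Perm := { r with sgh := s }

/-- The resource with another content of the ghost cell `used`. -/
def Res.withUsed (r : Res Perm) (b : Option Bool) : Res Perm := { r with used := b }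

/-- The resource with other I/O permissions. -/
def Res.withPerms (r : Res Perm) (p : Multiset Perm) : Res Perm := { r with perms := p }

/-- The remainder does not depend on the content `s`, so that updating the ghost cell amounts to
exchanging the token next to a fixed frame. -/
theorem Res.join_sgh (r : Res Perm) (s : Option (Finset Loc)) :
    Join (Res.token s none 0) (r.withSgh none) (r.withSgh s) where
  perm l := by simp [Res.token, Res.withSgh]
  val_left l h := by simp [Res.token] at h
  val_right l h := rfl
  sgh := Or.inr ⟨rfl, rfl⟩
  used := Or.inl ⟨rfl, rfl⟩
  perms := by simp [Res.token, Res.withSgh]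

theorem Res.join_used (r : Res Perm) (b : Option Bool) :
    Join (Res.token none b 0) (r.withUsed none) (r.withUsed b) where
  perm l := by simp [Res.token, Res.withUsed]
  val_left l h := by simp [Res.token] at h
  val_right l h := rfl
  sgh := Or.inl ⟨rfl, rfl⟩
  used := Or.inr ⟨rfl, rfl⟩
  perms := by simp [Res.token, Res.withUsed]

theorem Res.join_perms (r : Res Perm) {p : Multiset Perm} (h : p ≤ r.perms) :
    ∃ q, Join (Res.token none none p) (r.withPerms q) r := by
  obtain ⟨q, hq⟩ := Multiset.le_iff_exists_add.1 h
  exact ⟨q, fun l => by simp [Res.token, Res.withPerms], fun l h => by simp [Res.token] at h,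
    fun l h => rfl, Or.inl ⟨rfl, rfl⟩, Or.inl ⟨rfl, rfl⟩, hq⟩

theorem sghCell_token (S : Finset Loc) : sghCell S (Res.token (some S) none 0 : Res Perm) :=
  ⟨fun _ => rfl, rfl, rfl, rfl⟩

theorem usedCell_token (b : Bool) : usedCell b (Res.token none (some b) 0 : Res Perm) :=
  ⟨fun _ => rfl, rfl, rfl, rfl⟩

theorem spec_token {φ : Multiset Perm → Prop} {p : Multiset Perm} (h : φ p) :
    spec φ (Res.token none none p : Res Perm) :=
  ⟨fun _ => rfl, rfl, rfl, h⟩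

theorem sghCell.eq_token {S : Finset Loc} {r : Res Perm} (h : sghCell S r) :
    r = Res.token (some S) none 0 :=
  Res.ext_fields h.1 (fun l => r.val_nil l (h.1 l)) h.2.1 h.2.2.1 h.2.2.2

theorem usedCell.eq_token {b : Bool} {r : Res Perm} (h : usedCell b r) :
    r = Res.token none (some b) 0 :=
  Res.ext_fields h.1 (fun l => r.val_nil l (h.1 l)) h.2.1 h.2.2.1 h.2.2.2

theorem spec.eq_token {φ : Multiset Perm → Prop} {r : Res Perm} (h : spec φ r) :
    r = Res.token none none r.perms :=
  Res.ext_fields h.1 (fun l => r.val_nil l (h.1 l)) h.2.1 h.2.2.1 rfl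

/-- The resources of the global program invariant, if the ghost cells contain `S` and `b`. -/
structure HasGlobal (φ : Multiset Perm → Prop) (S : Finset Loc) (b : Bool) (r : Res Perm) :
    Prop where
  owns : Owns S r
  sgh : r.sgh = some S
  used : r.used = some b
  spec : b = false → ∃ p ≤ r.perms, φ p

theorem HasGlobal.mono {φ : Multiset Perm → Prop} {S : Finset Loc} {b : Bool} {r r' : Res Perm}
    (h : HasGlobal φ S b r) (hs : Sub r r') : HasGlobal φ S b r' where
  owns := h.owns.mono hs
  sgh := hs.sgh_eq h.sgh
  used := hs.used_eq h.used
  spec hb := by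
    obtain ⟨p, hp, h⟩ := h.spec hb
    exact ⟨p, hp.trans hs.perms_le, h⟩

theorem HasGlobal.of_piG {φ : Multiset Perm → Prop} {r : Res Perm} (h : PiG φ r) :
    ∃ S b, HasGlobal φ S b r := by
  obtain ⟨S, b, r1, r2, h12, h1, r3, r4, h34, h3, r5, r6, h56, h5, h6⟩ := h
  refine ⟨S, b, ?_, h12.sub_left.sgh_eq h1.2.1, ?_, fun hb => ?_⟩
  · exact ((starSet_acc.1 h3).owns.mono h34.sub_left).mono h12.sub_right
  · exact ((h56.sub_left.trans h34.sub_right).trans h12.sub_right).used_eq h5.2.2.1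
  · subst hb
    exact ⟨r6.perms, ((h56.sub_right.trans h34.sub_right).trans h12.sub_right).perms_le, h6.2.2.2⟩

theorem HasGlobal.up_piG {φ : Multiset Perm → Prop} {S : Finset Loc} {b : Bool} {r : Res Perm}
    (h : HasGlobal φ S b r) : Up (PiG φ) r := by
  have key : Up (Diodon.rstar (sghCell S) (Diodon.rstar (starSet S acc)
      (Diodon.rstar (usedCell b) (if b = true then emp else Diodon.spec φ)))) r := by
    have h1 := r.join_sgh (some S)
    rw [show r.withSgh (some S) = r by rw [← h.sgh]; rfl] at h1
    refine Up.rstar h1 (up_of (sghCell_token S)) ?_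
    have ho : Owns S (r.withSgh none) := h.owns
    refine Up.rstar ((r.withSgh none).join_restrict_remove S) (up_of (starSet_acc.2 ho.restrict)) ?_
    have h2 := ((r.withSgh none).remove S).join_used (some b)
    rw [show ((r.withSgh none).remove S).withUsed (some b) = (r.withSgh none).remove S by
      rw [← h.used]; rfl] at h2
    refine Up.rstar h2 (up_of (usedCell_token b)) ?_
    cases b with
    -- Once `used` is set, φ is no longer owed.
    | true => exact ⟨_, emp_zero, _, Join.zero_left _⟩
    | false =>
      obtain ⟨p, hp, hφ⟩ := h.spec rfl
      obtain ⟨q, hq⟩ := (((r.withSgh none).remove S).withUsed none).join_perms (p := p) hp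
      exact ⟨_, spec_token hφ, hq.sub_left⟩
  obtain ⟨r', hr, hs⟩ := key
  exact ⟨r', ⟨S, b, hr⟩, hs⟩

/-- The resources of a thread inside an atomic block: locations in `T` and Core instances in `I`
belong to it, locations in `S` to the global invariant. -/
def HasBoth (inv : Val → RProp Perm) (φ : Multiset Perm → Prop) (T I S : Finset Loc) (b : Bool) :
    RProp Perm := fun r =>
  ∃ rI rA, Join rI rA r ∧ starSet I (fun i => inv (.loc i)) rI ∧ Owns T rA ∧ Disjoint T S ∧
    HasGlobal φ S b rA

/-- That `T` and `S` are disjoint is not assumed but read off the resources: thread and global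
invariant each hold full permission, and their composition is defined. -/
theorem HasBoth.of_join {inv : Val → RProp Perm} {φ : Multiset Perm → Prop} {T I S : Finset Loc}
    {b : Bool} {a j r : Res Perm} (h : Join a j r) (ha : HasLocal inv T I a)
    (hj : HasGlobal φ S b j) : HasBoth inv φ T I S b r := by
  obtain ⟨rI, rA, hIA, hI, hA⟩ := ha
  obtain ⟨y, hy, hr⟩ := hIA.assoc h
  refine ⟨rI, y, hr, hI, hA.mono hy.sub_left, ?_, hj.mono hy.sub_right⟩
  rw [Finset.disjoint_left]
  intro l hT hS
  have h1 := hy.perm_zero_of_one (hA l hT)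
  rw [hj.owns l hS] at h1
  exact one_ne_zero h1

theorem HasBoth.up_star {inv : Val → RProp Perm} {φ : Multiset Perm → Prop} {st : LState}
    {S : Finset Loc} {b : Bool} {r : Res Perm} (h : HasBoth inv φ st.slh st.sih S b r) :
    Up (star (PiL inv) (lift (PiG φ)) st) r := by
  obtain ⟨rI, rA, hj, hI, hT, hd, hG⟩ := h
  have h1 := rA.join_restrict_remove st.slh
  obtain ⟨y, hy, hr⟩ := h1.assoc' hj
  refine Up.rstar hr (HasLocal.up_piL ⟨rI, _, hy, hI, hT.restrict.owns⟩) (HasGlobal.up_piG (S := S)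
    (b := b) ⟨fun l hl => ?_, hG.sgh, hG.used, hG.spec⟩)
  simp [Res.remove, Finset.disjoint_right.1 hd hl, hG.owns l hl]

/-! ### Variables -/

theorem Expr.eval_congr {σ σ' : Var → Option Val} (e : Expr) (h : ∀ x ∈ e.vars, σ x = σ' x) :
    e.eval σ = e.eval σ' := by
  induction e with
  | var x => exact h x rfl
  | nil | int _ | bool _ => rfl
  | fst a ih | snd a ih | not a ih => simp only [Expr.eval, ih h]
  | pair a b iha ihb | add a b iha ihb | mul a b iha ihb | lt a b iha ihb | eq a b iha ihb
  | and a b iha ihb =>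
    simp only [Expr.eval, iha fun x hx => h x (Or.inl hx), ihb fun x hx => h x (Or.inr hx)]

theorem evals_congr {σ σ' : Var → Option Val} {es : List Expr}
    (h : ∀ e ∈ es, e.eval σ = e.eval σ') : evals σ es = evals σ' es := by
  induction es with
  | nil => rfl
  | cons e es ih =>
    rw [List.forall_mem_cons] at h
    simp only [evals, h.1, ih h.2]

theorem LState.locs_congr {st st' : LState} {es : List Expr}
    (h : ∀ e ∈ es, e.eval st.store = e.eval st'.store) : st.locs es = st'.locs es := by
  unfold LState.locs
  congr 1
  exact List.filterMap_congr fun e he => by rw [h e he]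

theorem LState.locs_eq_valLocs {st : LState} {es : List Expr} {vs : List Val}
    (h : evals st.store es = some vs) : st.locs es = valLocs vs := by
  unfold LState.locs valLocs
  congr 1
  induction es generalizing vs with
  | nil =>
    obtain rfl : [] = vs := by simpa [evals] using h
    rfl
  | cons e es ih =>
    simp only [evals] at h
    split at h
    · rename_i v vs' hv hvs
      obtain rfl : v :: vs' = vs := by simpa using h
      simp [List.filterMap_cons, hv, ih hvs]
    · simp at h

theorem mem_locs {st : LState} {es : List Expr} {l : Loc} :
    l ∈ st.locs es ↔ ∃ e ∈ es, e.eval st.store = some (.loc l) := by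
  simp only [LState.locs, List.mem_toFinset, List.mem_filterMap]
  constructor
  · rintro ⟨e, he, h⟩
    refine ⟨e, he, ?_⟩
    cases hv : e.eval st.store with
    | none => simp [hv] at h
    | some v => cases v <;> simp_all [Val.toLoc]
  · rintro ⟨e, he, h⟩
    exact ⟨e, he, by simp [h, Val.toLoc]⟩

theorem locs_append {st : LState} (es es' : List Expr) :
    st.locs (es ++ es') = st.locs es ∪ st.locs es' := by
  ext l
  simp only [Finset.mem_union, mem_locs, List.mem_append]
  aesop

theorem locs_single {st : LState} {e : Expr} {l : Loc} (h : e.eval st.store = some (.loc l)) :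
    st.locs [e] = {l} := by
  ext l'
  simp [mem_locs, h, eq_comm]

theorem AgreeOff.refl (M : Set LVar) (st : LState) : AgreeOff M st st :=
  ⟨fun _ _ => rfl, fun _ => rfl, fun _ => rfl, fun _ => rfl⟩

theorem AgreeOff.symm {M : Set LVar} {st st' : LState} (h : AgreeOff M st st') :
    AgreeOff M st' st :=
  ⟨fun x hx => (h.1 x hx).symm, fun hx => (h.2.1 hx).symm, fun hx => (h.2.2.1 hx).symm,
    fun hx => (h.2.2.2 hx).symm⟩

theorem AgreeOff.trans {M : Set LVar} {st st' st'' : LState} (h : AgreeOff M st st')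
    (h' : AgreeOff M st' st'') : AgreeOff M st st'' :=
  ⟨fun x hx => (h.1 x hx).trans (h'.1 x hx), fun hx => (h.2.1 hx).trans (h'.2.1 hx),
    fun hx => (h.2.2.1 hx).trans (h'.2.2.1 hx), fun hx => (h.2.2.2 hx).trans (h'.2.2.2 hx)⟩

theorem AgreeOff.eq {st st' : LState} (h : AgreeOff ∅ st st') : st' = st := by
  obtain ⟨h1, h2, h3, h4⟩ := h
  cases st; cases st'
  simp only [Set.mem_empty_iff_false, not_false_eq_true, forall_const] at h1 h2 h3 h4
  obtain rfl := funext h1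
  subst h2 h3 h4
  rfl

theorem AgreeOff.eval {M : Set LVar} {st st' : LState} (h : AgreeOff M st st') {e : Expr}
    (he : ∀ x ∈ e.vars, LVar.var x ∉ M) : e.eval st'.store = e.eval st.store :=
  e.eval_congr fun x hx => (h.1 x (he x hx)).symm

/-! ### Symbolic execution in the proof system -/

section Tri

variable (K : CoreImpl Perm) (φ : Multiset Perm → Prop) (c : Stmt)

/-- A triple whose precondition describes one state. -/
def Tri (J : RProp Perm) (st₀ : LState) (r₀ : Res Perm) (C : GCmd) (Q : Assn Perm) : Prop :=
  Prov K φ c J (fun st r => st = st₀ ∧ r = r₀) C Q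

variable {K φ c} {J : RProp Perm} {st₀ : LState} {r₀ : Res Perm} {C C₁ C₂ : GCmd}
  {P Q Q' M : Assn Perm}

/-- The existential rule ranges over arbitrary sets of assertions, so a triple may be derived
separately for every single state satisfying the precondition. Derivations thereby become symbolic
executions from a known state. -/
theorem prov_of_tri (h : ∀ st₀ r₀, P st₀ r₀ → Tri K φ c J st₀ r₀ C Q) : Prov K φ c J P C Q := by
  refine .conseq ?_ (.ex {P' | ∃ st₀ r₀, P st₀ r₀ ∧ P' = fun st r => st = st₀ ∧ r = r₀} ?_)
    (fun st => REntails.of_up fun r => up_of)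
  · exact fun st => REntails.of_up fun r hr => up_of ⟨_, ⟨st, r, hr, rfl⟩, rfl, rfl⟩
  · rintro P' ⟨st₀, r₀, hP, rfl⟩
    exact h st₀ r₀ hP

theorem Tri.post (h : Tri K φ c J st₀ r₀ C Q') (hQ : ∀ st r, Q' st r → Up (Q st) r) :
    Tri K φ c J st₀ r₀ C Q :=
  Prov.conseq (fun st => REntails.of_up fun _ hr => up_of (A := fun r => st = st₀ ∧ r = r₀) hr) h
    fun st => REntails.of_up (hQ st)

theorem Tri.imp (h : Tri K φ c J st₀ r₀ C Q') (hQ : ∀ st r, Q' st r → Q st r) :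
    Tri K φ c J st₀ r₀ C Q :=
  h.post fun st r hr => up_of (hQ st r hr)

theorem tri_of_prov (h : Prov K φ c J P C Q) (hP : P st₀ r₀) : Tri K φ c J st₀ r₀ C Q :=
  .conseq (fun st => REntails.of_up fun r => by rintro ⟨rfl, rfl⟩; exact up_of hP) h
    fun st => REntails.of_up fun r => up_of

theorem Tri.seq (h : Tri K φ c J st₀ r₀ C₁ M)
    (h' : ∀ st r, M st r → Tri K φ c J st r C₂ Q) : Tri K φ c J st₀ r₀ (C₁ ;; C₂) Q :=
  Prov.seq h (prov_of_tri h')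

/-- The framed assertion fixes the remaining resource and also records agreement with `st₀` off the
modified variables. It is invariant under changes of those variables, as the frame rule demands, and
no knowledge about the others is lost. -/
theorem tri_frame {p f : Res Perm} (h : Prov K φ c J P C Q) (hP : P st₀ p) (hj : Join p f r₀) :
    Tri K φ c J st₀ r₀ C
      (fun st r => AgreeOff C.mods st₀ st ∧ ∃ p', Q st p' ∧ Join p' f r) := by
  refine .conseq ?_ (.frame (fun st r => AgreeOff C.mods st₀ st ∧ r = f) ?_ h) ?_
  · refine fun st => REntails.of_up fun r => ?_
    rintro ⟨rfl, rfl⟩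
    exact up_of ⟨p, f, hj, hP, AgreeOff.refl _ _, rfl⟩
  · intro st st' hst
    funext r
    exact propext ⟨fun h => ⟨h.1.trans hst, h.2⟩, fun h => ⟨h.1.trans hst.symm, h.2⟩⟩
  · refine fun st => REntails.of_up fun r => ?_
    rintro ⟨p', f', hj', hQ, ha, rfl⟩
    exact up_of ⟨ha, p', hQ, hj'⟩

theorem tri_slhInit : Tri K φ c J st₀ r₀ .slhInit
    (fun st r => st = { st₀ with slh := ∅ } ∧ r = r₀) :=
  tri_of_prov (P := fun st r => { st with slh := ∅ } = { st₀ with slh := ∅ } ∧ r = r₀)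
    (.slhInit (P := fun st r => st = { st₀ with slh := ∅ } ∧ r = r₀)) ⟨rfl, rfl⟩

theorem tri_sihInit : Tri K φ c J st₀ r₀ .sihInit
    (fun st r => st = { st₀ with sih := ∅ } ∧ r = r₀) :=
  tri_of_prov (P := fun st r => { st with sih := ∅ } = { st₀ with sih := ∅ } ∧ r = r₀)
    (.sihInit (P := fun st r => st = { st₀ with sih := ∅ } ∧ r = r₀)) ⟨rfl, rfl⟩

theorem tri_slhRem {es : List Expr} : Tri K φ c J st₀ r₀ (.slhRem es)
    (fun st r => st = { st₀ with slh := st₀.slh \ st₀.locs es } ∧ r = r₀) :=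
  tri_of_prov (.slhRem (P := fun st r =>
    st = { st₀ with slh := st₀.slh \ st₀.locs es } ∧ r = r₀)) ⟨rfl, rfl⟩

theorem tri_slhAdd {es : List Expr} : Tri K φ c J st₀ r₀ (.slhAdd es)
    (fun st r => st = { st₀ with slh := st₀.slh ∪ st₀.locs es } ∧ r = r₀) :=
  tri_of_prov (.slhAdd (P := fun st r =>
    st = { st₀ with slh := st₀.slh ∪ st₀.locs es } ∧ r = r₀)) ⟨rfl, rfl⟩

theorem tri_sihRem {x : Var} : Tri K φ c J st₀ r₀ (.sihRem x)
    (fun st r => st = { st₀ with sih := st₀.sih \ st₀.locs [.var x] } ∧ r = r₀) :=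
  tri_of_prov (.sihRem (P := fun st r =>
    st = { st₀ with sih := st₀.sih \ st₀.locs [.var x] } ∧ r = r₀)) ⟨rfl, rfl⟩

theorem tri_sihAdd {x : Var} : Tri K φ c J st₀ r₀ (.sihAdd x)
    (fun st r => st = { st₀ with sih := st₀.sih ∪ st₀.locs [.var x] } ∧ r = r₀) :=
  tri_of_prov (.sihAdd (P := fun st r =>
    st = { st₀ with sih := st₀.sih ∪ st₀.locs [.var x] } ∧ r = r₀)) ⟨rfl, rfl⟩

theorem tri_slhRemEsc : Tri K φ c J st₀ r₀ .slhRemEsc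
    (fun st r => st = { st₀ with slh := st₀.slh \ st₀.esc } ∧ r = r₀) :=
  tri_of_prov (.slhRemEsc (P := fun st r =>
    st = { st₀ with slh := st₀.slh \ st₀.esc } ∧ r = r₀)) ⟨rfl, rfl⟩

/-- The logic cannot see reachability and knows only that `esc` becomes a subset of `slh`. That
suffices for moving permissions; exact reachability matters only on traces. -/
theorem tri_escSet {es : List Expr} : Tri K φ c J st₀ r₀ (.escSet es)
    (fun st r => ∃ T, T ⊆ st₀.slh ∧ st = { st₀ with esc := T } ∧ r = r₀) :=
  tri_of_prov (.escSet (P := fun st r =>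
    ∃ T, T ⊆ st₀.slh ∧ st = { st₀ with esc := T } ∧ r = r₀)) fun T hT => ⟨T, hT, rfl, rfl⟩

/-! ### Symbolic execution for ghost cells and heap accesses -/

theorem tri_sgh {S : Finset Loc} {f : LState → Finset Loc} (hS : r₀.sgh = some S)
    (hC : C.mods = ∅) (h : Prov K φ c J (lift (sghCell S)) C (fun st => sghCell (f st))) :
    Tri K φ c J st₀ r₀ C (fun st r => st = st₀ ∧ r = r₀.withSgh (some (f st₀))) := by
  have hj := r₀.join_sgh (some S)
  rw [show r₀.withSgh (some S) = r₀ by rw [← hS]; rfl] at hj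
  refine (tri_frame h (sghCell_token S) hj).imp ?_
  rintro st r ⟨ha, p', hp, hj'⟩
  rw [hC] at ha
  obtain rfl := ha.eq
  refine ⟨rfl, ?_⟩
  rw [hp.eq_token] at hj'
  exact hj'.unique (r₀.join_sgh _)

theorem tri_sghRem {es : List Expr} {S : Finset Loc} (hS : r₀.sgh = some S) :
    Tri K φ c J st₀ r₀ (.sghRem es)
      (fun st r => st = st₀ ∧ r = r₀.withSgh (some (S \ st₀.locs es))) :=
  tri_sgh hS rfl (.sghRem S)

theorem tri_sghAdd {es : List Expr} {S : Finset Loc} (hS : r₀.sgh = some S) :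
    Tri K φ c J st₀ r₀ (.sghAdd es)
      (fun st r => st = st₀ ∧ r = r₀.withSgh (some (S ∪ st₀.locs es))) :=
  tri_sgh hS rfl (.sghAdd S)

theorem tri_sghAddEsc {S : Finset Loc} (hS : r₀.sgh = some S) :
    Tri K φ c J st₀ r₀ .sghAddEsc
      (fun st r => st = st₀ ∧ r = r₀.withSgh (some (S ∪ st₀.esc))) :=
  tri_sgh hS rfl (.sghAddEsc S)

theorem tri_usedSet {b : Bool} (hb : r₀.used = some b) :
    Tri K φ c J st₀ r₀ .usedSet
      (fun st r => st = st₀ ∧ r = r₀.withUsed (some true)) := by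
  have hj := r₀.join_used (some b)
  rw [show r₀.withUsed (some b) = r₀ by rw [← hb]; rfl] at hj
  refine (tri_frame (.usedSet b) (usedCell_token b) hj).imp ?_
  rintro st r ⟨ha, p', hp, hj'⟩
  obtain rfl := ha.eq
  refine ⟨rfl, ?_⟩
  rw [usedCell.eq_token hp] at hj'
  exact hj'.unique (r₀.join_used _)

theorem tri_sghNew (hS : r₀.sgh = none) : Tri K φ c J st₀ r₀ .sghNew
    (fun st r => st = st₀ ∧ r = r₀.withSgh (some ∅)) := by
  refine (tri_frame .sghNew emp_zero (Join.zero_left r₀)).imp ?_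
  rintro st r ⟨ha, p', hp, hj'⟩
  obtain rfl := ha.eq
  refine ⟨rfl, ?_⟩
  rw [sghCell.eq_token hp] at hj'
  have := r₀.join_sgh (some ∅)
  rw [show r₀.withSgh none = r₀ by rw [← hS]; rfl] at this
  exact hj'.unique this

theorem tri_usedNew (hb : r₀.used = none) : Tri K φ c J st₀ r₀ .usedNew
    (fun st r => st = st₀ ∧ r = r₀.withUsed (some false)) := by
  refine (tri_frame .usedNew emp_zero (Join.zero_left r₀)).imp ?_
  rintro st r ⟨ha, p', hp, hj'⟩
  obtain rfl := ha.eq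
  refine ⟨rfl, ?_⟩
  rw [usedCell.eq_token hp] at hj'
  have := r₀.join_used (some false)
  rw [show r₀.withUsed none = r₀ by rw [← hb]; rfl] at this
  exact hj'.unique this

theorem tri_alloc {ℓ : Label} {x : Var} : Tri K φ c J st₀ r₀ (.alloc ℓ x)
    (fun st r => AgreeOff {.var x} st₀ st ∧ ∃ l a, st.store x = some (.loc l) ∧
      OwnsExactly {l} a ∧ Join a r₀ r) := by
  refine (tri_frame .alloc emp_zero (Join.zero_left r₀)).imp ?_
  rintro st r ⟨ha, p', ⟨l, hl, hp⟩, hj'⟩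
  exact ⟨ha, l, p', hl, acc_iff.1 hp, hj'⟩

theorem Res.cell_restrict {r : Res Perm} {l : Loc} (h : r.perm l = 1) :
    cell l 1 (r.val l) (r.restrict {l}) := by
  have ho : Owns {l} r := by simpa [Owns] using h
  exact ⟨one_ne_zero, fun l' => by simp [ho.restrict.1 l'], by simp [Res.restrict],
    ho.restrict.2⟩

theorem cell.eq_restrict {r s : Res Perm} {l : Loc} (h : r.perm l = 1)
    (hs : cell l 1 (r.val l) s) : s = r.restrict {l} := by
  have h' := Res.cell_restrict h
  refine Res.ext_fields (fun l' => by rw [hs.2.1, h'.2.1]) (fun l' => ?_)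
    (by rw [hs.2.2.2.1, h'.2.2.2.1]) (by rw [hs.2.2.2.2.1, h'.2.2.2.2.1])
    (by rw [hs.2.2.2.2.2, h'.2.2.2.2.2])
  by_cases hl : l' = l
  · rw [hl, hs.2.2.1, h'.2.2.1]
  · rw [s.val_nil l' (by simp [hs.2.1, hl]), Res.val_nil _ l' (by simp [h'.2.1, hl])]

theorem tri_read {x : Var} {e : Expr} {l : Loc} (he : e.eval st₀.store = some (.loc l))
    (hl : r₀.perm l = 1) :
    Tri K φ c J st₀ r₀ (.read x e) (fun st r => AgreeOff {.var x} st₀ st ∧ r = r₀) := by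
  refine (tri_frame (.read l 1 (r₀.val l)) ⟨he, Res.cell_restrict hl⟩
    (r₀.join_restrict_remove {l})).imp ?_
  rintro st r ⟨ha, p', ⟨-, hp⟩, hj⟩
  rw [cell.eq_restrict hl hp] at hj
  exact ⟨ha, hj.unique (r₀.join_restrict_remove _)⟩

/-- The resources agree, except for the values that are stored. -/
structure SameShape (r s : Res Perm) : Prop where
  perm : ∀ l, s.perm l = r.perm l
  sgh : s.sgh = r.sgh
  used : s.used = r.used
  perms : s.perms = r.perms

/-- Writing within the part `a` leaves `f` literally unchanged. This matters when `f` holds Core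
invariants, which may depend on stored values, whereas in `a` only permissions count. -/
theorem tri_write {x : Var} {e : Expr} {l : Loc} {a f : Res Perm}
    (hx : st₀.store x = some (.loc l)) (hj : Join a f r₀) (hl : a.perm l = 1) :
    Tri K φ c J st₀ r₀ (.write x e)
      (fun st r => st = st₀ ∧ ∃ a', SameShape a a' ∧ Join a' f r) := by
  have h1 := a.join_restrict_remove {l}
  obtain ⟨y, hy, hr⟩ := h1.assoc hj
  refine (tri_frame (.write l) ⟨hx, _, Res.cell_restrict hl⟩ hr).imp ?_
  rintro st r ⟨ha, p', ⟨w, hw, hp⟩, hj'⟩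
  obtain rfl := ha.eq
  obtain ⟨a', ha', hr'⟩ := hy.assoc' hj'
  have hc := Res.cell_restrict hl
  refine ⟨rfl, a', ⟨fun l' => by rw [ha'.perm, h1.perm, hp.2.1, hc.2.1], ?_, ?_,
    by rw [ha'.perms, h1.perms, hp.2.2.2.2.2, hc.2.2.2.2.2]⟩, hr'⟩
  · have h2 := ha'.sgh
    rw [hp.2.2.2.1] at h2
    exact h2.eq_of_none
  · have h2 := ha'.used
    rw [hp.2.2.2.2.1] at h2
    exact h2.eq_of_none

theorem Tri.ifLocal {e : Expr}
    (h₁ : ∀ l, e.eval st₀.store = some (.loc l) → l ∈ st₀.slh → Tri K φ c J st₀ r₀ C₁ Q)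
    (h₂ : (¬ ∃ l, e.eval st₀.store = some (.loc l) ∧ l ∈ st₀.slh) → Tri K φ c J st₀ r₀ C₂ Q) :
    Tri K φ c J st₀ r₀ (.ifLocal e C₁ C₂) Q := by
  refine Prov.ifLocal (prov_of_tri ?_) (prov_of_tri ?_)
  · rintro st r ⟨⟨rfl, rfl⟩, l, hl, hm⟩
    exact h₁ l hl hm
  · rintro st r ⟨⟨rfl, rfl⟩, h⟩
    exact h₂ h

theorem Tri.point {s : Stmt} (hs : SideCondition K φ c s)
    (h : ∀ S u, omega s st₀ S u → Tri K φ c J st₀ r₀ C Q) :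
    Tri K φ c J st₀ r₀ (.point s C) Q := by
  refine Prov.point s hs (prov_of_tri ?_)
  rintro st r ⟨⟨rfl, rfl⟩, S, u, hω⟩
  exact h S u hω

/-- Inside the block the ghost cells are in hand, so that ω speaks about their actual contents `S`
and `b`. The conclusion is up to dropping resources because `PiG` has to be restored exactly. -/
theorem Tri.atomic {s : Stmt} (hs : SideCondition K φ c s)
    (h : ∀ S b j r, HasGlobal φ S b j → Join r₀ j r → omega s st₀ S b →
      Tri K φ c emp st₀ r C (fun st r => Up (star Q (lift (PiG φ)) st) r)) :
    Tri K φ c (PiG φ) st₀ r₀ (.atomic s C) Q := by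
  refine Prov.atom s hs (prov_of_tri ?_)
  rintro st r ⟨⟨a, j, hj, ⟨rfl, rfl⟩, hG⟩, hω⟩
  obtain ⟨S, b, hG⟩ := HasGlobal.of_piG hG
  exact (h S b j r hG hj (hω S b (hj.sub_right.sgh_eq hG.sgh) (hj.sub_right.used_eq hG.used))).post
    fun st r h => h

end Tri

/-! ### Derivations for the code that `𝔸` produces -/

theorem HasLocal.mono {inv : Val → RProp Perm} {T T' I : Finset Loc} {r r' : Res Perm}
    (h : HasLocal inv T I r) (hT : T' ⊆ T) (hs : Sub r r') : HasLocal inv T' I r' := by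
  obtain ⟨rI, rA, hj, hI, hA⟩ := h
  obtain ⟨t, ht⟩ := hs
  obtain ⟨y, hy, hr⟩ := hj.assoc ht
  exact ⟨rI, y, hr, hI, fun l hl => (hA.mono hy.sub_left) l (hT hl)⟩

theorem HasLocal.owns {inv : Val → RProp Perm} {T I : Finset Loc} {r : Res Perm}
    (h : HasLocal inv T I r) : Owns T r := by
  obtain ⟨rI, rA, hj, hI, hA⟩ := h
  exact hA.mono hj.sub_right

theorem HasLocal.add {inv : Val → RProp Perm} {T U I : Finset Loc} {a r r' : Res Perm}
    (h : HasLocal inv T I r) (ha : Owns U a) (hj : Join a r r') : HasLocal inv (T ∪ U) I r' := by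
  obtain ⟨rI, rA, hj', hI, hA⟩ := h
  obtain ⟨y, hy, hr⟩ := hj'.assoc hj.comm
  refine ⟨rI, y, hr, hI, fun l hl => ?_⟩
  rcases Finset.mem_union.1 hl with hl | hl
  · exact hA.mono hy.sub_left l hl
  · exact ha.mono hy.sub_right l hl

theorem SameShape.owns {T : Finset Loc} {r s : Res Perm} (h : SameShape r s) (ho : Owns T r) :
    Owns T s := fun l hl => by rw [h.perm, ho l hl]

theorem Join.withSgh {a r s : Res Perm} (h : Join a r s) {S : Finset Loc} (hr : r.sgh = some S)
    (S' : Finset Loc) : Join a (r.withSgh (some S')) (s.withSgh (some S')) where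
  perm := h.perm
  val_left := h.val_left
  val_right := h.val_right
  sgh := by
    have := h.sgh
    rw [hr] at this
    exact Or.inl ⟨this.eq_of_right.1, rfl⟩
  used := h.used
  perms := h.perms

theorem Join.withUsed {a r s : Res Perm} (h : Join a r s) {b : Bool} (hr : r.used = some b)
    (b' : Bool) : Join a (r.withUsed (some b')) (s.withUsed (some b')) where
  perm := h.perm
  val_left := h.val_left
  val_right := h.val_right
  sgh := h.sgh
  used := by
    have := h.used
    rw [hr] at this
    exact Or.inl ⟨this.eq_of_right.1, rfl⟩
  perms := h.perms

theorem valLocs_single (v : Val) : valLocs [v] = match v with | .loc l => {l} | _ => ∅ := by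
  cases v <;> rfl

theorem starSet_take {inv : Val → RProp Perm} {I : Finset Loc} {v : Val} {r : Res Perm}
    (h : starSet I (fun i => inv (.loc i)) r) (hv : ∀ l, v = .loc l → l ∈ I) :
    ∃ a b, Join a b r ∧ invNilable inv v a ∧
      starSet (I \ valLocs [v]) (fun i => inv (.loc i)) b := by
  cases v with
  | loc l =>
    rw [starSet_erase (hv l rfl)] at h
    obtain ⟨a, b, hj, ha, hb⟩ := h
    exact ⟨a, b, hj, ha, by rwa [valLocs_single, Finset.sdiff_singleton_eq_erase]⟩
  | _ => exact ⟨_, r, Join.zero_left r, emp_zero, by rw [valLocs_single]; simpa using h⟩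

theorem starSet_put {inv : Val → RProp Perm} {I : Finset Loc} {v : Val} {a b r : Res Perm}
    (hj : Join a b r) (ha : invNilable inv v a) (hb : starSet I (fun i => inv (.loc i)) b) :
    Up (starSet (I ∪ valLocs [v]) (fun i => inv (.loc i))) r := by
  cases v with
  | loc l =>
    rw [valLocs_single, Finset.union_comm, ← Finset.insert_eq]
    exact starSet_add l I _ hj ha hb
  | _ => rw [valLocs_single]; exact ⟨b, by simpa using hb, hj.sub_right⟩

theorem up_invNilable {inv : Val → RProp Perm} {v : Val} {r : Res Perm} (h : inv v r) :
    Up (invNilable inv v) r := by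
  cases v with
  | loc l => exact up_of h
  | _ => exact ⟨_, emp_zero, _, Join.zero_left r⟩

theorem HasLocal.of_up {inv : Val → RProp Perm} {T I : Finset Loc} {rI rA r : Res Perm}
    (hj : Join rI rA r) (hI : Up (starSet I fun i => inv (.loc i)) rI) (hA : Owns T rA) :
    HasLocal inv T I r := by
  obtain ⟨a, ha, hs⟩ := hI
  obtain ⟨y, hy, hyr⟩ := Sub.join_left hj hs
  exact HasLocal.mono ⟨a, rA, hy, ha, hA⟩ (Finset.Subset.refl _) hyr

/-- Scoping serves only to show that assigned variables do not occur in the operands of the same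
statement; for this any `Δ'` will do. -/
theorem Stmt.Scoped.subs {Δ : Set Var} {s s' : Stmt} (h : s.Scoped Δ) (hs : s' ∈ s.subs) :
    ∃ Δ', s'.Scoped Δ' := by
  induction s generalizing Δ with
  | seq ℓ s₁ s₂ ih₁ ih₂ =>
    simp only [Stmt.subs, List.mem_cons, List.mem_append] at hs
    rcases hs with rfl | hs | hs
    · exact ⟨Δ, h⟩
    · exact ih₁ h.1 hs
    · exact ih₂ h.2 hs
  | fork ℓ xs s ih =>
    simp only [Stmt.subs, List.mem_cons] at hs
    rcases hs with rfl | hs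
    · exact ⟨Δ, h⟩
    · exact ih h.2 hs
  | _ =>
    simp only [Stmt.subs, List.mem_singleton] at hs
    subst hs
    exact ⟨Δ, h⟩

/-- What the derivation for the code `𝔸(s)` needs to know about a statement `s`. -/
structure Derivable (K : CoreImpl Perm) (sp : CoreSpec Perm) (φ : Multiset Perm → Prop) (c s : Stmt) :
    Prop where
  side : SideCondition K φ c s
  wellScoped : ∃ Δ, s.Scoped Δ
  alloc : ∀ ℓ x es, s = .coreAlloc ℓ x es →
    Prov K φ c (PiG φ) (sp.preAllocAssn φ es) (.coreAlloc x es) (sp.postAllocAssn x es)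
  call : ∀ ℓ k x es rs, s = .coreCall ℓ k x es rs →
    Prov K φ c (PiG φ) (sp.preCallAssn k x es) (.coreCall k x es rs) (sp.postCallAssn k x es rs)

section Ghost

variable {K : CoreImpl Perm} {sp : CoreSpec Perm} {φ : Multiset Perm → Prop} {c : Stmt}
  {inv : Val → RProp Perm} {st₀ : LState} {r₀ : Res Perm}

theorem Tri.piL {J : RProp Perm} {C : GCmd}
    (h : Tri K φ c J st₀ r₀ C fun st r => HasLocal inv st.slh st.sih r) :
    Tri K φ c J st₀ r₀ C (PiL inv) :=
  h.post fun _ _ hr => hr.up_piL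

theorem tri_ghost_alloc {J : RProp Perm} {ℓ : Label} {x : Var}
    (h : HasLocal inv st₀.slh st₀.sih r₀) :
    Tri K φ c J st₀ r₀ (ghost (.alloc ℓ x)) (PiL inv) := by
  refine Tri.piL (tri_alloc.seq ?_)
  rintro st₁ r ⟨ha, l, a, hl, ho, hj⟩
  refine tri_slhAdd.imp ?_
  rintro st r ⟨rfl, rfl⟩
  rw [locs_single (e := .var x) hl]
  dsimp only
  rw [← ha.2.1 (by simp), ← ha.2.2.1 (by simp)]
  exact h.add ho.owns hj

theorem tri_ghost_read {ℓ : Label} {x : Var} {e : Expr}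
    (hs : Derivable K sp φ c (.read ℓ x e)) (h : HasLocal inv st₀.slh st₀.sih r₀) :
    Tri K φ c (PiG φ) st₀ r₀ (ghost (.read ℓ x e)) (PiL inv) := by
  -- By single assignment `e` still points to the same location after the read, so that the ghost
  -- code puts back exactly what it took out.
  have hxe : ∀ y ∈ e.vars, LVar.var y ∉ ({.var x} : Set LVar) := by
    obtain ⟨Δ, hx, he⟩ := hs.wellScoped
    intro y hy hyx
    obtain rfl : y = x := by simpa using hyx
    exact hx (he hy)
  refine Tri.point hs.side fun _ _ _ => Tri.ifLocal (fun l hl hm => ?_) (fun hnl => ?_)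
  · refine Tri.piL (tri_slhRem.seq ?_)
    rintro st₁ r ⟨rfl, rfl⟩
    refine (tri_read (l := l) (by exact hl) (h.owns l hm)).seq ?_
    rintro st₂ r ⟨ha, rfl⟩
    refine tri_slhAdd.imp ?_
    rintro st r ⟨rfl, rfl⟩
    have he := ha.eval hxe
    dsimp only at he ⊢
    rw [hl] at he
    rw [locs_single he, ← ha.2.1 (by simp), ← ha.2.2.1 (by simp), locs_single hl]
    refine h.mono (fun l' hl' => ?_) (Sub.refl _)
    rw [Finset.mem_union, Finset.mem_sdiff, Finset.mem_singleton] at hl'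
    rcases hl' with hl' | rfl
    · exact hl'.1
    · exact hm
  · refine Tri.atomic hs.side fun S b j r hG hj hω => ?_
    obtain ⟨l, hl, hm⟩ := hω
    -- The test `e ∈ slh` has failed, so ω leaves only `*sgh`.
    have hS : l ∈ S := by
      rcases Finset.mem_union.1 hm with hm | hm
      · exact absurd ⟨l, hl, hm⟩ hnl
      · exact hm
    have hB := HasBoth.of_join hj h hG
    refine (tri_sghRem (hj.sub_right.sgh_eq hG.sgh)).seq ?_
    rintro st₁ r₁ ⟨rfl, rfl⟩
    refine (tri_read (r₀ := r.withSgh _) hl (by exact hG.owns.mono hj.sub_right l hS)).seq ?_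
    rintro st₂ r₂ ⟨ha, rfl⟩
    refine (tri_sghAdd (S := S \ st₁.locs [e]) rfl).imp ?_
    rintro st r' ⟨rfl, rfl⟩
    have he := ha.eval hxe
    rw [hl] at he
    have hSS : S \ st₁.locs [e] ∪ st.locs [e] = S := by
      rw [locs_single he, locs_single hl]
      exact Finset.sdiff_union_of_subset (by simpa using hS)
    rw [hSS]
    have hr : (r.withSgh (some (S \ st₁.locs [e]))).withSgh (some S) = r := by
      rw [← hj.sub_right.sgh_eq hG.sgh]
      rfl
    rw [hr]
    rw [ha.2.1 (by simp), ha.2.2.1 (by simp)] at hB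
    exact hB.up_star

theorem tri_ghost_write {ℓ : Label} {x : Var} {e : Expr}
    (hs : Derivable K sp φ c (.write ℓ x e)) (h : HasLocal inv st₀.slh st₀.sih r₀) :
    Tri K φ c (PiG φ) st₀ r₀ (ghost (.write ℓ x e)) (PiL inv) := by
  refine Tri.point hs.side fun _ _ _ => Tri.ifLocal (fun l hl hm => ?_) (fun hnl => ?_)
  · refine Tri.piL (tri_slhRem.seq ?_)
    rintro st₁ r ⟨rfl, rfl⟩
    obtain ⟨rI, rA, hj, hI, hA⟩ := h
    refine (tri_write (l := l) (by exact hl) hj.comm (hA l hm)).seq ?_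
    rintro st₂ r ⟨rfl, a', hsh, hj'⟩
    refine tri_slhAdd.imp ?_
    rintro st r ⟨rfl, rfl⟩
    refine ⟨rI, a', hj'.comm, hI, fun l' hl' => hsh.owns hA l' ?_⟩
    change l' ∈ st₀.slh \ st₀.locs [.var x] ∪ st₀.locs [.var x] at hl'
    rw [locs_single (e := .var x) hl, Finset.mem_union, Finset.mem_sdiff,
      Finset.mem_singleton] at hl'
    rcases hl' with hl' | rfl
    · exact hl'.1
    · exact hm
  · refine Tri.atomic hs.side fun S b j r hG hj hω => ?_
    obtain ⟨l, hl, hm⟩ := hω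
    have hS : l ∈ S := by
      rcases Finset.mem_union.1 hm with hm | hm
      · exact absurd ⟨l, hl, hm⟩ hnl
      · exact hm
    obtain ⟨rI, rA, hIA, hI, hA, hd, hGA⟩ := HasBoth.of_join hj h hG
    refine (tri_sghRem (hj.sub_right.sgh_eq hG.sgh)).seq ?_
    rintro st₁ r₁ ⟨rfl, rfl⟩
    refine tri_escSet.seq ?_
    rintro st₂ r₂ ⟨T, hT, rfl, rfl⟩
    refine tri_slhRemEsc.seq ?_
    rintro st₃ r₃ ⟨rfl, rfl⟩
    have hIA' := hIA.withSgh hGA.sgh (S \ st₁.locs [.var x])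
    refine (tri_write (l := l) (by exact hl) hIA'.comm (hGA.owns l hS)).seq ?_
    rintro st₄ r₄ ⟨rfl, a', hsh, hj'⟩
    have hs4 : r₄.sgh = some (S \ st₁.locs [.var x]) :=
      hj'.sub_left.sgh_eq (by rw [hsh.sgh]; rfl)
    refine (tri_sghAdd hs4).seq ?_
    rintro st₅ r₅ ⟨rfl, rfl⟩
    refine (tri_sghAddEsc rfl).imp ?_
    rintro st r ⟨rfl, rfl⟩
    have hset : S \ st₁.locs [.var x] ∪ LState.locs
        { st₁ with esc := T, slh := st₁.slh \ T } [.var x] = S := by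
      change S \ st₁.locs [.var x] ∪ st₁.locs [.var x] = S
      rw [locs_single (e := .var x) hl]
      exact Finset.sdiff_union_of_subset (by simpa using hS)
    have hset' : (r₄.withSgh (some (S \ st₁.locs [.var x] ∪ LState.locs
        { st₁ with esc := T, slh := st₁.slh \ T } [.var x]))).withSgh
        (some (S \ st₁.locs [.var x] ∪ LState.locs
        { st₁ with esc := T, slh := st₁.slh \ T } [.var x] ∪ T)) = r₄.withSgh (some (S ∪ T)) := by
      rw [hset]
      rfl
    change Up _ ((r₄.withSgh _).withSgh _)
    rw [hset']
    -- `rA` holds the permissions of both the thread and the global invariant. Letting `T` escape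
    -- therefore moves no resource; only the line between the two sets is redrawn.
    refine HasBoth.up_star (S := S ∪ T) (b := b)
      ⟨rI, a'.withSgh (some (S ∪ T)), hj'.comm.withSgh (by rw [hsh.sgh]; rfl) _, hI, ?_, ?_, ?_⟩
    · intro l' hl'
      have := hA l' (Finset.mem_sdiff.1 hl').1
      rw [← this]
      exact hsh.perm l'
    · rw [Finset.disjoint_union_right]
      exact ⟨hd.mono_left Finset.sdiff_subset, Finset.sdiff_disjoint⟩
    · refine ⟨fun l' hl' => (hsh.perm l').trans ?_, rfl, hsh.used.trans hGA.used, ?_⟩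
      · rcases Finset.mem_union.1 hl' with hl' | hl'
        · exact hGA.owns l' hl'
        · exact hA l' (hT hl')
      · change b = false → ∃ p ≤ a'.perms, φ p
        rw [hsh.perms]
        exact hGA.spec

theorem HasLocal.put {v : Val} {T I : Finset Loc} {rI rA y rest r : Res Perm}
    (hy : Join rI rA y) (hr : Join y rest r) (hv : Up (invNilable inv v) rI)
    (hI : starSet I (fun i => inv (.loc i)) rest) (hA : Owns T rA) :
    HasLocal inv T (I ∪ valLocs [v]) r := by
  obtain ⟨a, ha, hs⟩ := hv
  obtain ⟨z, hz, hzr⟩ := hy.comm.assoc hr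
  obtain ⟨w, hw, hwz⟩ := Sub.join_left hz hs
  obtain ⟨u, hu, huw⟩ := starSet_put hw ha hI
  exact HasLocal.of_up hzr.comm ⟨u, hu, huw.trans hwz⟩ hA

/-- A call returns the permissions in `V`, and those outside `V` were never handed over. -/
theorem owns_of_remove {T V : Finset Loc} {r r' : Res Perm} (h : Owns T r) (hV : Owns V r')
    (hs : Sub (r.remove V) r') : Owns T r' := fun l hl => by
  by_cases hlV : l ∈ V
  · exact hV l hlV
  · exact h.remove.mono hs l (Finset.mem_sdiff.2 ⟨hl, hlV⟩)

theorem tri_ghost_coreAlloc (hspec : sp.Restricted) {ℓ : Label} {x : Var} {es : List Expr}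
    (hs : Derivable K sp φ c (.coreAlloc ℓ x es)) (h : HasLocal sp.inv st₀.slh st₀.sih r₀) :
    Tri K φ c (PiG φ) st₀ r₀ (ghost (.coreAlloc ℓ x es)) (PiL sp.inv) := by
  obtain ⟨Δ, hx, hes⟩ := hs.wellScoped
  refine Tri.point hs.side ?_
  rintro - - ⟨-, vs, hvs, hmem, hn⟩
  have hmem : valLocs vs ⊆ st₀.slh := fun l hl => hmem l (List.mem_toFinset.1 hl)
  -- After the atomic block the thread holds φ besides its local resources: `PiG` no longer asks for
  -- it once `used` is true.
  refine Tri.piL (Tri.seq (M := fun st r => st = st₀ ∧ ∃ rφ r₁, Join rφ r₁ r ∧ spec φ rφ ∧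
    HasLocal sp.inv st₀.slh st₀.sih r₁) (Tri.atomic hs.side ?_) ?_)
  · intro S b j r hG hj hω
    -- By ω the flag is not yet set, so `PiG` still contains φ.
    obtain rfl : b = false := hω.1
    refine (tri_usedSet (hj.sub_right.used_eq hG.used)).imp ?_
    rintro st r' ⟨rfl, rfl⟩
    obtain ⟨p, hp, hφ⟩ := hG.spec rfl
    obtain ⟨q, hq⟩ := j.join_perms hp
    have hq' : Join (Res.token none none p) ((j.withPerms q).withUsed (some true))
        (j.withUsed (some true)) := hq.withUsed hG.used true
    obtain ⟨y, hy, hr⟩ := hq'.assoc' (hj.withUsed hG.used true)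
    exact Up.rstar hr (up_of ⟨rfl, _, _, hy.comm, spec_token hφ, h⟩)
      (HasGlobal.up_piG (S := S) (b := true) ⟨hG.owns, hG.sgh, rfl, by simp⟩)
  · rintro st r ⟨rfl, rφ, r₁, hj, hφ, rI, rA, hIA, hI, hA⟩
    -- `y` consists of φ and the location permissions, from which the precondition is taken; the
    -- invariants `rI` of instances in `sih` are set aside.
    obtain ⟨y, hy, hr⟩ := hIA.comm.assoc' hj
    refine tri_slhRem.seq ?_
    rintro st₁ r' ⟨rfl, rfl⟩
    obtain ⟨p, q, hpq, hpre, hpost⟩ := hspec.coreAlloc_split (x := x)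
      (st := { st with slh := st.slh \ st.locs es }) hvs hn hy hφ
      fun l hl => hA l (hmem hl)
    obtain ⟨f, hf, hpf⟩ := hpq.assoc hr
    refine (tri_frame (hs.alloc ℓ x es rfl) hpre hpf).seq ?_
    rintro st₂ r₂ ⟨ha, p', hQ, hp'⟩
    obtain ⟨y', hy', hr'⟩ := hf.assoc' hp'
    have heval : ∀ e ∈ es, e.eval st₂.store = e.eval st.store := fun e he =>
      ha.eval fun z hz hzx => hx (by
        obtain rfl : z = x := by simpa [GCmd.mods] using hzx
        exact hes e he hz)
    have hvs' := (evals_congr heval).trans hvs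
    obtain ⟨v, rI', rA', hv, hj', hinv, ho, hsub⟩ := hpost st₂ p' y' hvs' hQ hy'
    refine tri_slhAdd.seq ?_
    rintro st₃ r₃ ⟨rfl, rfl⟩
    refine tri_sihAdd.imp ?_
    rintro st₄ r₄ ⟨rfl, rfl⟩
    have hlx : LState.locs { st₂ with slh := st₂.slh ∪ st₂.locs es } [.var x] = valLocs [v] :=
      LState.locs_eq_valLocs (by simp [evals, Expr.eval, hv])
    rw [hlx]
    dsimp only
    rw [← ha.2.1 (by simp [GCmd.mods]), ← ha.2.2.1 (by simp [GCmd.mods]),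
      LState.locs_eq_valLocs hvs, LState.locs_eq_valLocs hvs',
      Finset.sdiff_union_of_subset hmem]
    exact HasLocal.put hj' hr' (up_invNilable hinv) hI (owns_of_remove hA ho hsub)

theorem tri_ghost_coreCall (hspec : sp.Restricted) {ℓ : Label} {k : ℕ} {x : Var} {es : List Expr}
    {rs : List Var} (hs : Derivable K sp φ c (.coreCall ℓ k x es rs))
    (h : HasLocal sp.inv st₀.slh st₀.sih r₀) :
    Tri K φ c (PiG φ) st₀ r₀ (ghost (.coreCall ℓ k x es rs)) (PiL sp.inv) := by
  obtain ⟨Δ, hx, hes, hrs⟩ := hs.wellScoped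
  refine Tri.point hs.side ?_
  rintro - - ⟨⟨vs, hvs, hmem, hn⟩, v, hv, hvI⟩
  have hmem : valLocs vs ⊆ st₀.slh := fun l hl => hmem l (List.mem_toFinset.1 hl)
  refine Tri.piL (tri_sihRem.seq ?_)
  rintro st₁ r ⟨rfl, rfl⟩
  refine tri_slhRem.seq ?_
  rintro st₁ r' ⟨rfl, rfl⟩
  obtain ⟨rI, rA, hIA, hI, hA⟩ := h
  -- If the instance is `nil`, nothing is taken out and `ri` is empty.
  obtain ⟨ri, rest, hri, hinv, hrest⟩ := starSet_take hI hvI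
  obtain ⟨y, hy, hr₀⟩ := hri.comm.assoc hIA
  have hr := hr₀.comm
  obtain ⟨p, q, hpq, hpre, hpost⟩ := hspec.coreCall_split (x := x) (k := k) (rs := rs)
    (st := { st₀ with
      sih := st₀.sih \ st₀.locs [.var x]
      slh := st₀.slh \ LState.locs { st₀ with sih := st₀.sih \ st₀.locs [.var x] } es }) hv hvs hn
    hy hinv fun l hl => hA l (hmem hl)
  obtain ⟨f, hf, hpf⟩ := hpq.assoc hr
  refine (tri_frame (hs.call ℓ k x es rs rfl) hpre hpf).seq ?_
  rintro st₂ r₂ ⟨ha, p', hQ, hp'⟩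
  obtain ⟨y', hy', hr'⟩ := hf.assoc' hp'
  -- The result variables are new, so the instance and the arguments keep their values and the ghost
  -- code restores the sets it has reduced.
  have hmods : ∀ z ∈ Δ, LVar.var z ∉ (GCmd.coreCall k x es rs).mods := by
    rintro z hz ⟨r, hr, hzr⟩
    obtain rfl : z = r := by simpa using hzr
    exact hrs z hr hz
  have heval : ∀ e ∈ es, e.eval st₂.store = e.eval st₀.store := fun e he =>
    ha.eval fun z hz => hmods z (hes e he hz)
  have hvs' := (evals_congr heval).trans hvs
  have hv' : st₂.store x = some v := (ha.1 x (hmods x hx)).symm.trans hv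
  obtain ⟨ws, rI', rA', hws, hj', hinv', ho, how, hsub⟩ := hpost st₂ p' y' hv' hvs' hQ hy'
  refine tri_slhAdd.seq ?_
  rintro st₃ r₃ ⟨rfl, rfl⟩
  refine tri_sihAdd.imp ?_
  rintro st₄ r₄ ⟨rfl, rfl⟩
  have hlx : LState.locs
      { st₂ with slh := st₂.slh ∪ st₂.locs (es ++ rs.map .var) } [.var x] = valLocs [v] :=
    LState.locs_eq_valLocs (by simp [evals, Expr.eval, hv'])
  have hlx' : st₀.locs [.var x] = valLocs [v] :=
    LState.locs_eq_valLocs (by simp [evals, Expr.eval, hv])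
  have hlv : LState.locs { st₀ with sih := st₀.sih \ st₀.locs [.var x] } es = valLocs vs :=
    LState.locs_eq_valLocs hvs
  rw [hlx]
  dsimp only
  rw [← ha.2.1 (by simp [GCmd.mods]), ← ha.2.2.1 (by simp [GCmd.mods]), locs_append,
    LState.locs_eq_valLocs hvs', LState.locs_eq_valLocs hws, hlv, hlx', ← Finset.union_assoc,
    Finset.sdiff_union_of_subset hmem]
  refine HasLocal.put hj' hr' (up_of hinv') hrest fun l hl => ?_
  rcases Finset.mem_union.1 hl with hl | hl
  · exact owns_of_remove hA ho hsub l hl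
  · exact how l hl

/-- A forked thread starts with empty ghost sets and needs no resources of its own; the whole
resource stays with the parent. -/
theorem tri_fork {J : RProp Perm} {xs : List Var} {C : GCmd} {Q' : Assn Perm}
    (h : Prov K φ c J (lift emp) C Q') :
    Tri K φ c J st₀ r₀ (.fork xs C) (fun st r => st = st₀ ∧ r = r₀) := by
  refine (tri_frame (.fork (P := lift emp) (P' := lift emp) (fun _ _ h _ _ => h) h) emp_zero
    (Join.zero_left r₀)).imp ?_
  rintro st r ⟨ha, p', hp, hj⟩
  rw [emp.eq_zero hp] at hj
  exact ⟨ha.eq, hj.unique (Join.zero_left r₀)⟩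

theorem tri_forkPrefix {xs : List Var} {s : Stmt} (hs : SideCondition K φ c s)
    (h : HasLocal inv st₀.slh st₀.sih r₀) :
    Tri K φ c (PiG φ) st₀ r₀ (forkPrefix s xs) (PiL inv) := by
  refine tri_escSet.seq ?_
  rintro st₁ r ⟨T, hT, rfl, rfl⟩
  refine tri_slhRemEsc.seq ?_
  rintro st₂ r' ⟨rfl, rfl⟩
  refine Tri.atomic hs fun S b j r' hG hj _ => ?_
  refine (tri_sghAddEsc (hj.sub_right.sgh_eq hG.sgh)).imp ?_
  rintro st r' ⟨rfl, rfl⟩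
  obtain ⟨rI, rA, hIA, hI, hA, hd, hGA⟩ := HasBoth.of_join hj h hG
  refine HasBoth.up_star (S := S ∪ T) (b := b) ⟨rI, rA.withSgh (some (S ∪ T)),
    hIA.withSgh hGA.sgh _, hI, fun l hl => hA l (Finset.mem_sdiff.1 hl).1, ?_, ?_⟩
  · rw [Finset.disjoint_union_right]
    exact ⟨hd.mono_left Finset.sdiff_subset, Finset.sdiff_disjoint⟩
  · refine ⟨fun l' hl' => ?_, rfl, hGA.used, hGA.spec⟩
    rcases Finset.mem_union.1 hl' with hl' | hl'
    · exact hGA.owns l' hl'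
    · exact hA l' (hT hl')

theorem prov_init_local {J : RProp Perm} {C : GCmd} {Q : Assn Perm}
    (h : Prov K φ c J (PiL inv) C Q) :
    Prov K φ c J (lift emp) (.slhInit ;; .sihInit ;; C) Q := by
  refine prov_of_tri fun st₀ r₀ hr => tri_slhInit.seq ?_
  rintro st₁ r ⟨rfl, rfl⟩
  refine tri_sihInit.seq ?_
  rintro st₂ r' ⟨rfl, rfl⟩
  refine tri_of_prov h ⟨r', r', ?_, ?_, ?_⟩
  · obtain rfl := emp.eq_zero hr
    exact Join.zero_left _
  · rwa [starSet_empty]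
  · rwa [starSet_empty]

theorem prov_ghost (hspec : sp.Restricted) (s : Stmt)
    (hs : ∀ s' ∈ s.subs, Derivable K sp φ c s') :
    Prov K φ c (PiG φ) (PiL sp.inv) (ghost s) (PiL sp.inv) := by
  induction s with
  | skip ℓ => exact .skip
  | alloc ℓ x => exact prov_of_tri fun st r h => tri_ghost_alloc (HasLocal.of_piL h)
  | read ℓ x e =>
    exact prov_of_tri fun st r h => tri_ghost_read (hs _ (by simp [Stmt.subs])) (HasLocal.of_piL h)
  | write ℓ x e =>
    exact prov_of_tri fun st r h => tri_ghost_write (hs _ (by simp [Stmt.subs])) (HasLocal.of_piL h)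
  | coreAlloc ℓ x es =>
    exact prov_of_tri fun st r h =>
      tri_ghost_coreAlloc hspec (hs _ (by simp [Stmt.subs])) (HasLocal.of_piL h)
  | coreCall ℓ k x es rs =>
    exact prov_of_tri fun st r h =>
      tri_ghost_coreCall hspec (hs _ (by simp [Stmt.subs])) (HasLocal.of_piL h)
  | seq ℓ s₁ s₂ ih₁ ih₂ =>
    exact .seq (ih₁ fun s' h' => hs s' (by simp [Stmt.subs, h']))
      (ih₂ fun s' h' => hs s' (by simp [Stmt.subs, h']))
  | fork ℓ xs s ih =>
    refine prov_of_tri fun st r h =>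
      (tri_forkPrefix (hs _ (by simp [Stmt.subs])).side (HasLocal.of_piL h)).seq fun st' r' h' => ?_
    refine (tri_fork (prov_init_local (ih fun s' h' => hs s' (by simp [Stmt.subs, h'])))).imp ?_
    rintro _ _ ⟨rfl, rfl⟩
    exact h'

/-- After `sInit` there are no local or shared locations and no instances, so `PiG` needs only the
two new cells and φ. The sharing rule then turns it into the resource invariant. -/
theorem prov_program {inv : Val → RProp Perm} {C : GCmd}
    (h : Prov K φ c (PiG φ) (PiL inv) C (PiL inv)) :
    Prov K φ c emp (lift (spec φ)) (.seq sInit C) (fun _ _ => True) := by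
  have h' : Prov K φ c emp (star (PiL inv) (lift (PiG φ))) C (star (PiL inv) (lift (PiG φ))) :=
    .share (PiG φ) (by rwa [emp_rstar])
  refine prov_of_tri fun st₀ r₀ hr => Tri.seq (M := fun st r => st.slh = ∅ ∧ st.sih = ∅ ∧
    r = (r₀.withSgh (some ∅)).withUsed (some false)) ?_ ?_
  · refine tri_slhInit.seq ?_
    rintro st₁ r ⟨rfl, rfl⟩
    refine tri_sihInit.seq ?_
    rintro st₂ r ⟨rfl, rfl⟩
    refine (tri_sghNew hr.2.1).seq ?_
    rintro st₃ r' ⟨rfl, rfl⟩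
    refine (tri_usedNew (r₀ := r.withSgh (some ∅)) hr.2.2.1).imp ?_
    rintro st₄ r' ⟨rfl, rfl⟩
    exact ⟨rfl, rfl, rfl⟩
  · rintro st r ⟨h1, h2, rfl⟩
    refine Tri.imp (Q' := star (PiL inv) (lift (PiG φ))) ?_ fun _ _ _ => trivial
    have hB : HasBoth inv φ st.slh st.sih ∅ false
        ((r₀.withSgh (some ∅)).withUsed (some false)) := by
      refine ⟨_, _, Join.zero_left _, ?_, ?_, by simp, ?_⟩
      · rw [h2, starSet_empty]
        exact emp_zero
      · simp [h1, Owns]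
      · exact ⟨by simp [Owns], rfl, rfl, fun _ => ⟨_, le_rfl, hr.2.2.2⟩⟩
    obtain ⟨r', hr', t, ht⟩ := hB.up_star
    exact (tri_frame h' hr' ht).post fun st r ⟨_, p', hp, hj⟩ => ⟨p', hp, hj.sub_left⟩

end Ghost

/-! ### Core statements transform what their precondition describes -/

/-- The behaviour of Core statements. -/
def GCmd.coreStep (K : CoreImpl Perm) :
    GCmd → LState → Global Perm → LState → Global Perm → Prop
  | .coreAlloc c es => CoreAllocStep K c es
  | .coreCall k c es rs => CoreCallStep K k c es rs
  | _ => fun _ _ _ _ => False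

theorem LState.setMany_store_of_notMem {st : LState} {rs : List Var} {ws : List Val} {y : Var}
    (hy : y ∉ rs) : (st.setMany rs ws).store y = st.store y := by
  induction rs generalizing st ws with
  | nil => cases ws <;> rfl
  | cons r rs ih =>
    cases ws with
    | nil => rfl
    | cons w ws =>
      rw [List.mem_cons, not_or] at hy
      exact (ih hy.2).trans (Function.update_of_ne hy.1 _ _)

theorem LState.setMany_store_of_mem {st : LState} {rs : List Var} {ws : List Val} {y : Var}
    (hl : ws.length = rs.length) (hy : y ∈ rs) :
    ∃ w ∈ ws, (st.setMany rs ws).store y = some w := by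
  induction rs generalizing st ws with
  | nil => simp at hy
  | cons r rs ih =>
    cases ws with
    | nil => simp at hl
    | cons w ws =>
      by_cases hyr : y ∈ rs
      · obtain ⟨w', hw, h⟩ := ih (st := st.set r w) (by simpa using hl) hyr
        exact ⟨w', List.mem_cons_of_mem _ hw, h⟩
      · obtain rfl : y = r := by simpa [hyr] using hy
        refine ⟨w, List.mem_cons_self, ?_⟩
        exact (LState.setMany_store_of_notMem hyr).trans (Function.update_self ..)

theorem LState.setMany_ghost (st : LState) (rs : List Var) (ws : List Val) :
    (st.setMany rs ws).slh = st.slh ∧ (st.setMany rs ws).sih = st.sih ∧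
      (st.setMany rs ws).esc = st.esc := by
  induction rs generalizing st ws with
  | nil => cases ws <;> exact ⟨rfl, rfl, rfl⟩
  | cons r rs ih =>
    cases ws with
    | nil => exact ⟨rfl, rfl, rfl⟩
    | cons w ws => exact ih (st.set r w) ws

theorem GCmd.coreStep.agreeOff {K : CoreImpl Perm} {C : GCmd} {st st' : LState} {g g' : Global Perm}
    (h : C.coreStep K st g st' g') : AgreeOff C.mods st st' := by
  cases C with
  | coreAlloc c es =>
    cases h
    refine ⟨fun y hy => ?_, fun _ => rfl, fun _ => rfl, fun _ => rfl⟩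
    exact (Function.update_of_ne (fun h => hy (by simp [GCmd.mods, h])) _ _).symm
  | coreCall k c es rs =>
    cases h
    obtain ⟨h1, h2, h3⟩ := LState.setMany_ghost st rs ‹_›
    refine ⟨fun y hy => ?_, fun _ => h1.symm, fun _ => h2.symm, fun _ => h3.symm⟩
    exact (LState.setMany_store_of_notMem fun hr => hy ⟨y, hr, rfl⟩).symm
  | _ => exact h.elim

/-- Only structural rules and the rules for Core statements can derive such a triple. None of them
opens `J` or appeals to a side condition, hence the claim holds for every execution, without
reference to traces. The frame may grow, because whatever the consequence rule drops is added to it.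
-/
theorem Prov.core_valid {K : CoreImpl Perm} {φ : Multiset Perm → Prop} {c : Stmt} {J : RProp Perm}
    {P Q : Assn Perm} {C : GCmd} (h : Prov K φ c J P C Q) {st st' : LState} {g g' : Global Perm}
    {r rF : Res Perm} (hP : P st r) (hj : Join r rF g.res) (hs : C.coreStep K st g st' g') :
    ∃ r' rF', Q st' r' ∧ Join r' rF' g'.res ∧ Sub rF rF' := by
  induction h generalizing r rF with
  | conseq h1 _ h2 ih =>
    obtain ⟨a, b, hab, ha⟩ := h1 st r hP
    obtain ⟨y, hy, hr⟩ := hab.assoc hj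
    obtain ⟨r', rF', hQ, hj', hsub⟩ := ih ha hr hs
    obtain ⟨q, t, hqt, hq⟩ := h2 st' r' hQ
    obtain ⟨z, hz, hr'⟩ := hqt.assoc hj'
    exact ⟨q, z, hq, hr', (hy.sub_right.trans hsub).trans hz.sub_right⟩
  | frame F hF _ ih =>
    obtain ⟨a, b, hab, ha, hb⟩ := hP
    obtain ⟨y, hy, hr⟩ := hab.assoc hj
    obtain ⟨r', rF', hQ, hj', t, ht⟩ := ih ha hr hs
    obtain ⟨z, hz, hzr⟩ := hy.assoc ht
    obtain ⟨w, hw, hwr⟩ := hzr.assoc' hj'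
    refine ⟨w, z, ⟨r', b, hw, hQ, ?_⟩, hwr, hz.sub_left⟩
    rwa [← hF st st' hs.agreeOff]
  | share A _ ih =>
    obtain ⟨a, b, hab, ha, hb⟩ := hP
    obtain ⟨y, hy, hr⟩ := hab.assoc hj
    obtain ⟨r', rF', hQ, hj', t, ht⟩ := ih ha hr hs
    obtain ⟨z, hz, hzr⟩ := hy.assoc ht
    obtain ⟨w, hw, hwr⟩ := hzr.assoc' hj'
    exact ⟨w, z, ⟨r', b, hw, hQ, hb⟩, hwr, hz.sub_left⟩
  | ex Ps _ ih =>
    obtain ⟨P, hPs, hP⟩ := hP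
    exact ih P hPs hP hj hs
  | coreAlloc h =>
    obtain ⟨r', hQ, hj'⟩ := h _ _ _ _ _ _ hP hj hs
    exact ⟨r', rF, hQ, hj', Sub.refl _⟩
  | coreCall h =>
    obtain ⟨r', hQ, hj'⟩ := h _ _ _ _ _ _ hP hj hs
    exact ⟨r', rF, hQ, hj', Sub.refl _⟩
  | _ => exact hs.elim

/-! ### Executions of the code that `𝔸` produces -/

section Exec

variable {K : CoreImpl Perm} {st st' : LState} {g g' : Global Perm}

theorem Exec.seq_inv {C₁ C₂ : GCmd} (h : Exec K (C₁ ;; C₂) st g st' g') :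
    ∃ st₁ g₁, Exec K C₁ st g st₁ g₁ ∧ Exec K C₂ st₁ g₁ st' g' := by
  cases h with
  | seq h₁ h₂ => exact ⟨_, _, h₁, h₂⟩

theorem Expr.eval_set {st : LState} {x : Var} {v : Val} {e : Expr} (h : x ∉ e.vars) :
    e.eval (st.set x v).store = e.eval st.store :=
  e.eval_congr fun y hy => Function.update_of_ne (fun hyx : y = x => h (hyx ▸ hy)) _ _

theorem Exec.ghost_alloc {ℓ : Label} {x : Var} (h : Exec K (ghost (.alloc ℓ x)) st g st' g') :
    ∃ l, g.phys.heap l = none ∧ st' = { st.set x (.loc l) with slh := st.slh ∪ {l} } ∧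
      g' = { g with phys := { g.phys with
            heap := Function.update g.phys.heap l (some .nil)
            site := Function.update g.phys.site l (some (.app ℓ)) } } := by
  obtain ⟨st₁, g₁, h₁, h₂⟩ := h.seq_inv
  cases h₁ with
  | alloc hl =>
    cases h₂
    refine ⟨_, hl, ?_, rfl⟩
    rw [locs_single (by simp [Expr.eval, LState.set]; rfl)]
    rfl

theorem Exec.ghost_read {ℓ : Label} {x : Var} {e : Expr} (hx : x ∉ e.vars)
    (h : Exec K (ghost (.read ℓ x e)) st g st' g') :
    ∃ l v, e.eval st.store = some (.loc l) ∧ g.phys.heap l = some v ∧ st' = st.set x v ∧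
      ((l ∈ st.slh ∧ g' = g) ∨
        l ∉ st.slh ∧ ∃ S, g.sgh = some S ∧ g' = { g with sgh := some (S \ {l} ∪ {l}) }) := by
  cases h with
  | point h =>
  cases h with
  | ifLocalThen hl hm h =>
    rename_i l
    obtain ⟨st₁, g₁, h₁, h⟩ := h.seq_inv
    obtain ⟨st₂, g₂, h₂, h₃⟩ := h.seq_inv
    cases h₁
    cases h₂ with
    | read hl' hv =>
      cases h₃
      obtain rfl : l = _ := by simpa [hl] using hl'
      have hl2 := (Expr.eval_set (st := { st with slh := st.slh \ st.locs [e] })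
        (v := ‹Val›) hx).trans hl
      refine ⟨l, _, hl, hv, ?_, Or.inl ⟨hm, rfl⟩⟩
      rw [locs_single hl2]
      simp only [LState.set]
      rw [locs_single hl, Finset.sdiff_union_of_subset (by simpa using hm)]
  | ifLocalElse hn h =>
    cases h with
    | atomic h =>
    obtain ⟨st₁, g₁, h₁, h⟩ := h.seq_inv
    obtain ⟨st₂, g₂, h₂, h₃⟩ := h.seq_inv
    cases h₁ with
    | sghRem hS =>
    cases h₂ with
    | read hl hv =>
    cases h₃ with
    | sghAdd hS' =>
      have hl2 := (Expr.eval_set (st := st) (v := ‹Val›) hx).trans hl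
      simp only [Option.some.injEq] at hS'
      subst hS'
      refine ⟨_, _, hl, hv, rfl, Or.inr ⟨fun hm => hn ⟨_, hl, hm⟩, _, hS, ?_⟩⟩
      rw [locs_single hl2, locs_single hl]

/-- `T` is the set of the locations in `slh` that are reachable from the values of `es`. -/
def IsEscaping (st : LState) (h : Loc → Option Val) (es : List Expr) (T : Finset Loc) : Prop :=
  ∀ l, l ∈ T ↔ l ∈ st.slh ∧ ∃ e ∈ es, ∃ v, e.eval st.store = some v ∧ Reach h v l

theorem Exec.ghost_write {ℓ : Label} {x : Var} {e : Expr}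
    (h : Exec K (ghost (.write ℓ x e)) st g st' g') :
    ∃ l v w, st.store x = some (.loc l) ∧ g.phys.heap l = some v ∧ e.eval st.store = some w ∧
      ((l ∈ st.slh ∧ st' = st ∧ g' = { g with phys := { g.phys with
            heap := Function.update g.phys.heap l (some w) } }) ∨
        (l ∉ st.slh ∧ ∃ S T, g.sgh = some S ∧ IsEscaping st g.phys.heap [e] T ∧
          st' = { st with slh := st.slh \ T, esc := T } ∧
          g' = { g with
            phys := { g.phys with heap := Function.update g.phys.heap l (some w) }
            sgh := some (S \ {l} ∪ {l} ∪ T) })) := by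
  cases h with
  | point h =>
  cases h with
  | ifLocalThen hl hm h =>
    rename_i l
    obtain ⟨st₁, g₁, h₁, h⟩ := h.seq_inv
    obtain ⟨st₂, g₂, h₂, h₃⟩ := h.seq_inv
    cases h₁
    cases h₂ with
    | write hl' hv hw =>
      cases h₃
      have hl : st.store x = some (.loc l) := hl
      obtain rfl : l = _ := by simpa [hl] using hl'
      refine ⟨l, _, _, hl, hv, hw, Or.inl ⟨hm, ?_, rfl⟩⟩
      have h1 : st.locs [.var x] = {l} := locs_single hl
      have h2 : LState.locs { st with slh := st.slh \ st.locs [.var x] } [.var x] = {l} :=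
        locs_single hl
      rw [h2, h1]
      dsimp only
      rw [Finset.sdiff_union_of_subset (by simpa using hm)]
  | ifLocalElse hn h =>
    cases h with
    | atomic h =>
    obtain ⟨st₁, g₁, h₁, h⟩ := h.seq_inv
    obtain ⟨st₂, g₂, h₂, h⟩ := h.seq_inv
    obtain ⟨st₃, g₃, h₃, h⟩ := h.seq_inv
    obtain ⟨st₄, g₄, h₄, h⟩ := h.seq_inv
    obtain ⟨st₅, g₅, h₅, h₆⟩ := h.seq_inv
    cases h₁ with
    | sghRem hS =>
    cases h₂ with
    | escSet hT =>
    cases h₃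
    cases h₄ with
    | write hl hv hw =>
    cases h₅ with
    | sghAdd hS' =>
    cases h₆ with
    | sghAddEsc hS'' =>
      simp only [Option.some.injEq] at hS' hS''
      subst hS' hS''
      refine ⟨_, _, _, hl, hv, hw, Or.inr ⟨fun hm => hn ⟨_, hl, hm⟩, _, _, hS, hT, rfl, ?_⟩⟩
      dsimp only
      rw [locs_single (e := .var x) (by exact hl), locs_single (e := .var x) (by exact hl)]

/-- The Core looks only at the store, so its step can be replayed with any value of `slh`, in
particular with the one from before the ghost removal. In the global state `used` is already true,
since the atomic block comes first. -/
theorem Exec.ghost_coreAlloc {ℓ : Label} {x : Var} {es : List Expr}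
    (hx : ∀ e ∈ es, x ∉ e.vars) (h : Exec K (ghost (.coreAlloc ℓ x es)) st g st' g') :
    ∃ vs v m', evals st.store es = some vs ∧ Confined vs g.phys m' [v] ∧
      (∀ slh, (GCmd.coreAlloc x es).coreStep K { st with slh := slh } { g with used := some true }
        { st.set x v with slh := slh } { g with used := some true, phys := m' }) ∧
      st' = { st.set x v with
        slh := st.slh \ valLocs vs ∪ valLocs vs
        sih := st.sih ∪ valLocs [v] } ∧
      g' = { g with used := some true, phys := m' } := by
  cases h with
  | point h =>
  obtain ⟨st₁, g₁, h₁, h⟩ := h.seq_inv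
  obtain ⟨st₂, g₂, h₂, h⟩ := h.seq_inv
  obtain ⟨st₃, g₃, h₃, h⟩ := h.seq_inv
  obtain ⟨st₄, g₄, h₄, h₅⟩ := h.seq_inv
  cases h₁ with
  | atomic h₁ =>
  cases h₁ with
  | usedSet hu =>
  cases h₂
  cases h₃ with
  | coreAlloc h₃ =>
  cases h₃ with
  | mk hvs hK hC =>
  rename_i m' vs v
  cases h₄
  cases h₅
  have hvs : evals st.store es = some vs := hvs
  refine ⟨vs, v, m', hvs, hC, fun slh => .mk hvs hK hC, ?_, rfl⟩
  have h1 : LState.locs (LState.set { st with slh := st.slh \ st.locs es } x v) es =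
      valLocs vs := by
    rw [← LState.locs_eq_valLocs hvs]
    exact LState.locs_congr fun e he => Expr.eval_set (st := st) (hx e he)
  rw [h1, LState.locs_eq_valLocs hvs]
  rw [LState.locs_eq_valLocs (vs := [v]) (by simp [evals, Expr.eval, LState.set])]
  rfl

theorem Exec.ghost_coreCall {ℓ : Label} {k : ℕ} {x : Var} {es : List Expr} {rs : List Var}
    (hx : x ∉ rs) (hes : ∀ e ∈ es, ∀ r ∈ rs, r ∉ e.vars)
    (h : Exec K (ghost (.coreCall ℓ k x es rs)) st g st' g') :
    ∃ vc vs ws m' st₁, st.store x = some vc ∧ evals st.store es = some vs ∧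
      Confined (vc :: vs) g.phys m' ws ∧ st₁.store = st.store ∧
      (GCmd.coreCall k x es rs).coreStep K st₁ g (st₁.setMany rs ws) { g with phys := m' } ∧
      st'.store = (st₁.setMany rs ws).store ∧ ws.length = rs.length ∧
      st'.slh = st.slh \ valLocs vs ∪ (valLocs vs ∪ st'.locs (rs.map .var)) ∧
      st'.sih = st.sih \ valLocs [vc] ∪ valLocs [vc] ∧ g' = { g with phys := m' } := by
  cases h with
  | point h =>
  obtain ⟨st₁, g₁, h₁, h⟩ := h.seq_inv
  obtain ⟨st₂, g₂, h₂, h⟩ := h.seq_inv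
  obtain ⟨st₃, g₃, h₃, h⟩ := h.seq_inv
  obtain ⟨st₄, g₄, h₄, h₅⟩ := h.seq_inv
  cases h₁
  cases h₂
  cases h₃ with
  | coreCall h₃ =>
  have h₃' := h₃
  cases h₃ with
  | mk hxc hvs hlen hK hC =>
  rename_i m' vc vs ws
  cases h₄
  cases h₅
  have hvs : evals st.store es = some vs := hvs
  have hxc : st.store x = some vc := hxc
  have hG := LState.setMany_ghost { st with
    sih := st.sih \ st.locs [.var x]
    slh := st.slh \ LState.locs { st with sih := st.sih \ st.locs [.var x] } es } rs ws
  refine ⟨vc, vs, ws, m', _, hxc, hvs, hC, ?_, h₃', rfl, hlen, ?_, ?_, rfl⟩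
  · rfl
  · change _ ∪ LState.locs _ _ = _
    rw [hG.1, locs_append]
    congr 1
    · exact congrArg (st.slh \ ·) (LState.locs_eq_valLocs hvs)
    · rw [← LState.locs_eq_valLocs hvs]
      congr 1
      exact LState.locs_congr fun e he => e.eval_congr fun y hy =>
        LState.setMany_store_of_notMem fun hr => hes e he y hr hy
  · change _ ∪ LState.locs _ _ = _
    rw [hG.2.1]
    have h1 : st.locs [.var x] = valLocs [vc] :=
      LState.locs_eq_valLocs (by simp [evals, Expr.eval, hxc])
    rw [h1]
    congr 1
    refine LState.locs_eq_valLocs ?_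
    simp only [evals, Expr.eval]
    rw [LState.setMany_store_of_notMem hx]
    simp [hxc]

theorem Exec.forkPrefix {s : Stmt} {xs : List Var}
    (h : Exec K (Diodon.forkPrefix s xs) st g st' g') :
    ∃ S T, g.sgh = some S ∧ IsEscaping st g.phys.heap (xs.map .var) T ∧
      st' = { st with slh := st.slh \ T, esc := T } ∧ g' = { g with sgh := some (S ∪ T) } := by
  obtain ⟨st₁, g₁, h₁, h⟩ := h.seq_inv
  obtain ⟨st₂, g₂, h₂, h₃⟩ := h.seq_inv
  cases h₁ with
  | escSet hT =>
  cases h₂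
  cases h₃ with
  | atomic h₃ =>
  cases h₃ with
  | sghAddEsc hS => exact ⟨_, _, hS, hT, rfl, rfl⟩

theorem Exec.sInit {st st' : LState} {g g' : Global Perm}
    (h : Exec K Diodon.sInit st g st' g') :
    st' = { st with slh := ∅, sih := ∅ } ∧ g' = { g with sgh := some ∅, used := some false } := by
  obtain ⟨st₁, g₁, h₁, h⟩ := h.seq_inv
  obtain ⟨st₂, g₂, h₂, h⟩ := h.seq_inv
  obtain ⟨st₃, g₃, h₃, h₄⟩ := h.seq_inv
  cases h₁
  cases h₂
  cases h₃
  cases h₄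
  exact ⟨rfl, rfl⟩

end Exec

/-! ### Mentioned locations -/

/-- Expressions forge no pointers: only variables, pairing and projections yield values that contain
any. -/
theorem Expr.mentions {σ : Var → Option Val} {e : Expr} {v : Val} {l : Loc}
    (h : e.eval σ = some v) (hl : v.Mentions l) : ∃ x ∈ e.vars, ∃ w, σ x = some w ∧ w.Mentions l := by
  induction e generalizing v with
  | var x => exact ⟨x, rfl, v, h, hl⟩
  | nil | int _ | bool _ =>
    simp only [Expr.eval, Option.some.injEq] at h
    subst h
    exact hl.elim
  | pair a b iha ihb =>
    simp only [Expr.eval] at h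
    split at h
    · rename_i va vb hva hvb
      simp only [Option.some.injEq] at h
      subst h
      rcases hl with hl | hl
      · obtain ⟨x, hx, w⟩ := iha hva hl
        exact ⟨x, Or.inl hx, w⟩
      · obtain ⟨x, hx, w⟩ := ihb hvb hl
        exact ⟨x, Or.inr hx, w⟩
    · simp at h
  | fst a ih =>
    simp only [Expr.eval] at h
    split at h
    · rename_i va vb hva
      simp only [Option.some.injEq] at h
      subst h
      exact ih hva (Or.inl hl)
    · simp at h
  | snd a ih =>
    simp only [Expr.eval] at h
    split at h
    · rename_i va vb hva
      simp only [Option.some.injEq] at h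
      subst h
      exact ih hva (Or.inr hl)
    · simp at h
  | add a b | mul a b | lt a b | eq a b | and a b | not a =>
    simp only [Expr.eval] at h
    split at h
    · simp only [Option.some.injEq] at h
      subst h
      exact hl.elim
    · simp at h

theorem evals_exists {σ : Var → Option Val} {es : List Expr} {vs : List Val}
    (h : evals σ es = some vs) : List.Forall₂ (fun e v => e.eval σ = some v) es vs := by
  induction es generalizing vs with
  | nil =>
    obtain rfl : [] = vs := by simpa [evals] using h
    exact .nil
  | cons e es ih =>
    simp only [evals] at h
    split at h
    · rename_i v vs' hv hvs
      obtain rfl : v :: vs' = vs := by simpa using h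
      exact .cons hv (ih hvs)
    · simp at h

/-! ### An invariant of traces -/

/-- `l` belongs to the ghost set of some thread or to the global ghost set. -/
def Managed (κ : Config Perm) (S : Finset Loc) (l : Loc) : Prop :=
  l ∈ S ∨ ∃ (t : Tid) (th : Thread), κ.threads[t]? = some th ∧ l ∈ th.st.slh

/-- `l` occurs in the value returned by a Core allocation statement on the trace. -/
def CoreMention (τ : List (Event Perm)) (l : Loc) : Prop :=
  ∃ ev ∈ τ, ∃ ℓ c es, ev.stmt = .coreAlloc ℓ c es ∧
    ∃ th v, ev.post.threads[ev.tid]? = some th ∧ th.st.store c = some v ∧ v.Mentions l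

/-- Some part of the memory besides the managed locations satisfies the Core invariant for `i`. -/
def CoreOwned (sp : CoreSpec Perm) (κ : Config Perm) (S : Finset Loc) (i : Loc) : Prop :=
  ∃ r, sp.inv (.loc i) r ∧ r.sgh = none ∧ r.used = none ∧ r.perms ≤ κ.g.phys.perms ∧
    (∀ l, r.perm l ≠ 0 → κ.g.phys.heap l = some (r.val l)) ∧ ∀ l, Managed κ S l → r.perm l = 0

theorem PassedCore.mention {τ : List (Event Perm)} {l : Loc} (h : PassedCore τ l) :
    CoreMention τ l := by
  obtain ⟨ev, hev, ℓ, c, es, hs, th, hth, hl⟩ := h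
  exact ⟨ev, hev, ℓ, c, es, hs, th, _, hth, hl, rfl⟩

theorem CoreMention.mono {τ : List (Event Perm)} {l : Loc} (ev : Event Perm)
    (h : CoreMention τ l) : CoreMention (ev :: τ) l := by
  obtain ⟨ev', hev, h⟩ := h
  exact ⟨ev', List.mem_cons_of_mem _ hev, h⟩

theorem PassedReturn.mono {τ : List (Event Perm)} {l : Loc} (ev : Event Perm)
    (h : PassedReturn τ l) : PassedReturn (ev :: τ) l := by
  obtain ⟨ev', hev, h⟩ := h
  exact ⟨ev', List.mem_cons_of_mem _ hev, h⟩

theorem CoreMention.of_cons {τ : List (Event Perm)} {ev : Event Perm} {l : Loc}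
    (hs : ev.stmt.isCoreAlloc = false) (h : CoreMention (ev :: τ) l) : CoreMention τ l := by
  obtain ⟨ev', hev, ℓ, c, es, hst, h⟩ := h
  rcases List.mem_cons.1 hev with rfl | hev
  · simp [hst, Stmt.isCoreAlloc] at hs
  · exact ⟨ev', hev, ℓ, c, es, hst, h⟩

theorem PassedCore.of_cons {τ : List (Event Perm)} {ev : Event Perm} {l : Loc}
    (hs : ev.stmt.isCoreAlloc = false) (h : PassedCore (ev :: τ) l) : PassedCore τ l := by
  obtain ⟨ev', hev, ℓ, c, es, hst, h⟩ := h
  rcases List.mem_cons.1 hev with rfl | hev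
  · simp [hst, Stmt.isCoreAlloc] at hs
  · exact ⟨ev', hev, ℓ, c, es, hst, h⟩

/-- What holds in a configuration `κ` after the trace `τ`, if the ghost cells contain `S` and `b`. -/
structure TraceInv (sp : CoreSpec Perm) (φ : Multiset Perm → Prop) (τ : List (Event Perm))
    (κ : Config Perm) (S : Finset Loc) (b : Bool) : Prop where
  sgh : κ.g.sgh = some S
  used : κ.g.used = some b
  allocated : ∀ t l, Accessible τ κ t l → κ.g.phys.heap l ≠ none
  localTo : ∀ (t : Tid) (th : Thread) (l : Loc),
    κ.threads[t]? = some th → l ∈ th.st.slh → LocalTo τ κ t l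
  shared : ∀ l ∈ S, ∃ t₁ t₂, t₁ ≠ t₂ ∧ Accessible τ κ t₁ l ∧ Accessible τ κ t₂ l
  managed : ∀ l, AppManaged τ κ l → Managed κ S l
  vars : ∀ (t : Tid) (th : Thread) (x : Var) (v : Val) (l : Loc),
    κ.threads[t]? = some th → th.st.store x = some v → v.Mentions l →
    AppManaged τ κ l ∨ CoreMention τ l
  contents : ∀ l w l', AppManaged τ κ l → κ.g.phys.heap l = some w → w.Mentions l' →
    AppManaged τ κ l' ∨ CoreMention τ l'
  -- Unmanaged memory can be reached only by way of the Core instance; a thread without access to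
  -- the instance is thus unaffected by what the Core does to its own data.
  accessible : ∀ t l, Accessible τ κ t l →
    AppManaged τ κ l ∨ ∃ c, CoreMention τ c ∧ Accessible τ κ t c
  core : ∀ l, PassedCore τ l → ∃ (t : Tid) (th : Thread),
    κ.threads[t]? = some th ∧ l ∈ th.st.sih ∧ Accessible τ κ t l
  coreUnique : ∀ l l', PassedCore τ l → CoreMention τ l' → l' = l
  usedTrue : b = true → ∃ ev ∈ τ, ev.stmt.isCoreAlloc = true
  unused : b = false → ∀ ev ∈ τ, ev.stmt.isCoreAlloc = false
  owned : ∀ l, PassedCore τ l → CoreOwned sp κ S l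
  io : b = false → ∃ p ≤ κ.g.phys.perms, φ p

theorem TraceInv.managed_allocated {sp : CoreSpec Perm} {φ : Multiset Perm → Prop}
    {τ : List (Event Perm)} {κ : Config Perm} {S : Finset Loc} {b : Bool}
    (h : TraceInv sp φ τ κ S b) {l : Loc} (hl : Managed κ S l) : κ.g.phys.heap l ≠ none := by
  rcases hl with hl | ⟨t, th, ht, hl⟩
  · obtain ⟨t, _, _, ha, _⟩ := h.shared l hl
    exact h.allocated t l ha
  · exact h.allocated t l (h.localTo t th l ht hl).1

/-- The trace is an index of `Accessible`, so plain induction would forget that it ends with `ev`;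
here that bookkeeping is done once. -/
theorem Accessible.step_induction {τ : List (Event Perm)} {ev : Event Perm} {P : Tid → Loc → Prop}
    (hvar : ∀ (t : Tid) (th : Thread) (x : Var) (v : Val) (l : Loc),
      ev.post.threads[t]? = some th → th.st.store x = some v → v.Mentions l → P t l)
    (hderef : ∀ t l w l', P t l → ev.post.g.phys.heap l = some w → w.Mentions l' → P t l')
    (hmono : ∀ t l, Accessible τ ev.pre t l → P t l) {t : Tid} {l : Loc}
    (h : Accessible (ev :: τ) ev.post t l) : P t l := by
  generalize hτ : ev :: τ = τ', hκ : ev.post = κ at h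
  induction h with
  | var h1 h2 h3 =>
    subst hκ
    exact hvar _ _ _ _ _ h1 h2 h3
  | deref _ h2 h3 ih =>
    subst hκ
    exact hderef _ _ _ _ (ih hτ rfl) h2 h3
  | mono h =>
    obtain ⟨rfl, rfl⟩ := List.cons.inj hτ
    exact hmono _ _ h

theorem Accessible.reach {τ : List (Event Perm)} {κ : Config Perm} {t : Tid} {v : Val} {l : Loc}
    (hv : ∀ l, v.Mentions l → Accessible τ κ t l) (h : Reach κ.g.phys.heap v l) :
    Accessible τ κ t l := by
  induction h with
  | base h => exact hv _ h
  | step _ h2 h3 ih => exact .deref ih h2 h3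

theorem Accessible.of_eval {τ : List (Event Perm)} {κ : Config Perm} {t : Tid} {th : Thread}
    (ht : κ.threads[t]? = some th) {e : Expr} {v : Val} (he : e.eval th.st.store = some v) {l : Loc}
    (h : Reach κ.g.phys.heap v l) : Accessible τ κ t l :=
  Accessible.reach (fun _ hl => by
    obtain ⟨x, _, w, hw, hm⟩ := Expr.mentions he hl
    exact .var ht hw hm) h

/-- The effect of an execution step `ev` that takes the local state of its thread from `st` to `st'`
and the contents of the ghost cells from `S` to `S'` and `b'`. Locations in `X` may become
accessible to other threads. -/
structure Effect (sp : CoreSpec Perm) (φ : Multiset Perm → Prop) (τ : List (Event Perm))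
    (ev : Event Perm) (S S' : Finset Loc) (b' : Bool) (st st' : LState) (X : Loc → Prop) : Prop where
  pre : ∃ k, ev.pre.threads[ev.tid]? = some ⟨st, k⟩
  post : ∃ k, ev.post.threads[ev.tid]? = some ⟨st', k⟩
  others : ∀ t, t ≠ ev.tid → ∀ th, ev.post.threads[t]? = some th →
    ev.pre.threads[t]? = some th ∨ (th.st.slh = ∅ ∧ th.st.sih = ∅ ∧
      ∀ x v, th.st.store x = some v → st.store x = some v ∧ ∀ l, v.Mentions l → X l)
  keep : ∀ t, t ≠ ev.tid → ∀ th, ev.pre.threads[t]? = some th → ev.post.threads[t]? = some th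
  sgh : ev.post.g.sgh = some S'
  used : ev.post.g.used = some b'
  grow : ∀ l, ev.pre.g.phys.heap l ≠ none → ev.post.g.phys.heap l ≠ none
  sites : ∀ l, ev.pre.g.phys.heap l ≠ none → ev.post.g.phys.site l = ev.pre.g.phys.site l
  actorVars : ∀ x v l, st'.store x = some v → v.Mentions l → Accessible τ ev.pre ev.tid l ∨
    (ev.pre.g.phys.heap l = none ∧ ev.post.g.phys.heap l ≠ none)
  actorContents : ∀ l w l', (Accessible τ ev.pre ev.tid l ∨
      (ev.pre.g.phys.heap l = none ∧ ev.post.g.phys.heap l ≠ none)) →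
    ev.post.g.phys.heap l = some w → w.Mentions l' → Accessible τ ev.pre ev.tid l' ∨
      (ev.pre.g.phys.heap l' = none ∧ ev.post.g.phys.heap l' ≠ none)
  escaping : ∀ l, X l → Accessible τ ev.pre ev.tid l
  otherContents : ∀ t, t ≠ ev.tid → ∀ l w l', Accessible τ ev.pre t l ∨ X l →
    ev.post.g.phys.heap l = some w → w.Mentions l' → Accessible τ ev.pre t l' ∨ X l'
  slhNew : ∀ l ∈ st'.slh, (l ∈ st.slh ∧ ¬ X l) ∨ LocalTo (ev :: τ) ev.post ev.tid l ∨
    (ev.pre.g.phys.heap l = none ∧ ∃ x, st'.store x = some (.loc l))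
  sghNew : ∀ l ∈ S', l ∈ S ∨ ∃ t₁ t₂, t₁ ≠ t₂ ∧ Accessible (ev :: τ) ev.post t₁ l ∧
    Accessible (ev :: τ) ev.post t₂ l
  slhOld : ∀ l ∈ st.slh, l ∈ st'.slh ∨ l ∈ S'
  sghOld : S ⊆ S'
  managedNew : ∀ l, AppManaged (ev :: τ) ev.post l → AppManaged τ ev.pre l ∨ l ∈ st'.slh
  varsNew : ∀ x v l, st'.store x = some v → v.Mentions l →
    AppManaged (ev :: τ) ev.post l ∨ CoreMention (ev :: τ) l
  contentsNew : ∀ l w l', AppManaged (ev :: τ) ev.post l → ev.post.g.phys.heap l = some w →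
    w.Mentions l' → AppManaged (ev :: τ) ev.post l' ∨ CoreMention (ev :: τ) l'
  sihOld : st.sih ⊆ st'.sih
  coreNew : ∀ l, PassedCore (ev :: τ) l →
    PassedCore τ l ∨ (l ∈ st'.sih ∧ Accessible (ev :: τ) ev.post ev.tid l)
  coreUnique : ∀ l l', PassedCore (ev :: τ) l → CoreMention (ev :: τ) l' → l' = l
  usedTrue : b' = true → ∃ ev' ∈ ev :: τ, ev'.stmt.isCoreAlloc = true
  unused : b' = false → ∀ ev' ∈ ev :: τ, ev'.stmt.isCoreAlloc = false
  owned : ∀ l, PassedCore (ev :: τ) l → CoreOwned sp ev.post S' l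
  io : b' = false → ∃ p ≤ ev.post.g.phys.perms, φ p

section Step

variable {sp : CoreSpec Perm} {φ : Multiset Perm → Prop} {τ : List (Event Perm)} {ev : Event Perm}
  {S S' : Finset Loc} {b b' : Bool} {st st' : LState} {X : Loc → Prop}

/-- The old accessible locations together with the fresh ones are closed under dereferencing in the
new heap. -/
theorem Effect.accessible_actor (h : Effect sp φ τ ev S S' b' st st' X) {l : Loc}
    (hl : Accessible (ev :: τ) ev.post ev.tid l) : Accessible τ ev.pre ev.tid l ∨
      (ev.pre.g.phys.heap l = none ∧ ev.post.g.phys.heap l ≠ none) := by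
  refine Accessible.step_induction (P := fun t l => t = ev.tid → Accessible τ ev.pre ev.tid l ∨
      (ev.pre.g.phys.heap l = none ∧ ev.post.g.phys.heap l ≠ none)) ?_ ?_ ?_ hl rfl
  · rintro t th x v l ht hx hv rfl
    obtain ⟨k, hk⟩ := h.post
    obtain rfl := Option.some.inj (hk.symm.trans ht)
    exact h.actorVars x v l hx hv
  · rintro t l w l' ih hw hm rfl
    exact h.actorContents l w l' (ih rfl) hw hm
  · rintro t l hl rfl
    exact Or.inl hl

theorem Effect.accessible_other (h : Effect sp φ τ ev S S' b' st st' X) {t : Tid}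
    (ht : t ≠ ev.tid) {l : Loc} (hl : Accessible (ev :: τ) ev.post t l) :
    Accessible τ ev.pre t l ∨ X l := by
  refine Accessible.step_induction (P := fun t l => t ≠ ev.tid → Accessible τ ev.pre t l ∨ X l)
    ?_ ?_ ?_ hl ht
  · rintro t th x v l ht hx hv hne
    rcases h.others t hne th ht with hth | ⟨-, -, hst⟩
    · exact Or.inl (.var hth hx hv)
    · exact Or.inr ((hst x v hx).2 l hv)
  · rintro t l w l' ih hw hm hne
    exact h.otherContents t hne l w l' (ih hne) hw hm
  · rintro t l hl -
    exact Or.inl hl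

/-- Managed locations are allocated, and a step does not alter the sites of allocated locations. -/
theorem AppManaged.step (hI : TraceInv sp φ τ ev.pre S b) (h : Effect sp φ τ ev S S' b' st st' X)
    {l : Loc} (hl : AppManaged τ ev.pre l) : AppManaged (ev :: τ) ev.post l := by
  rcases hl with ⟨ℓ, hl⟩ | hl
  · refine Or.inl ⟨ℓ, ?_⟩
    rw [h.sites l (hI.managed_allocated (hI.managed l (Or.inl ⟨ℓ, hl⟩))), hl]
  · exact Or.inr (hl.mono ev)

/-- The delicate clause is locality. Every location accessible after the step was accessible to the
same thread before it, or was accessible to the acting thread, or is fresh; each possibility is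
excluded for a location local to somebody else. -/
theorem TraceInv.step (hI : TraceInv sp φ τ ev.pre S b) (h : Effect sp φ τ ev S S' b' st st' X) :
    TraceInv sp φ (ev :: τ) ev.post S' b' := by
  obtain ⟨k, hk⟩ := h.pre
  obtain ⟨k', hk'⟩ := h.post
  have hacc : ∀ t l, Accessible (ev :: τ) ev.post t l → Accessible τ ev.pre t l ∨
      Accessible τ ev.pre ev.tid l ∨
        (ev.pre.g.phys.heap l = none ∧ ev.post.g.phys.heap l ≠ none) := by
    intro t l hl
    by_cases ht : t = ev.tid
    · subst ht
      exact Or.inr (h.accessible_actor hl)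
    · rcases h.accessible_other ht hl with hl | hl
      · exact Or.inl hl
      · exact Or.inr (Or.inl (h.escaping l hl))
  have hAC : ∀ l, AppManaged τ ev.pre l ∨ CoreMention τ l →
      AppManaged (ev :: τ) ev.post l ∨ CoreMention (ev :: τ) l := fun l hl =>
    hl.imp (fun hl => hl.step hI h) (fun hl => hl.mono ev)
  have hvars : ∀ (t : Tid) (th : Thread) (x : Var) (v : Val) (l : Loc),
      ev.post.threads[t]? = some th → th.st.store x = some v → v.Mentions l →
        AppManaged (ev :: τ) ev.post l ∨ CoreMention (ev :: τ) l := by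
    intro t th x v l ht hx hv
    by_cases hne : t = ev.tid
    · subst hne
      obtain rfl := Option.some.inj (hk'.symm.trans ht)
      exact h.varsNew x v l hx hv
    · rcases h.others t hne th ht with hth | ⟨-, -, hst⟩
      · exact hAC l (hI.vars t th x v l hth hx hv)
      · exact hAC l (hI.vars _ _ x v l hk (hst x v hx).1 hv)
  refine ⟨h.sgh, h.used, ?_, ?_, ?_, ?_, hvars, h.contentsNew, ?_, ?_, h.coreUnique, h.usedTrue,
    h.unused, h.owned, h.io⟩
  · intro t l hl
    rcases hacc t l hl with hl | hl | hl
    · exact h.grow l (hI.allocated t l hl)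
    · exact h.grow l (hI.allocated _ l hl)
    · exact hl.2
  · intro t th l ht hl
    by_cases hne : t = ev.tid
    · subst hne
      obtain rfl := Option.some.inj (hk'.symm.trans ht)
      rcases h.slhNew l hl with ⟨hl, hX⟩ | hl | ⟨hl, x, hx⟩
      · have hloc := hI.localTo _ _ l hk hl
        refine ⟨.mono hloc.1, fun t' ht' ha => ?_⟩
        rcases h.accessible_other ht' ha with ha | ha
        · exact hloc.2 t' ht' ha
        · exact hX ha
      · exact hl
      -- A fresh location: whatever another thread can reach after the step was allocated before it.
      · refine ⟨.var hk' hx rfl, fun t' ht' ha => ?_⟩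
        rcases h.accessible_other ht' ha with ha | ha
        · exact hI.allocated _ _ ha hl
        · exact hI.allocated _ _ (h.escaping l ha) hl
    -- The acting thread could not reach a location local to `t`, hence cannot have passed it on.
    · rcases h.others t hne th ht with hth | ⟨h0, -, -⟩
      · have hloc := hI.localTo t th l hth hl
        refine ⟨.mono hloc.1, fun t' ht' ha => ?_⟩
        rcases hacc t' l ha with ha | ha | ha
        · exact hloc.2 t' ht' ha
        · exact hloc.2 _ (Ne.symm hne) ha
        · exact hI.allocated _ _ hloc.1 ha.1
      · simp [h0] at hl
  · intro l hl
    rcases h.sghNew l hl with hl | hl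
    · obtain ⟨t₁, t₂, hne, h₁, h₂⟩ := hI.shared l hl
      exact ⟨t₁, t₂, hne, .mono h₁, .mono h₂⟩
    · exact hl
  · intro l hl
    rcases h.managedNew l hl with hl | hl
    · rcases hI.managed l hl with hl | ⟨t, th, ht, hl⟩
      · exact Or.inl (h.sghOld hl)
      · by_cases hne : t = ev.tid
        · subst hne
          obtain rfl := Option.some.inj (hk.symm.trans ht)
          rcases h.slhOld l hl with hl | hl
          · exact Or.inr ⟨_, _, hk', hl⟩
          · exact Or.inl hl
        · exact Or.inr ⟨t, th, h.keep t hne th ht, hl⟩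
    · exact Or.inr ⟨_, _, hk', hl⟩
  · intro t l hl
    refine (Accessible.step_induction (P := fun t l => Accessible (ev :: τ) ev.post t l ∧
      (AppManaged (ev :: τ) ev.post l ∨
        ∃ c, CoreMention (ev :: τ) c ∧ Accessible (ev :: τ) ev.post t c)) ?_ ?_ ?_ hl).2
    · intro t th x v l ht hx hv
      have ha : Accessible (ev :: τ) ev.post t l := .var ht hx hv
      exact ⟨ha, (hvars t th x v l ht hx hv).imp_right fun hc => ⟨l, hc, ha⟩⟩
    · rintro t l w l' ⟨ha, ih⟩ hw hm
      have ha' : Accessible (ev :: τ) ev.post t l' := .deref ha hw hm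
      rcases ih with ih | ih
      · exact ⟨ha', (h.contentsNew l w l' ih hw hm).imp_right fun hc => ⟨l', hc, ha'⟩⟩
      · exact ⟨ha', Or.inr ih⟩
    · intro t l ha
      refine ⟨.mono ha, ?_⟩
      rcases hI.accessible t l ha with hl | ⟨c, hc, hac⟩
      · exact Or.inl (hl.step hI h)
      · exact Or.inr ⟨c, hc.mono ev, .mono hac⟩
  · intro l hl
    rcases h.coreNew l hl with hl | ⟨hl, ha⟩
    · obtain ⟨t, th, ht, hl, ha⟩ := hI.core l hl
      by_cases hne : t = ev.tid
      · subst hne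
        obtain rfl := Option.some.inj (hk.symm.trans ht)
        exact ⟨_, _, hk', h.sihOld hl, .mono ha⟩
      · exact ⟨t, th, h.keep t hne th ht, hl, .mono ha⟩
    · exact ⟨_, _, hk', hl, ha⟩

end Step

/-! ### Steps of the Application -/

section AppStep

variable {sp : CoreSpec Perm} {φ : Multiset Perm → Prop} {τ : List (Event Perm)} {ev : Event Perm}
  {S S' : Finset Loc} {b b' : Bool} {st st' : LState} {X : Loc → Prop}

/-- The thread list changes as in a step from the local state `st` to `st'`, by which at most the
locations in `X` are passed to a new thread. -/
structure ThreadStep (ev : Event Perm) (st st' : LState) (X : Loc → Prop) : Prop where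
  pre : ∃ k, ev.pre.threads[ev.tid]? = some ⟨st, k⟩
  post : ∃ k, ev.post.threads[ev.tid]? = some ⟨st', k⟩
  others : ∀ t, t ≠ ev.tid → ∀ th, ev.post.threads[t]? = some th →
    ev.pre.threads[t]? = some th ∨ (th.st.slh = ∅ ∧ th.st.sih = ∅ ∧
      ∀ x v, th.st.store x = some v → st.store x = some v ∧ ∀ l, v.Mentions l → X l)
  keep : ∀ t, t ≠ ev.tid → ∀ th, ev.pre.threads[t]? = some th → ev.post.threads[t]? = some th

theorem ThreadStep.simple {t : Tid} {s : Stmt} {κ : Config Perm} {k k' : List Stmt}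
    {g' : Global Perm} (h : κ.threads[t]? = some ⟨st, k⟩) :
    ThreadStep ⟨t, s, κ, ⟨κ.threads.set t ⟨st', k'⟩, g'⟩⟩ st st' X := by
  have hlt : t < κ.threads.length := (List.getElem?_eq_some_iff.1 h).1
  refine ⟨⟨k, h⟩, ⟨k', by simp [hlt]⟩, fun t' ht th hth => Or.inl ?_, fun t' ht th hth => ?_⟩
  · simpa [List.getElem?_set_ne (Ne.symm ht)] using hth
  · simpa [List.getElem?_set_ne (Ne.symm ht)] using hth

theorem ThreadStep.fork {t : Tid} {s : Stmt} {κ : Config Perm} {k k' kN : List Stmt}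
    {g' : Global Perm} {xs : List Var} (h : κ.threads[t]? = some ⟨st, k⟩)
    (hs : st'.store = st.store)
    (hX : ∀ x ∈ xs, ∀ v l, st.store x = some v → v.Mentions l → X l) :
    ThreadStep ⟨t, s, κ, ⟨κ.threads.set t ⟨st', k'⟩ ++ [⟨⟨st'.passed xs, ∅, ∅, ∅⟩, kN⟩], g'⟩⟩
      st st' X := by
  have hlt : t < κ.threads.length := (List.getElem?_eq_some_iff.1 h).1
  refine ⟨⟨k, h⟩, ⟨k', ?_⟩, fun t' ht th hth => ?_, fun t' ht th hth => ?_⟩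
  · dsimp only
    rw [List.getElem?_append_left (by simpa using hlt)]
    simp [hlt]
  · dsimp only at hth ht ⊢
    by_cases hlt' : t' < κ.threads.length
    · rw [List.getElem?_append_left (by simpa using hlt'),
        List.getElem?_set_ne (Ne.symm ht)] at hth
      exact Or.inl hth
    · rw [List.getElem?_append_right (by simpa using hlt')] at hth
      obtain rfl : (⟨⟨st'.passed xs, ∅, ∅, ∅⟩, kN⟩ : Thread) = th := by
        simpa using (List.getElem?_eq_some_iff.1 hth).2
      refine Or.inr ⟨rfl, rfl, fun x v hx => ?_⟩
      simp only [LState.passed, hs] at hx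
      split at hx
      · rename_i hxs
        exact ⟨hx, fun l hl => hX x hxs v l hx hl⟩
      · simp at hx
  · dsimp only at hth ht ⊢
    have hlt' : t' < κ.threads.length := (List.getElem?_eq_some_iff.1 hth).1
    rwa [List.getElem?_append_left (by simpa using hlt'), List.getElem?_set_ne (Ne.symm ht)]

/-- The effect of a step of the Application. -/
structure AppEffect (τ : List (Event Perm)) (ev : Event Perm) (S S' : Finset Loc) (st st' : LState)
    (X : Loc → Prop) : Prop where
  threads : ThreadStep ev st st' X
  noAlloc : ev.stmt.isCoreAlloc = false
  noCall : ∀ ℓ k c es rs, ev.stmt ≠ .coreCall ℓ k c es rs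
  sgh : ev.post.g.sgh = some S'
  used : ev.post.g.used = ev.pre.g.used
  perms : ev.post.g.phys.perms = ev.pre.g.phys.perms
  grow : ∀ l, ev.pre.g.phys.heap l ≠ none → ev.post.g.phys.heap l ≠ none
  sites : ∀ l, ev.pre.g.phys.heap l ≠ none → ev.post.g.phys.site l = ev.pre.g.phys.site l
  newSites : ∀ l ℓ, ev.post.g.phys.site l = some (.app ℓ) →
    ev.pre.g.phys.site l = some (.app ℓ) ∨ l ∈ st'.slh
  varsNew : ∀ x v l, st'.store x = some v → v.Mentions l →
    (∃ y w, st.store y = some w ∧ w.Mentions l) ∨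
    (∃ l₀ w, Accessible τ ev.pre ev.tid l₀ ∧ AppManaged τ ev.pre l₀ ∧
      ev.pre.g.phys.heap l₀ = some w ∧ w.Mentions l) ∨
    (ev.pre.g.phys.heap l = none ∧ ev.post.g.phys.heap l ≠ none ∧
      ∃ ℓ, ev.post.g.phys.site l = some (.app ℓ))
  contentsNew : ∀ l w l', ev.post.g.phys.heap l = some w → w.Mentions l' →
    ev.pre.g.phys.heap l = some w ∨ ((∃ y v, st.store y = some v ∧ v.Mentions l') ∧
      (X l' ∨ (¬ X l ∧ ∀ t, t ≠ ev.tid → ¬ Accessible τ ev.pre t l)))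
  escaping : ∀ l, X l → Accessible τ ev.pre ev.tid l
  closed : ∀ l w l', X l → ev.pre.g.phys.heap l = some w → w.Mentions l' → X l'
  slhNew : ∀ l ∈ st'.slh, (l ∈ st.slh ∧ ¬ X l) ∨
    (ev.pre.g.phys.heap l = none ∧ ∃ x, st'.store x = some (.loc l))
  sghNew : ∀ l ∈ S', l ∈ S ∨ (l ∈ st.slh ∧ ∃ t₁ t₂, t₁ ≠ t₂ ∧
    Accessible (ev :: τ) ev.post t₁ l ∧ Accessible (ev :: τ) ev.post t₂ l)
  slhOld : ∀ l ∈ st.slh, l ∈ st'.slh ∨ l ∈ S'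
  sghOld : S ⊆ S'
  sih : st'.sih = st.sih
  unmanaged : ∀ l, ev.pre.g.phys.heap l ≠ none → ¬ Managed ev.pre S l →
    ev.post.g.phys.heap l = ev.pre.g.phys.heap l

theorem AppEffect.effect (hI : TraceInv sp φ τ ev.pre S b) (h : AppEffect τ ev S S' st st' X) :
    Effect sp φ τ ev S S' b st st' X := by
  obtain ⟨k, hk⟩ := h.threads.pre
  obtain ⟨k', hk'⟩ := h.threads.post
  have hvar : ∀ y w l, st.store y = some w → w.Mentions l → Accessible τ ev.pre ev.tid l :=
    fun y w l hy hl => .var hk hy hl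
  have hPR : ∀ l, PassedReturn (ev :: τ) l → PassedReturn τ l := by
    rintro l ⟨ev', hev, ℓ, k, c, es, rs, hs, hl⟩
    rcases List.mem_cons.1 hev with rfl | hev
    · exact (h.noCall _ _ _ _ _ hs).elim
    · exact ⟨ev', hev, ℓ, k, c, es, rs, hs, hl⟩
  have hAMnew : ∀ l, AppManaged (ev :: τ) ev.post l → AppManaged τ ev.pre l ∨ l ∈ st'.slh := by
    rintro l (⟨ℓ, hl⟩ | hl)
    · exact (h.newSites l ℓ hl).imp_left fun hl => Or.inl ⟨ℓ, hl⟩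
    · exact Or.inl (Or.inr (hPR l hl))
  have hAMold : ∀ l, AppManaged τ ev.pre l → AppManaged (ev :: τ) ev.post l := by
    rintro l (⟨ℓ, hl⟩ | hl)
    · refine Or.inl ⟨ℓ, ?_⟩
      rw [h.sites l (hI.managed_allocated (hI.managed l (Or.inl ⟨ℓ, hl⟩))), hl]
    · exact Or.inr (hl.mono ev)
  have hAC : ∀ l, AppManaged τ ev.pre l ∨ CoreMention τ l →
      AppManaged (ev :: τ) ev.post l ∨ CoreMention (ev :: τ) l := fun l hl =>
    hl.imp (hAMold l) (fun hl => hl.mono ev)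
  have hAMpre : ∀ l, AppManaged (ev :: τ) ev.post l → ev.pre.g.phys.heap l ≠ none →
      AppManaged τ ev.pre l := by
    rintro l (⟨ℓ, hl⟩ | hl) hne
    · exact Or.inl ⟨ℓ, by rw [← h.sites l hne, hl]⟩
    · exact Or.inr (hPR l hl)
  refine
    { pre := h.threads.pre
      post := h.threads.post
      others := h.threads.others
      keep := h.threads.keep
      sgh := h.sgh
      used := h.used.trans hI.used
      grow := h.grow
      sites := h.sites
      actorVars := ?_
      actorContents := ?_
      escaping := h.escaping
      otherContents := ?_
      slhNew := fun l hl => (h.slhNew l hl).imp_right Or.inr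
      sghNew := fun l hl => (h.sghNew l hl).imp_right And.right
      slhOld := h.slhOld
      sghOld := h.sghOld
      managedNew := hAMnew
      varsNew := ?_
      contentsNew := ?_
      sihOld := h.sih ▸ Finset.Subset.refl _
      coreNew := fun l hl => Or.inl (hl.of_cons h.noAlloc)
      coreUnique := fun l l' hl hl' =>
        hI.coreUnique l l' (hl.of_cons h.noAlloc) (hl'.of_cons h.noAlloc)
      usedTrue := fun hb => by
        obtain ⟨ev', hev, h⟩ := hI.usedTrue hb
        exact ⟨ev', List.mem_cons_of_mem _ hev, h⟩
      unused := fun hb ev' hev => by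
        rcases List.mem_cons.1 hev with rfl | hev
        · exact h.noAlloc
        · exact hI.unused hb ev' hev
      owned := ?_
      io := by rw [h.perms]; exact hI.io }
  · intro x v l hx hv
    rcases h.varsNew x v l hx hv with ⟨y, w, hy, hw⟩ | ⟨l₀, w, ha, -, hw, hm⟩ | ⟨h1, h2, -⟩
    · exact Or.inl (hvar y w l hy hw)
    · exact Or.inl (.deref ha hw hm)
    · exact Or.inr ⟨h1, h2⟩
  · intro l w l' hl hw hm
    rcases h.contentsNew l w l' hw hm with hw' | ⟨⟨y, v, hy, hv⟩, -⟩
    · rcases hl with hl | ⟨hl, -⟩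
      · exact Or.inl (.deref hl hw' hm)
      · simp [hl] at hw'
    · exact Or.inl (hvar y v l' hy hv)
  · intro t ht l w l' hl hw hm
    rcases h.contentsNew l w l' hw hm with hw' | ⟨-, hX | ⟨h1, h2⟩⟩
    · rcases hl with hl | hl
      · exact Or.inl (.deref hl hw' hm)
      · exact Or.inr (h.closed l w l' hl hw' hm)
    · exact Or.inr hX
    · rcases hl with hl | hl
      · exact absurd hl (h2 t ht)
      · exact absurd hl h1
  · intro x v l hx hv
    rcases h.varsNew x v l hx hv with ⟨y, w, hy, hw⟩ | ⟨l₀, w, ha, hA, hw, hm⟩ | ⟨-, -, h2⟩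
    · exact hAC l (hI.vars _ _ y w l hk hy hw)
    · exact hAC l (hI.contents l₀ w l hA hw hm)
    · exact Or.inl (Or.inl h2)
  · intro l w l' hl hw hm
    rcases h.contentsNew l w l' hw hm with hw' | ⟨⟨y, v, hy, hv⟩, -⟩
    · exact hAC l' (hI.contents l w l' (hAMpre l hl (by simp [hw'])) hw' hm)
    · exact hAC l' (hI.vars _ _ y v l' hk hy hv)
  -- The Application changes only managed and fresh locations, while the part of memory that
  -- satisfies `inv` has no permission to either.
  · intro l hl
    obtain ⟨r, hr, h1, h2, h3, h4, h5⟩ := hI.owned l (hl.of_cons h.noAlloc)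
    refine ⟨r, hr, h1, h2, by rw [h.perms]; exact h3, fun l' hl' => ?_, fun l' hl' => ?_⟩
    · rw [h.unmanaged l' (by simp [h4 l' hl']) fun hm => hl' (h5 l' hm), h4 l' hl']
    · have hfresh : ev.pre.g.phys.heap l' = none → r.perm l' = 0 := fun h0 => by
        by_contra hne
        simp [h4 l' hne] at h0
      have hst : l' ∈ st.slh → r.perm l' = 0 := fun hm => h5 l' (Or.inr ⟨_, _, hk, hm⟩)
      rcases hl' with hl' | ⟨t, th, ht, hl'⟩
      · rcases h.sghNew l' hl' with hl' | hl'
        · exact h5 l' (Or.inl hl')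
        · exact hst hl'.1
      · by_cases hne : t = ev.tid
        · subst hne
          obtain rfl := Option.some.inj (hk'.symm.trans ht)
          rcases h.slhNew l' hl' with hl' | hl'
          · exact hst hl'.1
          · exact hfresh hl'.1
        · rcases h.threads.others t hne th ht with hth | ⟨h0, -, -⟩
          · exact h5 l' (Or.inr ⟨t, th, hth, hl'⟩)
          · simp [h0] at hl'

/-! ### The individual steps of the Application -/

section Instances

variable {κ : Config Perm} {t : Tid} {k k₀ : List Stmt}

theorem AppEffect.skip (hI : TraceInv sp φ τ κ S b) {ℓ : Label}
    (hk : κ.threads[t]? = some ⟨st, k₀⟩) :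
    AppEffect τ ⟨t, .skip ℓ, κ, ⟨κ.threads.set t ⟨st, k⟩, κ.g⟩⟩ S S st st fun _ => False where
  threads := .simple hk
  noAlloc := rfl
  noCall := by simp
  sgh := hI.sgh
  used := rfl
  perms := rfl
  grow _ h := h
  sites _ _ := rfl
  newSites _ _ h := Or.inl h
  varsNew x v _ hx hv := Or.inl ⟨x, v, hx, hv⟩
  contentsNew _ _ _ hw _ := Or.inl hw
  escaping _ h := h.elim
  closed _ _ _ h := h.elim
  slhNew _ h := Or.inl ⟨h, id⟩
  sghNew _ h := Or.inl h
  slhOld _ h := Or.inl h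
  sghOld := Finset.Subset.refl _
  sih := rfl
  unmanaged _ _ _ := rfl

theorem AppEffect.alloc (hI : TraceInv sp φ τ κ S b) {ℓ : Label} {x : Var} {l : Loc}
    (hk : κ.threads[t]? = some ⟨st, k₀⟩) (hl : κ.g.phys.heap l = none) :
    AppEffect τ ⟨t, .alloc ℓ x, κ,
      ⟨κ.threads.set t ⟨{ st.set x (.loc l) with slh := st.slh ∪ {l} }, k⟩,
        { κ.g with phys := { κ.g.phys with
            heap := Function.update κ.g.phys.heap l (some .nil)
            site := Function.update κ.g.phys.site l (some (.app ℓ)) } }⟩⟩ S S st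
      { st.set x (.loc l) with slh := st.slh ∪ {l} } fun _ => False where
  threads := .simple hk
  noAlloc := rfl
  noCall := by simp
  sgh := hI.sgh
  used := rfl
  perms := rfl
  grow l' h := by
    by_cases hll : l' = l
    · simp [hll]
    · simpa [hll] using h
  sites l' h := by
    by_cases hll : l' = l
    · exact absurd (hll ▸ hl) h
    · simp [hll]
  newSites l' ℓ' h := by
    by_cases hll : l' = l
    · simp [hll]
    · exact Or.inl (by simpa [hll] using h)
  varsNew y v l' hy hv := by
    by_cases hyx : y = x
    · subst hyx
      obtain rfl : Val.loc l = v := by simpa [LState.set] using hy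
      obtain rfl : l = l' := hv
      exact Or.inr (Or.inr ⟨hl, by simp, ℓ, by simp⟩)
    · exact Or.inl ⟨y, v, by simpa [LState.set, hyx] using hy, hv⟩
  contentsNew l' w l'' hw hm := by
    by_cases hll : l' = l
    · subst hll
      obtain rfl : Val.nil = w := by simpa using hw
      exact hm.elim
    · exact Or.inl (by simpa [hll] using hw)
  escaping _ h := h.elim
  closed _ _ _ h := h.elim
  slhNew l' h := by
    rcases Finset.mem_union.1 h with h | h
    · exact Or.inl ⟨h, id⟩
    · obtain rfl := Finset.mem_singleton.1 h
      exact Or.inr ⟨hl, x, by simp [LState.set]⟩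
  sghNew _ h := Or.inl h
  slhOld _ h := Or.inl (Finset.mem_union_left _ h)
  sghOld := Finset.Subset.refl _
  sih := rfl
  unmanaged l' h _ := by
    by_cases hll : l' = l
    · exact absurd (hll ▸ hl) h
    · simp [hll]

theorem AppEffect.read (hI : TraceInv sp φ τ κ S b) {ℓ : Label} {x : Var} {e : Expr} {l : Loc}
    {v : Val} (hk : κ.threads[t]? = some ⟨st, k₀⟩) (he : e.eval st.store = some (.loc l))
    (hv : κ.g.phys.heap l = some v) (hA : AppManaged τ κ l) :
    AppEffect τ ⟨t, .read ℓ x e, κ, ⟨κ.threads.set t ⟨st.set x v, k⟩, κ.g⟩⟩ S S st (st.set x v)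
      fun _ => False where
  threads := .simple hk
  noAlloc := rfl
  noCall := by simp
  sgh := hI.sgh
  used := rfl
  perms := rfl
  grow _ h := h
  sites _ _ := rfl
  newSites _ _ h := Or.inl h
  varsNew y w l' hy hw := by
    by_cases hyx : y = x
    · subst hyx
      obtain rfl : v = w := by simpa [LState.set] using hy
      exact Or.inr (Or.inl ⟨l, v, Accessible.of_eval hk he (.base rfl), hA, hv, hw⟩)
    · exact Or.inl ⟨y, w, by simpa [LState.set, hyx] using hy, hw⟩
  contentsNew _ _ _ hw _ := Or.inl hw
  escaping _ h := h.elim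
  closed _ _ _ h := h.elim
  slhNew _ h := Or.inl ⟨h, id⟩
  sghNew _ h := Or.inl h
  slhOld _ h := Or.inl h
  sghOld := Finset.Subset.refl _
  sih := rfl
  unmanaged _ _ _ := rfl

/-- No other thread can reach `l`, so nothing escapes by being stored there. -/
theorem AppEffect.writeLocal (hI : TraceInv sp φ τ κ S b) {ℓ : Label} {x : Var} {e : Expr} {l : Loc}
    {v w : Val} (hk : κ.threads[t]? = some ⟨st, k₀⟩) (hv : κ.g.phys.heap l = some v)
    (hw : e.eval st.store = some w) (hl : l ∈ st.slh) :
    AppEffect τ ⟨t, .write ℓ x e, κ, ⟨κ.threads.set t ⟨st, k⟩,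
      { κ.g with phys := { κ.g.phys with
          heap := Function.update κ.g.phys.heap l (some w) } }⟩⟩ S S st st fun _ => False where
  threads := .simple hk
  noAlloc := rfl
  noCall := by simp
  sgh := hI.sgh
  used := rfl
  perms := rfl
  grow l' h := by
    by_cases hll : l' = l
    · simp [hll]
    · simpa [hll] using h
  sites _ _ := rfl
  newSites _ _ h := Or.inl h
  varsNew y u _ hy hu := Or.inl ⟨y, u, hy, hu⟩
  contentsNew l' u l'' hu hm := by
    by_cases hll : l' = l
    · subst hll
      obtain rfl : w = u := by simpa using hu
      obtain ⟨y, -, u, hy, hu⟩ := Expr.mentions hw hm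
      exact Or.inr ⟨⟨y, u, hy, hu⟩, Or.inr ⟨id, (hI.localTo _ _ _ hk hl).2⟩⟩
    · exact Or.inl (by simpa [hll] using hu)
  escaping _ h := h.elim
  closed _ _ _ h := h.elim
  slhNew _ h := Or.inl ⟨h, id⟩
  sghNew _ h := Or.inl h
  slhOld _ h := Or.inl h
  sghOld := Finset.Subset.refl _
  sih := rfl
  unmanaged l' _ hm := by
    by_cases hll : l' = l
    · subst hll
      exact absurd (Or.inr ⟨_, _, hk, hl⟩) hm
    · simp [hll]

/-- The write may cut a path from `w` that passes through `l`. What lies behind `l` on such a path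
was, however, accessible before, and accessibility is never lost. -/
theorem Accessible.write {ev : Event Perm} {l l' : Loc} {w : Val} {t : Tid}
    (hw : ev.post.g.phys.heap = Function.update ev.pre.g.phys.heap l (some w))
    (hl : Accessible τ ev.pre t l) (h : Reach ev.pre.g.phys.heap w l') :
    Accessible (ev :: τ) ev.post t l' := by
  induction h with
  | base hm => exact .deref (.mono hl) (by rw [hw, Function.update_self]) hm
  | @step l₁ l₂ u _ hu hm ih =>
    by_cases hll : l₁ = l
    · subst hll
      exact .mono (.deref hl hu hm)
    · exact .deref ih (by rw [hw, Function.update_of_ne hll, hu]) hm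

/-- Everything reachable from the written value may escape. As `l` is shared, two threads reach all
of it after the write, which justifies moving `T` into `*sgh`; what remains in `slh` is not
reachable from the value. -/
theorem AppEffect.writeGlobal (hI : TraceInv sp φ τ κ S b) {ℓ : Label} {x : Var} {e : Expr}
    {l : Loc} {v w : Val} {T : Finset Loc} (hk : κ.threads[t]? = some ⟨st, k₀⟩)
    (hv : κ.g.phys.heap l = some v) (hw : e.eval st.store = some w) (hl : l ∈ S)
    (hT : IsEscaping st κ.g.phys.heap [e] T) :
    AppEffect τ ⟨t, .write ℓ x e, κ, ⟨κ.threads.set t ⟨{ st with slh := st.slh \ T, esc := T }, k⟩,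
      { κ.g with
        phys := { κ.g.phys with heap := Function.update κ.g.phys.heap l (some w) }
        sgh := some (S \ {l} ∪ {l} ∪ T) }⟩⟩ S (S \ {l} ∪ {l} ∪ T) st
      { st with slh := st.slh \ T, esc := T } (Reach κ.g.phys.heap w) where
  threads := .simple hk
  noAlloc := rfl
  noCall := by simp
  sgh := rfl
  used := rfl
  perms := rfl
  grow l' h := by
    by_cases hll : l' = l
    · simp [hll]
    · simpa [hll] using h
  sites _ _ := rfl
  newSites _ _ h := Or.inl h
  varsNew y u _ hy hu := Or.inl ⟨y, u, hy, hu⟩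
  contentsNew l' u l'' hu hm := by
    by_cases hll : l' = l
    · subst hll
      obtain rfl : w = u := by simpa using hu
      obtain ⟨y, -, u, hy, hu⟩ := Expr.mentions hw hm
      exact Or.inr ⟨⟨y, u, hy, hu⟩, Or.inl (.base hm)⟩
    · exact Or.inl (by simpa [hll] using hu)
  escaping _ h := Accessible.of_eval hk hw h
  closed _ _ _ h hu hm := .step h hu hm
  slhNew l' h := by
    rw [Finset.mem_sdiff] at h
    exact Or.inl ⟨h.1, fun hr => h.2 ((hT l').2 ⟨h.1, e, by simp, w, hw, hr⟩)⟩
  sghNew l' h := by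
    rw [Finset.sdiff_union_of_subset (by simpa using hl), Finset.mem_union] at h
    rcases h with h | h
    · exact Or.inl h
    · obtain ⟨h1, e', he', w', hw', hr⟩ := (hT l').1 h
      obtain rfl : e' = e := by simpa using he'
      obtain rfl : w = w' := by simpa [hw] using hw'
      obtain ⟨t₁, t₂, hne, h₁, h₂⟩ := hI.shared l hl
      exact Or.inr ⟨h1, t₁, t₂, hne, .write (by rfl) h₁ hr, .write (by rfl) h₂ hr⟩
  slhOld l' h := by
    by_cases hlT : l' ∈ T
    · exact Or.inr (Finset.mem_union_right _ hlT)
    · exact Or.inl (Finset.mem_sdiff.2 ⟨h, hlT⟩)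
  sghOld := by
    rw [Finset.sdiff_union_of_subset (by simpa using hl)]
    exact Finset.subset_union_left
  sih := rfl
  unmanaged l' _ hm := by
    by_cases hll : l' = l
    · subst hll
      exact absurd (Or.inl hl) hm
    · simp [hll]

theorem AppEffect.fork {ℓ : Label} {xs : List Var} {s : Stmt}
    {T : Finset Loc} {kN : List Stmt} (hk : κ.threads[t]? = some ⟨st, k₀⟩)
    (hT : IsEscaping st κ.g.phys.heap (xs.map .var) T) :
    AppEffect τ ⟨t, .fork ℓ xs s, κ,
      ⟨κ.threads.set t ⟨{ st with slh := st.slh \ T, esc := T }, k⟩ ++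
        [⟨⟨LState.passed { st with slh := st.slh \ T, esc := T } xs, ∅, ∅, ∅⟩, kN⟩],
        { κ.g with sgh := some (S ∪ T) }⟩⟩ S (S ∪ T) st
      { st with slh := st.slh \ T, esc := T }
      (fun l => ∃ x ∈ xs, ∃ v, st.store x = some v ∧ Reach κ.g.phys.heap v l) where
  threads := .fork hk rfl fun x hx v _ hv hm => ⟨x, hx, v, hv, .base hm⟩
  noAlloc := rfl
  noCall := by simp
  sgh := rfl
  used := rfl
  perms := rfl
  grow _ h := h
  sites _ _ := rfl
  newSites _ _ h := Or.inl h
  varsNew y u _ hy hu := Or.inl ⟨y, u, hy, hu⟩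
  contentsNew _ _ _ hu _ := Or.inl hu
  escaping := by
    rintro l ⟨x, hx, v, hv, hr⟩
    exact Accessible.of_eval hk (e := .var x) hv hr
  closed := by
    rintro l w l' ⟨x, hx, v, hv, hr⟩ hw hm
    exact ⟨x, hx, v, hv, .step hr hw hm⟩
  slhNew l' h := by
    rw [Finset.mem_sdiff] at h
    refine Or.inl ⟨h.1, ?_⟩
    rintro ⟨x, hx, v, hv, hr⟩
    exact h.2 ((hT l').2 ⟨h.1, .var x, List.mem_map_of_mem hx, v, hv, hr⟩)
  sghNew l' h := by
    rcases Finset.mem_union.1 h with h | h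
    · exact Or.inl h
    · obtain ⟨h1, e, he, v, hv, hr⟩ := (hT l').1 h
      obtain ⟨x, hx, rfl⟩ := List.mem_map.1 he
      have hlt : t < κ.threads.length := (List.getElem?_eq_some_iff.1 hk).1
      -- The new thread is appended, so its identifier is the old number of threads.
      refine Or.inr ⟨h1, t, κ.threads.length, hlt.ne, ?_, ?_⟩
      · exact .mono (Accessible.of_eval hk hv hr)
      · refine Accessible.of_eval
          (th := ⟨⟨LState.passed { st with slh := st.slh \ T, esc := T } xs, ∅, ∅, ∅⟩, kN⟩)
          (e := .var x) ?_ (v := v) ?_ hr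
        · dsimp only
          rw [List.getElem?_append_right (by simp)]
          simp
        · simpa [Expr.eval, LState.passed, hx] using hv
  slhOld l' h := by
    by_cases hlT : l' ∈ T
    · exact Or.inr (Finset.mem_union_right _ hlT)
    · exact Or.inl (Finset.mem_sdiff.2 ⟨h, hlT⟩)
  sghOld := Finset.subset_union_left
  sih := rfl
  unmanaged _ _ _ := rfl

end Instances

end AppStep

/-! ### Steps of the Core -/

theorem Sub.heap_eq {s : Res Perm} {g : Global Perm} (h : Sub s g.res) {l : Loc}
    (hl : s.perm l ≠ 0) : g.phys.heap l = some (s.val l) := by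
  have h1 := h.val_eq hl
  have h2 : g.res.perm l ≠ 0 := fun h0 => hl (le_antisymm (h0 ▸ h.perm_le l) zero_le)
  simp only [Global.res] at h1 h2
  cases hv : g.phys.heap l with
  | none => simp [hv] at h2
  | some v => simpa [hv] using h1

theorem Global.res_perm {g : Global Perm} {l : Loc} (h : g.phys.heap l ≠ none) :
    g.res.perm l = 1 := by
  obtain ⟨v, hv⟩ := Option.ne_none_iff_exists'.1 h
  simp [Global.res, hv]

/-- A resource that agrees with the heap and contains no ghost cells is a part of the global
state. -/
theorem Global.sub_res {g : Global Perm} {r : Res Perm}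
    (hheap : ∀ l, r.perm l ≠ 0 → g.phys.heap l = some (r.val l)) (hs : r.sgh = none)
    (hu : r.used = none) (hp : r.perms ≤ g.phys.perms) : Sub r g.res := by
  obtain ⟨q, hq⟩ := Multiset.le_iff_exists_add.1 hp
  classical
  refine ⟨⟨fun l => g.res.perm l - r.perm l,
    fun l => if g.res.perm l - r.perm l = 0 then .nil else g.res.val l,
    fun l => tsub_le_self.trans (g.res.perm_le l), fun l hl => by simp [hl], g.sgh, g.used, q⟩,
    fun l => ?_, fun l hl => ?_, fun l hl => ?_, Or.inl ⟨hs, rfl⟩, Or.inl ⟨hu, rfl⟩, hq⟩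
  · refine (add_tsub_cancel_of_le ?_).symm
    by_cases hl : r.perm l = 0
    · simp [hl]
    · rw [Global.res_perm (by simp [hheap l hl])]
      exact r.perm_le l
  · simp [Global.res, hheap l hl]
  · exact (if_neg hl).symm

/-- Outside `V` the old resource is still a part of the new one. Resources record the values of the
heap they are part of, so both heaps store the same. -/
theorem heap_unchanged {V : Finset Loc} {rA rA' : Res Perm} {g g' : Global Perm}
    (h : Sub rA g.res) (h' : Sub rA' g'.res) (hs : Sub (rA.remove V) rA') {l : Loc}
    (hl : rA.perm l ≠ 0) (hV : l ∉ V) : g'.phys.heap l = g.phys.heap l := by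
  have h1 : (rA.remove V).perm l ≠ 0 := by simp [Res.remove, hV, hl]
  rw [(hs.trans h').heap_eq h1, h.heap_eq hl]
  simp [Res.remove, hV]

section CoreStep

variable {sp : CoreSpec Perm} {φ : Multiset Perm → Prop} {τ : List (Event Perm)} {ev : Event Perm}
  {S : Finset Loc} {b b' : Bool} {st st' : LState}

/-- What the invariant needs to know about a call of a Core function; `V` contains the locations to
which the arguments point, and `R` those to which the results point. -/
structure CoreEffect (sp : CoreSpec Perm) (φ : Multiset Perm → Prop) (τ : List (Event Perm))
    (ev : Event Perm) (S : Finset Loc) (b' : Bool) (st st' : LState) (ins outs : List Val)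
    (V R : Finset Loc) : Prop where
  threads : ThreadStep ev st st' fun _ => False
  confined : Confined ins ev.pre.g.phys ev.post.g.phys outs
  insAccessible : ∀ v ∈ ins, ∀ l, v.Mentions l → Accessible τ ev.pre ev.tid l
  store : ∀ x v, st'.store x = some v → st.store x = some v ∨ v ∈ outs
  sgh : ev.post.g.sgh = some S
  used : ev.post.g.used = some b'
  slh : ∀ l, l ∈ st'.slh ↔ l ∈ st.slh ∨ l ∈ R
  shallow : ∀ l w l', l ∈ V ∨ l ∈ R → ev.post.g.phys.heap l = some w → w.Mentions l' → l' = l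
  resLocal : ∀ l ∈ R, LocalTo (ev :: τ) ev.post ev.tid l
  same : ∀ l, Managed ev.pre S l → l ∉ V → ev.post.g.phys.heap l = ev.pre.g.phys.heap l
  otherSame : ∀ t, t ≠ ev.tid → ∀ l, Accessible τ ev.pre t l →
    ev.post.g.phys.heap l = ev.pre.g.phys.heap l
  returned : ∀ l, PassedReturn (ev :: τ) l → PassedReturn τ l ∨ l ∈ R
  varsNew : ∀ x v l, st'.store x = some v → v ∈ outs → v.Mentions l →
    AppManaged (ev :: τ) ev.post l ∨ CoreMention (ev :: τ) l
  sihOld : st.sih ⊆ st'.sih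
  coreNew : ∀ l, PassedCore (ev :: τ) l →
    PassedCore τ l ∨ (l ∈ st'.sih ∧ Accessible (ev :: τ) ev.post ev.tid l)
  coreUnique : ∀ l l', PassedCore (ev :: τ) l → CoreMention (ev :: τ) l' → l' = l
  usedTrue : b' = true → ∃ ev' ∈ ev :: τ, ev'.stmt.isCoreAlloc = true
  unused : b' = false → ∀ ev' ∈ ev :: τ, ev'.stmt.isCoreAlloc = false
  owned : ∀ l, PassedCore (ev :: τ) l → CoreOwned sp ev.post S l
  io : b' = false → ∃ p ≤ ev.post.g.phys.perms, φ p

theorem CoreEffect.effect {ins outs : List Val} {V R : Finset Loc}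
    (hI : TraceInv sp φ τ ev.pre S b) (h : CoreEffect sp φ τ ev S b' st st' ins outs V R) :
    Effect sp φ τ ev S S b' st st' fun _ => False := by
  obtain ⟨k, hk⟩ := h.threads.pre
  obtain ⟨k', hk'⟩ := h.threads.post
  have hreach : ∀ l, (∃ v ∈ ins, Reach ev.pre.g.phys.heap v l) →
      Accessible τ ev.pre ev.tid l := by
    rintro l ⟨v, hv, hr⟩
    exact Accessible.reach (h.insAccessible v hv) hr
  have hAMpre : ∀ l, AppManaged (ev :: τ) ev.post l → AppManaged τ ev.pre l ∨ l ∈ R := by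
    rintro l (⟨ℓ, hl⟩ | hl)
    -- The Core cannot create Application sites: whatever it allocates receives a site inside the
    -- Core.
    · left; left
      by_cases h0 : ev.pre.g.phys.heap l = none
      · by_cases h1 : ev.post.g.phys.heap l = none
        · exact ⟨ℓ, by rw [← h.confined.oldSites l (Or.inr h1), hl]⟩
        · obtain ⟨a, ha⟩ := h.confined.newSites l h0 h1
          rw [ha] at hl
          simp at hl
      · exact ⟨ℓ, by rw [← h.confined.oldSites l (Or.inl h0), hl]⟩
    · exact (h.returned l hl).imp_left Or.inr
  have hsites : ∀ l, ev.pre.g.phys.heap l ≠ none →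
      ev.post.g.phys.site l = ev.pre.g.phys.site l := fun l hl =>
    h.confined.oldSites l (Or.inl hl)
  have hAMold : ∀ l, AppManaged τ ev.pre l → AppManaged (ev :: τ) ev.post l := by
    rintro l (⟨ℓ, hl⟩ | hl)
    · refine Or.inl ⟨ℓ, ?_⟩
      rw [hsites l (hI.managed_allocated (hI.managed l (Or.inl ⟨ℓ, hl⟩))), hl]
    · exact Or.inr (hl.mono ev)
  have hAC : ∀ l, AppManaged τ ev.pre l ∨ CoreMention τ l →
      AppManaged (ev :: τ) ev.post l ∨ CoreMention (ev :: τ) l := fun l hl =>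
    hl.imp (hAMold l) (fun hl => hl.mono ev)
  refine
    { pre := h.threads.pre
      post := h.threads.post
      others := h.threads.others
      keep := h.threads.keep
      sgh := h.sgh
      used := h.used
      grow := h.confined.grow
      sites := hsites
      actorVars := ?_
      actorContents := ?_
      escaping := fun _ hf => hf.elim
      otherContents := ?_
      slhNew := ?_
      sghNew := fun l hl => Or.inl hl
      slhOld := fun l hl => Or.inl ((h.slh l).2 (Or.inl hl))
      sghOld := Finset.Subset.refl _
      managedNew := fun l hl => (hAMpre l hl).imp_right fun hR => (h.slh l).2 (Or.inr hR)
      varsNew := ?_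
      contentsNew := ?_
      sihOld := h.sihOld
      coreNew := h.coreNew
      coreUnique := h.coreUnique
      usedTrue := h.usedTrue
      unused := h.unused
      owned := h.owned
      io := h.io }
  · intro x v l hx hv
    rcases h.store x v hx with hx | hx
    · exact Or.inl (.var hk hx hv)
    · exact (h.confined.results v hx l hv).imp_left (hreach l)
  · intro l w l' hl hw hm
    by_cases hr : ∃ v ∈ ins, Reach ev.pre.g.phys.heap v l
    · exact (h.confined.contents l w l' hw (Or.inl hr) hm).imp_left (hreach l')
    · rcases hl with hl | hl
      · rw [h.confined.unreached l (hI.allocated _ _ hl) hr] at hw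
        exact Or.inl (.deref hl hw hm)
      · exact (h.confined.contents l w l' hw (Or.inr hl.1) hm).imp_left (hreach l')
  · rintro t ht l w l' (hl | hl) hw hm
    · rw [h.otherSame t ht l hl] at hw
      exact Or.inl (.deref hl hw hm)
    · exact hl.elim
  · intro l hl
    rcases (h.slh l).1 hl with hl | hl
    · exact Or.inl ⟨hl, id⟩
    · exact Or.inr (Or.inl (h.resLocal l hl))
  · intro x v l hx hv
    rcases h.store x v hx with hx' | hx'
    · exact hAC l (hI.vars _ _ x v l hk hx' hv)
    · exact h.varsNew x v l hx hx' hv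
  · intro l w l' hl hw hm
    -- Arguments and results are shallow and can point only to themselves; other managed locations
    -- keep their contents.
    by_cases hVR : l ∈ V ∨ l ∈ R
    · rw [h.shallow l w l' hVR hw hm]
      exact Or.inl hl
    · rw [not_or] at hVR
      rcases hAMpre l hl with hl | hl
      · rw [h.same l (hI.managed l hl) hVR.1] at hw
        exact hAC l' (hI.contents l w l' hl hw hm)
      · exact absurd hl hVR.2

theorem Shallow.eq {κ : Config Perm} {l l' : Loc} {w : Val} (h : Shallow κ (.loc l))
    (hw : κ.g.phys.heap l = some w) (hm : w.Mentions l') : l' = l := by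
  have := h l' (.step (.base rfl) hw hm)
  simpa using this.symm

variable {K : CoreImpl Perm} {c : Stmt} {κ : Config Perm} {t : Tid} {k k₀ : List Stmt}

theorem mem_valLocs_iff_eval {σ : Var → Option Val} {es : List Expr} {vs : List Val}
    (h : evals σ es = some vs) {l : Loc} :
    l ∈ valLocs vs ↔ ∃ e ∈ es, e.eval σ = some (.loc l) := by
  rw [← LState.locs_eq_valLocs (st := ⟨σ, ∅, ∅, ∅⟩) h, mem_locs]

theorem evals_mem {σ : Var → Option Val} {es : List Expr} {vs : List Val}
    (h : evals σ es = some vs) {v : Val} (hv : v ∈ vs) : ∃ e ∈ es, e.eval σ = some v := by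
  obtain ⟨i, hi, rfl⟩ := List.getElem_of_mem hv
  have h2 := evals_exists h
  exact ⟨_, List.getElem_mem (h2.length_eq ▸ hi), (List.forall₂_iff_get.1 h2).2 i _ hi⟩

/-- No instance exists yet, so φ is split off the I/O permissions and the whole heap goes into `rA`.
By the triple, full permission to all previously allocated locations is still in `rA'` afterwards.
Hence old locations other than arguments are unchanged, and the part satisfying `inv` has permission
only to fresh locations. -/
theorem CoreEffect.coreAlloc (hspec : sp.Restricted) (hI : TraceInv sp φ τ κ S false) {ℓ : Label}
    {x : Var} {es : List Expr} {vs : List Val} {v : Val} {m' : Phys Perm}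
    (hprov : Prov K φ c (PiG φ) (sp.preAllocAssn φ es) (.coreAlloc x es) (sp.postAllocAssn x es))
    (hk : κ.threads[t]? = some ⟨st, k₀⟩) (hx : ∀ e ∈ es, x ∉ e.vars)
    (hvs : evals st.store es = some vs) (hmem : valLocs vs ⊆ st.slh)
    (hn : (vs.filterMap Val.toLoc).Nodup) (hC : Confined vs κ.g.phys m' [v])
    (hstep : ∀ slh, (GCmd.coreAlloc x es).coreStep K { st with slh := slh }
      { κ.g with used := some true } { st.set x v with slh := slh }
      { κ.g with used := some true, phys := m' })
    (hst' : st' = { st.set x v with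
        slh := st.slh \ valLocs vs ∪ valLocs vs
        sih := st.sih ∪ valLocs [v] })
    (hev : ev = ⟨t, .coreAlloc ℓ x es, κ, ⟨κ.threads.set t ⟨st', k⟩,
      { κ.g with used := some true, phys := m' }⟩⟩)
    (hlocal : ∀ l ∈ valLocs vs, LocalTo (ev :: τ) ev.post t l)
    (hshallow : ∀ l ∈ valLocs vs, Shallow ev.post (.loc l)) :
    CoreEffect sp φ τ ev S true st st' vs [v] (valLocs vs) ∅ := by
  have hnoM : ∀ l, ¬ CoreMention τ l := by
    rintro l ⟨ev', hev', ℓ', c', es', hs, -⟩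
    have := hI.unused rfl ev' hev'
    simp [hs, Stmt.isCoreAlloc] at this
  have hnoC : ∀ l, ¬ PassedCore τ l := fun l hl => hnoM l hl.mention
  have hstx : st'.store x = some v := by simp [hst', LState.set]
  have hpost : ev.post.threads[ev.tid]? = some ⟨st', k⟩ := by
    subst hev
    have hlt : t < κ.threads.length := (List.getElem?_eq_some_iff.1 hk).1
    simp [hlt]
  have hslh : st'.slh = st.slh := by
    rw [hst']
    exact Finset.sdiff_union_of_subset hmem
  have hvst' : ∀ ℓ' c' es', ev.stmt = .coreAlloc ℓ' c' es' → c' = x := by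
    subst hev
    intro ℓ' c' es' h
    simp only [Stmt.coreAlloc.injEq] at h
    exact h.2.1.symm
  have hCM : ∀ l, CoreMention (ev :: τ) l ↔ v.Mentions l := by
    intro l
    constructor
    · rintro ⟨ev', hev', ℓ', c', es', hs, th, v', hth, hv', hm⟩
      rcases List.mem_cons.1 hev' with rfl | hev'
      · obtain rfl := hvst' _ _ _ hs
        obtain rfl := Option.some.inj (hpost.symm.trans hth)
        obtain rfl : v = v' := by simpa [hstx] using hv'
        exact hm
      · exact absurd ⟨ev', hev', ℓ', c', es', hs, th, v', hth, hv', hm⟩ (hnoM l)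
    · intro hm
      exact ⟨ev, List.mem_cons_self, ℓ, x, es, by rw [hev], _, v, hpost, hstx, hm⟩
  have hPC : ∀ l, PassedCore (ev :: τ) l → v = .loc l := by
    rintro l ⟨ev', hev', ℓ', c', es', hs, th, hth, hv'⟩
    rcases List.mem_cons.1 hev' with rfl | hev'
    · obtain rfl := hvst' _ _ _ hs
      obtain rfl := Option.some.inj (hpost.symm.trans hth)
      simpa [hstx] using hv'
    · exact absurd ⟨ev', hev', ℓ', c', es', hs, th, hth, hv'⟩ (hnoC l)
  obtain ⟨p, hp, hφ⟩ := hI.io rfl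
  obtain ⟨p', hrA⟩ := Res.join_perms
    (Global.res { κ.g with used := some true }) (p := p) hp
  have hperm : ∀ l, κ.g.phys.heap l ≠ none →
      ((Global.res { κ.g with used := some true }).withPerms p').perm l = 1 := fun l hl =>
    Global.res_perm (g := { κ.g with used := some true }) hl
  have halloc : ∀ l ∈ valLocs vs, κ.g.phys.heap l ≠ none := fun l hl =>
    hI.managed_allocated (Or.inr ⟨_, _, hk, hmem hl⟩)
  obtain ⟨P, Q, hPQ, hpre, hback⟩ := hspec.coreAlloc_split (x := x) (st := st) hvs hn hrA
    (spec_token hφ) fun l hl => hperm l (halloc l hl)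
  obtain ⟨r', rF', hQ, hj', hsub⟩ := hprov.core_valid hpre hPQ (hstep st.slh)
  obtain ⟨y, hy, hyr⟩ := Sub.join_left hj'.comm hsub
  have hevals : evals (st.set x v).store es = some vs := by
    rw [← hvs]
    exact evals_congr fun e he => Expr.eval_set (hx e he)
  obtain ⟨v', rI, rA', hv', hIA, hinv, hown, hrem⟩ := hback _ r' y hevals hQ hy.comm
  obtain rfl : v = v' := by simpa [LState.set] using hv'
  have hsame : ∀ l, κ.g.phys.heap l ≠ none → l ∉ valLocs vs → m'.heap l = κ.g.phys.heap l :=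
    fun l hl hV => heap_unchanged (g := { κ.g with used := some true }) hrA.sub_right
      (hIA.sub_right.trans hyr) hrem (by simp [hperm l hl]) hV
  have hManaged : ∀ l, Managed ev.post S l → Managed κ S l := by
    rintro l (hl | ⟨t', th, hth, hl⟩)
    · exact Or.inl hl
    · by_cases htt : t' = t
      · subst htt
        have : ev.tid = t' := by rw [hev]
        rw [this] at hpost
        obtain rfl := Option.some.inj (hpost.symm.trans hth)
        exact Or.inr ⟨_, _, hk, hslh ▸ hl⟩
      · subst hev
        rw [List.getElem?_set_ne (Ne.symm htt)] at hth
        exact Or.inr ⟨_, _, hth, hl⟩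
  subst hev
  refine
    { threads := .simple hk
      confined := hC
      insAccessible := ?_
      store := ?_
      sgh := hI.sgh
      used := rfl
      slh := by simp [hslh]
      shallow := ?_
      resLocal := by simp
      same := fun l hl hV => hsame l (hI.managed_allocated hl) hV
      otherSame := ?_
      returned := ?_
      varsNew := ?_
      sihOld := by rw [hst']; exact Finset.subset_union_left
      coreNew := ?_
      coreUnique := ?_
      usedTrue := fun _ => ⟨_, List.mem_cons_self, rfl⟩
      unused := by simp
      owned := ?_
      io := by simp }
  · intro w hw l hm
    obtain ⟨e, he, hev⟩ := evals_mem hvs hw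
    exact Accessible.of_eval hk hev (.base hm)
  · intro y w hy
    by_cases hyx : y = x
    · subst hyx
      right
      simpa [hstx, eq_comm] using hy
    · left
      simpa [hst', LState.set, hyx] using hy
  · intro l w l' hl hw hm
    exact (hshallow l (by simpa using hl)).eq hw hm
  -- An argument is local after the call. Access is never lost, so no other thread could reach it
  -- before.
  · intro t' ht l hl
    refine hsame l (hI.allocated _ _ hl) fun hV => (hlocal l hV).2 t' ht (.mono hl)
  · rintro l ⟨ev', hev', ℓ', k', c', es', rs, hs, h⟩
    rcases List.mem_cons.1 hev' with rfl | hev'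
    · simp at hs
    · exact Or.inl ⟨ev', hev', ℓ', k', c', es', rs, hs, h⟩
  · intro y w l hy hw hm
    refine Or.inr ((hCM l).2 ?_)
    obtain rfl : w = v := by simpa using hw
    exact hm
  · intro l hl
    have := hPC l hl
    subst this
    refine Or.inr ⟨by rw [hst', valLocs_single]; simp, .var hpost hstx rfl⟩
  · intro l l' hl hl'
    have := hPC l hl
    subst this
    exact ((hCM l').1 hl').symm
  · intro l hl
    have := hPC l hl
    subst this
    have hS : rA'.sgh = some S := hrem.sgh_eq hI.sgh
    have hu : rA'.used = some true := hrem.used_eq rfl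
    refine ⟨rI, hinv, ?_, ?_, ?_, ?_, ?_⟩
    · have := hIA.sgh
      rw [hS] at this
      exact this.eq_of_right.1
    · have := hIA.used
      rw [hu] at this
      exact this.eq_of_right.1
    · exact (hIA.sub_left.trans hyr).perms_le
    · exact fun l' hl' => (hIA.sub_left.trans hyr).heap_eq
        (g := { κ.g with used := some true, phys := m' }) hl'
    -- The constructor adds no managed locations: anything managed now was allocated before the call
    -- and is fully owned by `rA'`.
    · intro l' hl'
      refine hIA.comm.perm_zero_of_one ?_
      have hne := hI.managed_allocated (hManaged l' hl')
      exact owns_of_remove (T := {l'}) (r := (Global.res { κ.g with used := some true }).withPerms p')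
        (by simpa [Owns] using hperm l' hne) hown hrem l' (by simp)

end CoreStep

/-! ### Calls of Core API functions -/

section CoreCall

variable {sp : CoreSpec Perm} {φ : Multiset Perm → Prop} {τ : List (Event Perm)} {ev : Event Perm}
  {S : Finset Loc} {b : Bool} {st st' : LState} {κ : Config Perm}

/-- The resources in a configuration, split into those for the Core instance `v`, those for the
Core instances other than `v`, and the rest. -/
theorem TraceInv.split_core (hI : TraceInv sp φ τ κ S b) {v : Val}
    (hv : ∀ i, v = .loc i → PassedCore τ i) :
    ∃ rX rI rA r, Join r rX κ.g.res ∧ Join rI rA r ∧ invNilable sp.inv v rI ∧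
      (∀ l, Managed κ S l → rA.perm l = 1) ∧ rA.sgh = some S ∧ rA.used = some b ∧
      (b = false → rA.perms = κ.g.phys.perms) ∧
      ((∀ i, v ≠ .loc i) → rI = Res.zero) ∧
      ∀ i, PassedCore τ i → v = .loc i ∨ sp.inv (.loc i) rX := by
  have hown : ∀ l, Managed κ S l → κ.g.res.perm l = 1 := fun l hl =>
    Global.res_perm (hI.managed_allocated hl)
  by_cases hC : ∃ i, PassedCore τ i
  · obtain ⟨i, hi⟩ := hC
    have huniq : ∀ j, PassedCore τ j → j = i := fun j hj => hI.coreUnique i j hi hj.mention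
    -- An instance exists only after a Core allocation, which has set `used`; the claim about I/O
    -- permissions is then void.
    have hb : b ≠ false := fun hb => by
      obtain ⟨ev, hev, ℓ, x, es, hs, -⟩ := hi
      have := hI.unused hb ev hev
      simp [hs, Stmt.isCoreAlloc] at this
    obtain ⟨r, hr, h1, h2, h3, h4, h5⟩ := hI.owned i hi
    obtain ⟨t, hj⟩ := Global.sub_res h4 h1 h2 h3
    have ht : ∀ l, Managed κ S l → t.perm l = 1 := fun l hl => by
      have := hj.perm l
      rw [hown l hl, h5 l hl, zero_add] at this
      exact this.symm
    have hts : t.sgh = some S := by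
      have := hj.sgh
      rw [h1] at this
      rcases this with ⟨-, h⟩ | ⟨h, h'⟩
      · exact h ▸ hI.sgh
      · exact absurd (h' ▸ hI.sgh : none = some S) (by simp)
    have htu : t.used = some b := by
      have := hj.used
      rw [h2] at this
      rcases this with ⟨-, h⟩ | ⟨h, h'⟩
      · exact h ▸ hI.used
      · exact absurd (h' ▸ hI.used : none = some b) (by simp)
    by_cases hvi : ∃ j, v = .loc j
    · obtain ⟨j, rfl⟩ := hvi
      obtain rfl := huniq j (hv j rfl)
      exact ⟨Res.zero, r, t, κ.g.res, Join.zero_right _, hj, hr, ht, hts, htu,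
        fun h => absurd h hb, fun h => absurd rfl (h j), fun l hl => Or.inl (by rw [huniq l hl])⟩
    -- A call without an instance while one exists: the memory of that instance goes into `rX` and
    -- hence into the frame.
    · push Not at hvi
      refine ⟨r, Res.zero, t, t, hj.comm, Join.zero_left t, ?_, ht, hts, htu,
        fun h => absurd h hb, fun _ => rfl, fun l hl => Or.inr (by rwa [huniq l hl])⟩
      cases v with
      | loc l => exact absurd rfl (hvi l)
      | _ => exact emp_zero
  -- Without any instance everything is in `rA`, including all I/O permissions, so that φ remains
  -- available.
  · refine ⟨Res.zero, Res.zero, κ.g.res, κ.g.res, Join.zero_right _, Join.zero_left _, ?_, hown,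
      hI.sgh, hI.used, fun _ => rfl, fun _ => rfl, fun i hi => absurd ⟨i, hi⟩ hC⟩
    cases v with
    | loc l => exact absurd ⟨l, hv l rfl⟩ hC
    | _ => exact emp_zero

variable {K : CoreImpl Perm} {c : Stmt} {t : Tid} {k k₀ : List Stmt}

/-- The triple is applied with the instance part `rI` and the argument permissions; the rest of
`rA`, and `rX`, survive the call. The part of `rA` outside the arguments contains the other managed
locations, so these are unchanged, and the new invariant part is separate from all managed
locations, the results included. -/
theorem CoreEffect.coreCall (hspec : sp.Restricted) (hI : TraceInv sp φ τ κ S b) {ℓ : Label}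
    {n : ℕ} {x : Var} {es : List Expr} {rs : List Var} {vc : Val} {vs ws : List Val}
    {m' : Phys Perm} {st₁ : LState}
    (hprov : Prov K φ c (PiG φ) (sp.preCallAssn n x es) (.coreCall n x es rs)
      (sp.postCallAssn n x es rs))
    (hk : κ.threads[t]? = some ⟨st, k₀⟩) (hx : x ∉ rs) (hes : ∀ e ∈ es, ∀ r ∈ rs, r ∉ e.vars)
    (hvc : st.store x = some vc) (hvs : evals st.store es = some vs)
    (hmem : valLocs vs ⊆ st.slh) (hn : (vs.filterMap Val.toLoc).Nodup)
    (hcore : ∀ i, vc = .loc i → PassedCore τ i ∧ LocalTo τ κ t i)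
    (hC : Confined (vc :: vs) κ.g.phys m' ws) (hst₁ : st₁.store = st.store)
    (hstep : (GCmd.coreCall n x es rs).coreStep K st₁ κ.g (st₁.setMany rs ws)
      { κ.g with phys := m' })
    (hst' : st'.store = (st₁.setMany rs ws).store) (hlen : ws.length = rs.length)
    (hslh : st'.slh = st.slh \ valLocs vs ∪ (valLocs vs ∪ st'.locs (rs.map .var)))
    (hsih : st'.sih = st.sih \ valLocs [vc] ∪ valLocs [vc])
    (hev : ev = ⟨t, .coreCall ℓ n x es rs, κ, ⟨κ.threads.set t ⟨st', k⟩,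
      { κ.g with phys := m' }⟩⟩)
    (hlocal : ∀ l ∈ valLocs vs, LocalTo (ev :: τ) ev.post t l)
    (hresLocal : ∀ l ∈ st'.locs (rs.map .var), LocalTo (ev :: τ) ev.post t l)
    (hshallow : ∀ l ∈ valLocs vs, Shallow ev.post (.loc l))
    (hresShallow : ∀ r ∈ rs, ∀ v, st'.store r = some v → Shallow ev.post v) :
    CoreEffect sp φ τ ev S b st st' (vc :: vs) ws (valLocs vs) (st'.locs (rs.map .var)) := by
  have hpost : ev.post.threads[ev.tid]? = some ⟨st', k⟩ := by
    subst hev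
    have hlt : t < κ.threads.length := (List.getElem?_eq_some_iff.1 hk).1
    simp [hlt]
  have hslh' : st'.slh = st.slh ∪ st'.locs (rs.map .var) := by
    rw [hslh, ← Finset.union_assoc, Finset.sdiff_union_of_subset hmem]
  have hevA : ev.stmt.isCoreAlloc = false := by rw [hev]; rfl
  have hold : ∀ y, y ∉ rs → st'.store y = st.store y := fun y hy => by
    rw [hst', LState.setMany_store_of_notMem hy, hst₁]
  have hR : ∀ l, l ∈ st'.locs (rs.map .var) ↔ ∃ r ∈ rs, st'.store r = some (.loc l) := by
    intro l
    rw [mem_locs]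
    constructor
    · rintro ⟨e, he, h⟩
      obtain ⟨r, hr, rfl⟩ := List.mem_map.1 he
      exact ⟨r, hr, h⟩
    · rintro ⟨r, hr, h⟩
      exact ⟨.var r, List.mem_map_of_mem hr, h⟩
  obtain ⟨rX, rI, rA, r₀, hX, hIA, hinv, hperm, hsA, huA, hpA, hI0, hXinv⟩ :=
    hI.split_core (v := vc) fun i hi => (hcore i hi).1
  obtain ⟨P, q, hPq, hpre, hback⟩ := hspec.coreCall_split (k := n) (x := x) (es := es) (rs := rs)
    (st := st₁) (hst₁ ▸ hvc) (hst₁ ▸ hvs) hn hIA hinv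
    fun l hl => hperm l (Or.inr ⟨_, _, hk, hmem hl⟩)
  obtain ⟨qX, hqX, hP⟩ := hPq.assoc hX
  obtain ⟨P', qX', hQ, hj', hsub⟩ := hprov.core_valid hpre hP hstep
  obtain ⟨y, hy, hyr⟩ := Sub.join_left hj'.comm hsub
  obtain ⟨r', hr', hr'X⟩ := hqX.assoc' hy.comm
  obtain ⟨ws', rI', rA', hws', hIA', hinv', hown, hownR, hrem⟩ := hback (st₁.setMany rs ws) P' r'
    (by rw [← hst', hold x hx, hvc])
    (by
      rw [← hvs, ← hst']
      refine evals_congr fun e he => Expr.eval_congr e fun z hz => ?_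
      exact hold z fun hr => hes e he z hr hz) hQ hr'
  rw [← hst'] at hws'
  rw [← LState.locs_eq_valLocs hws'] at hownR
  have hsubA : Sub rA κ.g.res := hIA.sub_right.trans hX.sub_left
  have hsub' : Sub r' (Global.res { κ.g with phys := m' }) := hr'X.sub_left.trans hyr
  have hsubA' := hIA'.sub_right.trans hsub'
  have hsame : ∀ l, rA.perm l ≠ 0 → l ∉ valLocs vs → m'.heap l = κ.g.phys.heap l :=
    fun l hl hV => heap_unchanged hsubA hsubA' hrem hl hV
  have hManaged : ∀ l, Managed ev.post S l → rA'.perm l = 1 := by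
    have hpre : ∀ l, Managed κ S l → rA'.perm l = 1 := fun l hl =>
      owns_of_remove (T := {l}) (by simpa [Owns] using hperm l hl) hown hrem l (by simp)
    rintro l (hl | ⟨t', th, hth, hl⟩)
    · exact hpre l (Or.inl hl)
    · by_cases htt : t' = t
      · subst htt
        have : ev.tid = t' := by rw [hev]
        rw [this] at hpost
        obtain rfl := Option.some.inj (hpost.symm.trans hth)
        rcases Finset.mem_union.1 (hslh' ▸ hl : l ∈ st.slh ∪ _) with hl | hl
        · exact hpre l (Or.inr ⟨_, _, hk, hl⟩)
        · exact hownR l hl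
      · subst hev
        rw [List.getElem?_set_ne (Ne.symm htt)] at hth
        exact hpre l (Or.inr ⟨_, _, hth, hl⟩)
  have hS' : rA'.sgh = some S := hrem.sgh_eq hsA
  have hu' : rA'.used = some b := hrem.used_eq huA
  subst hev
  refine
    { threads := .simple hk
      confined := hC
      insAccessible := ?_
      store := ?_
      sgh := hI.sgh
      used := hI.used
      slh := fun l => by rw [hslh', Finset.mem_union]
      shallow := ?_
      resLocal := hresLocal
      same := fun l hl hV => hsame l (by simp [hperm l hl]) hV
      otherSame := ?_
      returned := ?_
      varsNew := ?_
      sihOld := ?_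
      coreNew := fun l hl => Or.inl (hl.of_cons hevA)
      coreUnique := fun l l' hl hl' =>
        hI.coreUnique l l' (hl.of_cons hevA) (hl'.of_cons hevA)
      usedTrue := fun hb => by
        obtain ⟨ev', hev, h⟩ := hI.usedTrue hb
        exact ⟨ev', List.mem_cons_of_mem _ hev, h⟩
      unused := fun hb ev' hev => by
        rcases List.mem_cons.1 hev with rfl | hev
        · exact hevA
        · exact hI.unused hb ev' hev
      owned := ?_
      io := ?_ }
  · intro w hw l hm
    rcases List.mem_cons.1 hw with rfl | hw
    · exact .var hk hvc hm
    · obtain ⟨e, he, hev⟩ := evals_mem hvs hw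
      exact Accessible.of_eval hk hev (.base hm)
  · intro y w hy
    by_cases hyr : y ∈ rs
    · right
      obtain ⟨w', hw', h⟩ := LState.setMany_store_of_mem (st := st₁) hlen hyr
      rw [hst', h] at hy
      obtain rfl := Option.some.inj hy
      exact hw'
    · exact Or.inl (hold y hyr ▸ hy)
  · rintro l w l' (hl | hl) hw hm
    · exact (hshallow l hl).eq hw hm
    · obtain ⟨r, hr, h⟩ := (hR l).1 hl
      exact (hresShallow r hr _ h).eq hw hm
  -- A location reached by another thread is managed, hence unchanged, or that thread reaches the
  -- Core instance. In the latter case the call was not given the instance, which would be local to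
  -- the caller; then `rI` is empty and the location belongs to `rA` or to the frame `rX`.
  · intro t' ht l hl
    have hV : l ∉ valLocs vs := fun hV => (hlocal l hV).2 t' ht (.mono hl)
    rcases hI.accessible t' l hl with hA | ⟨i, hi, ha⟩
    · exact hsame l (by simp [hperm l (hI.managed l hA)]) hV
    · have hvi : ∀ j, vc ≠ .loc j := fun j hj => by
        obtain ⟨h1, h2⟩ := hcore j hj
        obtain rfl := hI.coreUnique j i h1 hi
        exact h2.2 t' ht ha
      by_cases hl0 : rA.perm l = 0
      · have h1 := hX.perm l
        rw [Global.res_perm (hI.allocated t' l hl), hIA.perm, hI0 hvi, hl0] at h1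
        have hX0 : rX.perm l ≠ 0 := fun h0 => by simp [h0, Res.zero] at h1
        exact (((hr'X.sub_right.trans hyr).heap_eq hX0).trans
          (hX.sub_right.heap_eq hX0).symm :)
      · exact hsame l hl0 hV
  · rintro l ⟨ev', hev', ℓ', k', c', es', rs', hs, th, hth, r, hr, h⟩
    rcases List.mem_cons.1 hev' with rfl | hev'
    · obtain rfl := Option.some.inj (hpost.symm.trans hth)
      simp only [Stmt.coreCall.injEq] at hs
      obtain ⟨-, -, -, -, rfl⟩ := hs
      exact Or.inr ((hR l).2 ⟨r, hr, h⟩)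
    · exact Or.inl ⟨ev', hev', ℓ', k', c', es', rs', hs, th, hth, r, hr, h⟩
  · intro y w l hy hw hm
    by_cases hyr : y ∈ rs
    -- A shallow result mentions `l` only by being a pointer to `l`, so `l` counts as returned.
    · have := hresShallow y hyr w hy l (.base hm)
      subst this
      exact Or.inl (Or.inr ⟨_, List.mem_cons_self, ℓ, n, x, es, rs, rfl, _, hpost, y, hyr, hy⟩)
    · rw [hold y hyr] at hy
      refine (hI.vars _ _ y w l hk hy hm).imp ?_ fun h => h.mono _
      rintro (⟨ℓ', hl⟩ | hl)
      · refine Or.inl ⟨ℓ', ?_⟩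
        rw [← hl]
        exact hC.oldSites l
          (Or.inl (hI.managed_allocated (hI.managed l (Or.inl ⟨ℓ', hl⟩))))
      · exact Or.inr (hl.mono _)
  · rw [hsih]
    intro l hl
    by_cases h : l ∈ valLocs [vc] <;> simp [h, hl]
  · intro l hl
    rcases hXinv l (hl.of_cons hevA) with rfl | hinvX
    · refine ⟨rI', hinv', ?_, ?_, (hIA'.sub_left.trans hsub').perms_le,
        fun l' hl' => (hIA'.sub_left.trans hsub').heap_eq hl', fun l' hl' =>
        hIA'.comm.perm_zero_of_one (hManaged l' hl')⟩
      · have := hIA'.sgh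
        rw [hS'] at this
        exact this.eq_of_right.1
      · have := hIA'.used
        rw [hu'] at this
        exact this.eq_of_right.1
    · refine ⟨rX, hinvX, ?_, ?_, (hr'X.sub_right.trans hyr).perms_le,
        fun l' hl' => (hr'X.sub_right.trans hyr).heap_eq hl', fun l' hl' =>
        hr'X.perm_zero_of_one (hIA'.sub_right.perm_one (hManaged l' hl'))⟩
      · have := hr'X.sgh.comm
        rw [hIA'.sub_right.sgh_eq hS'] at this
        exact this.eq_of_right.1
      · have := hr'X.used.comm
        rw [hIA'.sub_right.used_eq hu'] at this
        exact this.eq_of_right.1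
  -- While `used` is false all I/O permissions were in `rA`, and the part of it that survives
  -- retains them.
  · intro hb
    obtain ⟨p, hp, hφ⟩ := hI.io hb
    exact ⟨p, hp.trans ((hpA hb).symm.trans_le ((hrem.trans hsubA').perms_le)), hφ⟩

end CoreCall

/-! ### Statements executed on a trace -/

theorem Stmt.mem_subs_self (s : Stmt) : s ∈ s.subs := by cases s <;> simp [Stmt.subs]

theorem Stmt.subs_trans {s s' c : Stmt} (h : s ∈ c.subs) (h' : s' ∈ s.subs) : s' ∈ c.subs := by
  induction c with
  | seq ℓ s₁ s₂ ih₁ ih₂ =>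
    simp only [Stmt.subs, List.mem_cons, List.mem_append] at h ⊢
    rcases h with rfl | h | h
    · simpa [Stmt.subs] using h'
    · exact Or.inr (Or.inl (ih₁ h))
    · exact Or.inr (Or.inr (ih₂ h))
  | fork ℓ xs s ih =>
    simp only [Stmt.subs, List.mem_cons] at h ⊢
    rcases h with rfl | h
    · simpa [Stmt.subs] using h'
    · exact Or.inr (ih h)
  | _ =>
    obtain rfl : s = _ := by simpa [Stmt.subs] using h
    exact h'

theorem Stmt.subs_of_mem_flatten {s s' : Stmt} (h : s' ∈ s.flatten) : s' ∈ s.subs := by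
  induction s with
  | seq ℓ s₁ s₂ ih₁ ih₂ =>
    simp only [Stmt.flatten, Stmt.subs, List.mem_cons, List.mem_append] at h ⊢
    exact Or.inr (h.imp ih₁ ih₂)
  | _ =>
    obtain rfl : s' = _ := by simpa [Stmt.flatten] using h
    exact Stmt.mem_subs_self _

/-- The number of Core allocation statements in `s`. -/
def Stmt.coreAllocs (s : Stmt) : ℕ := s.subs.countP isCoreAlloc

/-- The number of Core allocation statements that a thread and the threads it forks may still
execute. -/
def Thread.coreAllocs (th : Thread) : ℕ := (th.cont.map Stmt.coreAllocs).sum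

theorem Stmt.sum_coreAllocs_flatten (s : Stmt) :
    (s.flatten.map Stmt.coreAllocs).sum = s.coreAllocs := by
  induction s with
  | seq ℓ s₁ s₂ ih₁ ih₂ =>
    simp [Stmt.flatten, ih₁, ih₂, Stmt.coreAllocs, Stmt.subs, Stmt.isCoreAlloc]
  | _ => simp [Stmt.flatten]

theorem sum_map_set {α : Type*} (f : α → ℕ) {l : List α} {i : ℕ} {a a' : α}
    (h : l[i]? = some a) : ((l.set i a').map f).sum + f a = (l.map f).sum + f a' := by
  induction l generalizing i with
  | nil => simp at h
  | cons b l ih =>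
    cases i with
    | zero =>
      obtain rfl : b = a := by simpa using h
      simp only [List.set_cons_zero, List.map_cons, List.sum_cons]
      omega
    | succ i =>
      have := ih (by simpa using h)
      simp only [List.set_cons_succ, List.map_cons, List.sum_cons]
      omega

/-! ### Statements and Core allocations along a run -/

section Run

variable {K : CoreImpl Perm} {φ : Multiset Perm → Prop} {c : Stmt} {τ : List (Event Perm)}
  {κ : Config Perm}

theorem Run.mem_subs (h : Run K φ c τ κ) : ∀ th ∈ κ.threads, ∀ s ∈ th.cont, s ∈ c.subs := by
  induction h with
  | init h =>
    obtain ⟨p, st, g, -, -, rfl⟩ := h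
    intro th hth s hs
    obtain rfl := List.mem_singleton.1 hth
    exact Stmt.subs_of_mem_flatten hs
  | step _ hstep ih =>
    cases hstep with
    | simple hk _ _ =>
      intro th hth s hs
      rcases List.mem_or_eq_of_mem_set hth with hth | rfl
      · exact ih th hth s hs
      · exact ih _ (List.mem_of_getElem? hk) s (List.mem_cons_of_mem _ hs)
    | fork hk _ =>
      intro th hth s hs
      rcases List.mem_append.1 hth with hth | hth
      · rcases List.mem_or_eq_of_mem_set hth with hth | rfl
        · exact ih th hth s hs
        · exact ih _ (List.mem_of_getElem? hk) s (List.mem_cons_of_mem _ hs)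
      · obtain rfl := List.mem_singleton.1 hth
        exact Stmt.subs_trans (ih _ (List.mem_of_getElem? hk) _ List.mem_cons_self)
          (List.mem_cons_of_mem _ (Stmt.subs_of_mem_flatten hs))

/-- The number of executed Core allocations plus those still ahead of the threads is conserved by
every step; a fork merely transfers the share of its body to the new thread. -/
theorem Run.coreAllocs_le (h : Run K φ c τ κ) :
    (κ.threads.map Thread.coreAllocs).sum + τ.countP (fun ev => ev.stmt.isCoreAlloc) ≤
      c.coreAllocs := by
  induction h with
  | init h =>
    obtain ⟨p, st, g, -, -, rfl⟩ := h
    simp [Thread.coreAllocs, Stmt.sum_coreAllocs_flatten]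
  | step _ hstep ih =>
    refine le_trans (le_of_eq ?_) ih
    cases hstep with
    | @simple t s k st st' κ g' hk hs _ =>
      have := sum_map_set Thread.coreAllocs (a' := ⟨st', k⟩) hk
      have h1 : s.coreAllocs = if s.isCoreAlloc then 1 else 0 := by
        cases s <;> first | exact hs.elim | rfl
      simp only [Thread.coreAllocs, List.map_cons, List.sum_cons, List.countP_cons] at this ⊢
      omega
    | @fork t ℓ xs b k st st' κ g' hk _ =>
      have := sum_map_set Thread.coreAllocs (a' := ⟨st', k⟩) hk
      have h1 := b.sum_coreAllocs_flatten
      have h2 : (Stmt.fork ℓ xs b).coreAllocs = b.coreAllocs := by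
        simp [Stmt.coreAllocs, Stmt.subs, Stmt.isCoreAlloc]
      have h3 : (Stmt.fork ℓ xs b).isCoreAlloc = false := rfl
      simp only [Thread.coreAllocs, List.map_cons, List.sum_cons, List.countP_cons,
        List.map_append, List.sum_append, List.map_nil, List.sum_nil, h3] at this ⊢
      simp only [Bool.false_eq_true, if_false]
      omega

theorem Run.pre {ev : Event Perm} (h : Run K φ c (ev :: τ) κ) :
    Run K φ c τ ev.pre ∧ Step K ev ∧ κ = ev.post := by
  cases h with
  | step h hs => exact ⟨h, hs, rfl⟩

theorem Run.atPost {ev : Event Perm} (h : Run K φ c (ev :: τ) ev.post) :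
    AtPoint K φ c (.post ev.stmt.label) (ev :: τ) ev.post := ⟨h, ev, τ, rfl, rfl⟩

theorem Run.atPre {ev : Event Perm} (h : Run K φ c (ev :: τ) ev.post) :
    AtPoint K φ c (.pre ev.stmt.label) τ ev.pre := ⟨ev, h, rfl, rfl⟩

theorem Step.thread {ev : Event Perm} (h : Step K ev) :
    ∃ st k, ev.pre.threads[ev.tid]? = some ⟨st, ev.stmt :: k⟩ := by
  cases h with
  | simple hk _ _ => exact ⟨_, _, hk⟩
  | fork hk _ => exact ⟨_, _, hk⟩

theorem Run.stmt_mem {ev : Event Perm} (h : Run K φ c (ev :: τ) κ) : ev.stmt ∈ c.subs := by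
  obtain ⟨h, hs, -⟩ := h.pre
  obtain ⟨st, k, hk⟩ := hs.thread
  exact h.mem_subs _ (List.mem_of_getElem? hk) _ List.mem_cons_self

theorem Run.isCoreAlloc_unique {ev : Event Perm} (h : Run K φ c (ev :: τ) κ)
    (hone : c.AtMostOneCoreAlloc) (hs : ev.stmt.isCoreAlloc = true) :
    ∀ ev' ∈ τ, ev'.stmt.isCoreAlloc = false := by
  intro ev' hev'
  by_contra hne
  have h1 := h.coreAllocs_le.trans hone
  have h2 : 0 < τ.countP (fun ev => ev.stmt.isCoreAlloc) :=
    List.countP_pos_iff.2 ⟨ev', hev', by simpa using hne⟩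
  rw [List.countP_cons, if_pos hs] at h1
  omega

end Run

/-! ### The side conditions -/

/-- The premises of the proof construction. -/
structure Analysed (K : CoreImpl Perm) (sp : CoreSpec Perm) (φ : Multiset Perm → Prop)
    (an : Analysis) (c : Stmt) : Prop where
  ssa : c.SSA
  one : c.AtMostOneCoreAlloc
  restricted : sp.Restricted
  shallow : ShallowArguments K φ c
  pts : an.PointerSound K φ c
  esc : an.EscapeSound K φ c
  judgements : ∀ s ∈ c.subs, an.Judgements K φ c s
  alloc : ∀ ℓ x es, .coreAlloc ℓ x es ∈ c.subs →
    Prov K φ c (PiG φ) (sp.preAllocAssn φ es) (.coreAlloc x es) (sp.postAllocAssn x es)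
  call : ∀ ℓ k x es rs, .coreCall ℓ k x es rs ∈ c.subs →
    Prov K φ c (PiG φ) (sp.preCallAssn k x es) (.coreCall k x es rs) (sp.postCallAssn k x es rs)

/-- Applied with `R` as disjointness of points-to sets: a common target would have its allocation
site in both. -/
theorem nodup_filterMap_toLoc {σ : Var → Option Val} {es : List Expr} {vs : List Val}
    {R : Expr → Expr → Prop} (h : List.Forall₂ (fun e v => e.eval σ = some v) es vs)
    (hP : es.Pairwise R) (hR : ∀ e ∈ es, ∀ e' ∈ es, ∀ l, R e e' → e.eval σ = some (.loc l) →
      e'.eval σ ≠ some (.loc l)) : (vs.filterMap Val.toLoc).Nodup := by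
  induction h with
  | nil => simp
  | @cons e v es vs hv h ih =>
    rw [List.pairwise_cons] at hP
    have ih := ih hP.2 fun e he e' he' => hR e (List.mem_cons_of_mem _ he) e'
      (List.mem_cons_of_mem _ he')
    cases v with
    | loc l =>
      refine List.nodup_cons.2 ⟨fun hl => ?_, ih⟩
      obtain ⟨v, hmem, hvl⟩ := List.mem_filterMap.1 hl
      obtain ⟨i, hi, rfl⟩ := List.getElem_of_mem hmem
      have hi' : i < es.length := h.length_eq ▸ hi
      have he := (List.forall₂_iff_get.1 h).2 i hi' hi
      refine hR e List.mem_cons_self _ (List.mem_cons_of_mem _ (List.getElem_mem hi')) l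
        (hP.1 _ (List.getElem_mem hi')) hv ?_
      simp only [List.get_eq_getElem] at he
      rw [he]
      cases hvi : vs[i] <;> simp_all [Val.toLoc]
    | _ => exact ih

/-! ### From the static judgements to the side conditions -/

section Side

variable {K : CoreImpl Perm} {sp : CoreSpec Perm} {φ : Multiset Perm → Prop} {an : Analysis}
  {c : Stmt} {τ : List (Event Perm)} {ev : Event Perm} {S : Finset Loc} {b : Bool}
  {st st' : LState} {k k' : List Stmt}

/-- A managed location in the `slh` of another thread would be local to that thread and thus out of
reach. -/
theorem TraceInv.local_or_global {κ : Config Perm} (hI : TraceInv sp φ τ κ S b) {t : Tid} {l : Loc}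
    (hk : κ.threads[t]? = some ⟨st, k⟩) (ha : Accessible τ κ t l) (hA : AppManaged τ κ l) :
    l ∈ st.slh ∨ l ∈ S := by
  rcases hI.managed l hA with h | ⟨t', th, hth, h⟩
  · exact Or.inr h
  · by_cases htt : t' = t
    · subst htt
      obtain rfl := Option.some.inj (hk.symm.trans hth)
      exact Or.inl h
    · exact absurd ha ((hI.localTo t' th l hth h).2 t (Ne.symm htt))

/-- Members of `*sgh` are accessible to two threads, which excludes them for a local location. -/
theorem TraceInv.mem_slh {κ : Config Perm} (hI : TraceInv sp φ τ κ S b) {t : Tid} {l : Loc}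
    (hk : κ.threads[t]? = some ⟨st, k⟩) (hl : LocalTo τ κ t l) (hA : AppManaged τ κ l) :
    l ∈ st.slh := by
  rcases hI.local_or_global hk hl.1 hA with h | h
  · exact h
  · obtain ⟨t₁, t₂, hne, h₁, h₂⟩ := hI.shared l h
    have e₁ : t₁ = t := by_contra fun h => hl.2 _ h h₁
    have e₂ : t₂ = t := by_contra fun h => hl.2 _ h h₂
    exact absurd (e₁.trans e₂.symm) hne

theorem LocalTo.of_cons {t : Tid} {l : Loc} (h : LocalTo (ev :: τ) ev.post t l)
    (ha : Accessible τ ev.pre t l) : LocalTo τ ev.pre t l :=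
  ⟨ha, fun t' ht ha => h.2 t' ht (.mono ha)⟩

theorem Analysed.appManaged (hA : Analysed K sp φ an c) (hrun : Run K φ c (ev :: τ) ev.post)
    (hk : ev.pre.threads[ev.tid]? = some ⟨st, k⟩) {e : Expr} {ℓ : Label} {l : Loc}
    (hℓ : ev.stmt.label = ℓ) (hacc : an.AppAccess K φ c e ℓ)
    (he : e.eval st.store = some (.loc l)) : AppManaged τ ev.pre l := by
  obtain ⟨a, ha, hs⟩ := hA.pts e τ ev.pre l hrun.pre.1 ⟨_, List.mem_of_getElem? hk, he⟩
  exact hacc τ ev.pre ⟨ev, hrun, hℓ, rfl⟩ l a ha hs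

/-- The escape analysis only promises locality to some thread; the thread that evaluates `e` has
access, so it is that one. -/
theorem Analysed.localTo (hA : Analysed K sp φ an c) {κ : Config Perm} {t : Tid} {p : Point}
    (hp : AtPoint K φ c p τ κ) (hk : κ.threads[t]? = some ⟨st, k⟩) {e : Expr} {l : Loc}
    (hloc : an.isLocal e p) (he : e.eval st.store = some (.loc l)) : LocalTo τ κ t l := by
  obtain ⟨t', ht'⟩ := hA.esc e p hloc τ κ l hp ⟨_, List.mem_of_getElem? hk, he⟩
  have : t = t' := by_contra fun h => ht'.2 t h (Accessible.of_eval hk he (.base rfl))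
  exact this ▸ ht'

/-- Locality is judged after the statement, where it is stronger: access is monotone, so the
arguments were local before as well, and being managed they are in `slh`. Disjoint points-to sets
make them different. -/
theorem Analysed.arguments (hA : Analysed K sp φ an c) (hI : TraceInv sp φ τ ev.pre S b)
    (hrun : Run K φ c (ev :: τ) ev.post) (hk : ev.pre.threads[ev.tid]? = some ⟨st, k⟩)
    (hk' : ev.post.threads[ev.tid]? = some ⟨st', k'⟩) {es : List Expr} {ℓ : Label}
    (hℓ : ev.stmt.label = ℓ) (hdis : an.DisjointSites es) (hloc : an.LocalAppManaged K φ c es ℓ)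
    (hes : ∀ e ∈ es, e.eval st'.store = e.eval st.store) {vs : List Val}
    (hvs : evals st.store es = some vs) :
    (∀ l ∈ valLocs vs, LocalTo (ev :: τ) ev.post ev.tid l) ∧ valLocs vs ⊆ st.slh ∧
      (vs.filterMap Val.toLoc).Nodup := by
  have hsite : ∀ e l, e.eval st.store = some (.loc l) →
      ∃ a ∈ an.pts e, ev.pre.g.phys.site l = some a := fun e l he =>
    hA.pts e τ ev.pre l hrun.pre.1 ⟨_, List.mem_of_getElem? hk, he⟩
  have hl : ∀ l ∈ valLocs vs, LocalTo (ev :: τ) ev.post ev.tid l ∧ l ∈ st.slh := by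
    intro l hl
    obtain ⟨e, he, hel⟩ := (mem_valLocs_iff_eval hvs).1 hl
    obtain ⟨a, ha, hs⟩ := hsite e l hel
    obtain ⟨h1, h2⟩ := hloc e he τ ev.pre ⟨ev, hrun, hℓ, rfl⟩ l a ha hs
    have h3 := hA.localTo hrun.atPost hk' (hℓ ▸ h1) ((hes e he).trans hel)
    exact ⟨h3, hI.mem_slh hk (h3.of_cons (Accessible.of_eval hk hel (.base rfl))) h2⟩
  refine ⟨fun l h => (hl l h).1, fun l h => (hl l h).2,
    nodup_filterMap_toLoc (evals_exists hvs) hdis fun e _ e' _ l hd he he' => ?_⟩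
  obtain ⟨a, ha, hs⟩ := hsite e l he
  obtain ⟨a', ha', hs'⟩ := hsite e' l he'
  obtain rfl : a = a' := by simpa [hs] using hs'
  exact (hd ▸ ⟨ha, ha'⟩ : a ∈ (∅ : Set Site))

/-- Every step on a trace satisfies the side condition of its statement, and preserves the
invariant. -/
theorem Analysed.step (hA : Analysed K sp φ an c) (hI : TraceInv sp φ τ ev.pre S b)
    (hrun : Run K φ c (ev :: τ) ev.post) :
    (∃ th, ev.pre.threads[ev.tid]? = some th ∧ omega ev.stmt th.st S b) ∧
      ∃ S' b', TraceInv sp φ (ev :: τ) ev.post S' b' := by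
  have hmem := hrun.stmt_mem
  have hJ := hA.judgements _ hmem
  obtain ⟨Δ, hΔ⟩ := hA.ssa.2.2.subs hmem
  obtain ⟨hpre, hstep, -⟩ := hrun.pre
  cases hstep with
  | @fork t ℓ xs s k st st' κ g' hk hex =>
    obtain ⟨S', T, hS, hT, rfl, rfl⟩ := hex.forkPrefix
    obtain rfl : S' = S := by simpa [hS] using hI.sgh
    exact ⟨⟨_, hk, trivial⟩, _, _, hI.step ((AppEffect.fork hk hT).effect hI)⟩
  | @simple t s k st st' κ g' hk hs hex =>
    have hlt : t < κ.threads.length := (List.getElem?_eq_some_iff.1 hk).1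
    have hk' : (κ.threads.set t ⟨st', k⟩)[t]? = some ⟨st', k⟩ := by simp [hlt]
    cases s with
    | skip ℓ =>
      cases hex
      exact ⟨⟨_, hk, trivial⟩, _, _, hI.step ((AppEffect.skip hI hk).effect hI)⟩
    | alloc ℓ x =>
      obtain ⟨l, hl, rfl, rfl⟩ := hex.ghost_alloc
      exact ⟨⟨_, hk, trivial⟩, _, _, hI.step ((AppEffect.alloc hI hk hl).effect hI)⟩
    | read ℓ x e =>
      obtain ⟨l, v, he, hv, rfl, hg⟩ := hex.ghost_read fun h => hΔ.1 (hΔ.2 h)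
      have hM := hA.appManaged hrun hk rfl hJ he
      have hω := hI.local_or_global hk (Accessible.of_eval hk he (.base rfl)) hM
      refine ⟨⟨_, hk, l, he, Finset.mem_union.2 hω⟩, S, b, ?_⟩
      -- In the shared case the location is in `*sgh`, so that removing and adding it again changes
      -- nothing.
      have hg' : g' = κ.g := by
        rcases hg with ⟨-, rfl⟩ | ⟨hn, S', hS, rfl⟩
        · rfl
        · obtain rfl : S' = S := by simpa [hS] using hI.sgh
          rw [Finset.sdiff_union_of_subset (by simpa using hω.resolve_left hn), ← hS]
      subst hg'
      exact hI.step ((AppEffect.read hI hk he hv hM).effect hI)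
    | write ℓ x e =>
      obtain ⟨l, v, w, hx, hv, hw, hg⟩ := hex.ghost_write
      have hx' : (Expr.var x).eval st.store = some (.loc l) := hx
      have hω := hI.local_or_global hk (Accessible.of_eval hk hx' (.base rfl))
        (hA.appManaged hrun hk rfl hJ hx')
      refine ⟨⟨_, hk, l, hx, Finset.mem_union.2 hω⟩, ?_⟩
      rcases hg with ⟨hl, rfl, rfl⟩ | ⟨hn, S', T, hS, hT, rfl, rfl⟩
      · exact ⟨_, _, hI.step ((AppEffect.writeLocal hI hk hv hw hl).effect hI)⟩
      · obtain rfl : S' = S := by simpa [hS] using hI.sgh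
        exact ⟨_, _, hI.step
          ((AppEffect.writeGlobal hI hk hv hw (hω.resolve_left hn) hT).effect hI)⟩
    | coreAlloc ℓ x es =>
      have hx : ∀ e ∈ es, x ∉ e.vars := fun e he hxe => hΔ.1 (hΔ.2 e he hxe)
      obtain ⟨vs, v, m', hvs, hC, hstep, hst', rfl⟩ := hex.ghost_coreAlloc hx
      -- If `used` were set, a Core allocation would already have been executed, and this would be a
      -- second one.
      obtain rfl : b = false := by
        by_contra hb
        obtain ⟨ev', hev', h⟩ := hI.usedTrue (by simpa using hb)
        simp [hrun.isCoreAlloc_unique hA.one rfl ev' hev'] at h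
      have hes : ∀ e ∈ es, e.eval st'.store = e.eval st.store := fun e he => by
        rw [hst']
        exact Expr.eval_set (hx e he)
      obtain ⟨hlocal, hslh, hn⟩ := hA.arguments hI hrun hk hk' rfl hJ.1 hJ.2 hes hvs
      refine ⟨⟨_, hk, rfl, vs, hvs, fun l hl => hslh (List.mem_toFinset.2 hl), hn⟩, S, true, ?_⟩
      refine hI.step ((CoreEffect.coreAlloc hA.restricted hI (hA.alloc ℓ x es hmem) hk hx hvs hslh hn
        hC hstep hst' rfl hlocal fun l hl => ?_).effect hI)
      obtain ⟨e, he, hel⟩ := (mem_valLocs_iff_eval hvs).1 hl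
      exact hA.shallow.1 ℓ x es hmem e he (.post ℓ) (by simp) _ _ _
        hrun.atPost ⟨_, List.mem_of_getElem? hk', (hes e he).trans hel⟩
    | coreCall ℓ n x es rs =>
      have hx : x ∉ rs := fun hr => hΔ.2.2 x hr hΔ.1
      have hes : ∀ e ∈ es, ∀ r ∈ rs, r ∉ e.vars := fun e he r hr h =>
        hΔ.2.2 r hr (hΔ.2.1 e he h)
      obtain ⟨vc, vs, ws, m', st₁, hvc, hvs, hC, hst₁, hstep, hst', hlen, hslh', hsih, rfl⟩ :=
        hex.ghost_coreCall hx hes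
      have hes' : ∀ e ∈ es, e.eval st'.store = e.eval st.store := fun e he =>
        Expr.eval_congr e fun z hz => by
          rw [hst', LState.setMany_store_of_notMem fun hr => hes e he z hr hz, hst₁]
      obtain ⟨hlocal, hslh, hn⟩ := hA.arguments hI hrun hk hk' rfl hJ.1 hJ.2.1 hes' hvs
      have hcore : ∀ i, vc = .loc i → PassedCore τ i ∧ LocalTo τ κ t i := by
        rintro i rfl
        have hx' : (Expr.var x).eval st.store = some (.loc i) := hvc
        obtain ⟨a, ha, hs⟩ := hA.pts _ τ κ i hpre ⟨_, List.mem_of_getElem? hk, hx'⟩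
        obtain ⟨h1, h2⟩ := hJ.2.2.1 τ κ ⟨_, hrun, rfl, rfl⟩ i a ha hs
        exact ⟨h2, hA.localTo hrun.atPre hk h1 hx'⟩
      refine ⟨⟨_, hk, ⟨vs, hvs, fun l hl => hslh (List.mem_toFinset.2 hl), hn⟩, vc, hvc,
        fun i hi => ?_⟩, S, b, ?_⟩
      · obtain ⟨h1, h2⟩ := hcore i hi
        -- The instance is in the `sih` of a thread that has access to it; by locality this is the
        -- calling thread.
        obtain ⟨t', th, hth, hsi, ha⟩ := hI.core i h1
        obtain rfl : t' = t := by_contra fun h => h2.2 t' h ha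
        obtain rfl := Option.some.inj (hk.symm.trans hth)
        exact hsi
      · refine hI.step ((CoreEffect.coreCall hA.restricted hI (hA.call ℓ n x es rs hmem) hk hx hes hvc
          hvs hslh hn hcore hC hst₁ hstep hst' hlen hslh' hsih rfl hlocal ?_ ?_ ?_).effect hI)
        · intro l hl
          obtain ⟨e, he, hel⟩ := mem_locs.1 hl
          obtain ⟨r, hr, rfl⟩ := List.mem_map.1 he
          exact hA.localTo hrun.atPost hk' (hJ.2.2.2 r hr) hel
        · intro l hl
          obtain ⟨e, he, hel⟩ := (mem_valLocs_iff_eval hvs).1 hl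
          exact (hA.shallow.2 ℓ n x es rs hmem).1 e he (.post ℓ) (by simp) _ _ _
            hrun.atPost ⟨_, List.mem_of_getElem? hk', (hes' e he).trans hel⟩
        · intro r hr v hv
          exact (hA.shallow.2 ℓ n x es rs hmem).2 r hr _ _ _ hrun.atPost
            ⟨_, List.mem_of_getElem? hk', hv⟩
    | seq ℓ s₁ s₂ => exact hs.elim
    | fork ℓ xs s => exact hs.elim

theorem Initial.traceInv {κ : Config Perm} (h : Initial K φ c κ) :
    TraceInv sp φ [] κ ∅ false := by
  obtain ⟨p, st, g, hp, hex, rfl⟩ := h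
  obtain ⟨rfl, rfl⟩ := hex.sInit
  have hth : ∀ (t : Tid) (th : Thread),
      ([⟨⟨fun _ => none, ∅, ∅, ∅⟩, c.flatten⟩] : List Thread)[t]? = some th →
        th = ⟨⟨fun _ => none, ∅, ∅, ∅⟩, c.flatten⟩ := fun t th h =>
    List.mem_singleton.1 (List.mem_of_getElem? h)
  have hacc : ∀ (τ : List (Event Perm)) (κ : Config Perm) (t : Tid) (l : Loc),
      Accessible τ κ t l → τ = [] →
      (∀ (t : Tid) (th : Thread), κ.threads[t]? = some th → ∀ x, th.st.store x = none) →
      False := by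
    intro τ κ t l h hτ hκ
    induction h with
    | var h1 h2 _ => simp [hκ _ _ h1] at h2
    | deref _ _ _ ih => exact ih hτ hκ
    | mono _ _ => simp at hτ
  have hacc : ∀ t l, ¬ Accessible [] (⟨[⟨⟨fun _ => none, ∅, ∅, ∅⟩, c.flatten⟩],
      ⟨⟨fun _ => none, fun _ => none, p⟩, some ∅, some false⟩⟩ : Config Perm) t l := fun t l h =>
    hacc _ _ _ _ h rfl fun t th h x => by rw [hth t th h]
  have hmanaged : ∀ l, ¬ AppManaged [] (⟨[⟨⟨fun _ => none, ∅, ∅, ∅⟩, c.flatten⟩],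
      ⟨⟨fun _ => none, fun _ => none, p⟩, some ∅, some false⟩⟩ : Config Perm) l := by
    rintro l (⟨ℓ, h⟩ | ⟨ev, h, -⟩)
    · simp at h
    · simp at h
  have hcore : ∀ l, ¬ PassedCore ([] : List (Event Perm)) l := by
    rintro l ⟨ev, h, -⟩
    simp at h
  exact
    { sgh := rfl
      used := rfl
      allocated := fun t l h => absurd h (hacc t l)
      localTo := fun t th l h hl => by simp [hth t th h] at hl
      shared := by simp
      managed := fun l h => absurd h (hmanaged l)
      vars := fun t th x v l h hv => by simp [hth t th h] at hv
      contents := fun l _ _ h => absurd h (hmanaged l)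
      accessible := fun t l h => absurd h (hacc t l)
      core := fun l h => absurd h (hcore l)
      coreUnique := fun l _ h => absurd h (hcore l)
      usedTrue := by simp
      unused := by simp
      owned := fun l h => absurd h (hcore l)
      io := fun _ => ⟨p, le_rfl, hp⟩ }

theorem Analysed.traceInv (hA : Analysed K sp φ an c) {κ : Config Perm} (h : Run K φ c τ κ) :
    ∃ S b, TraceInv sp φ τ κ S b := by
  induction h with
  | init h => exact ⟨∅, false, h.traceInv⟩
  | step hrun hs ih =>
    obtain ⟨S, b, hI⟩ := ih
    exact (hA.step hI (.step hrun hs)).2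

/-- The invariant holds on the trace that ends just before `s` is executed, and there it determines
the contents of the ghost cells to which ω refers. -/
theorem Analysed.sideCondition (hA : Analysed K sp φ an c) (s : Stmt) : SideCondition K φ c s := by
  rintro τ ev hrun rfl
  obtain ⟨S, b, hI⟩ := hA.traceInv hrun.pre.1
  obtain ⟨th, hth, hω⟩ := (hA.step hI hrun).1
  exact ⟨th, S, b, hth, hI.sgh, hI.used, hω⟩

theorem Analysed.derivable (hA : Analysed K sp φ an c) {s : Stmt} (hs : s ∈ c.subs) :
    Derivable K sp φ c s where
  side := hA.sideCondition s
  wellScoped := hA.ssa.2.2.subs hs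
  alloc ℓ x es h := hA.alloc ℓ x es (h ▸ hs)
  call ℓ k x es rs h := hA.call ℓ k x es rs (h ▸ hs)

end Side

end Diodon

theorem mainTheorem4 {Perm : Type*} (K : Diodon.CoreImpl Perm) (sp : Diodon.CoreSpec Perm)
    (φ : Multiset Perm → Prop) (an : Diodon.Analysis) (c : Diodon.Stmt)
    (hssa : c.SSA) (hone : c.AtMostOneCoreAlloc)
    (hspec : sp.Restricted) (hshallow : Diodon.ShallowArguments K φ c)
    (hpts : an.PointerSound K φ c) (hesc : an.EscapeSound K φ c)
    (hc : ∀ s ∈ c.subs, an.Judgements K φ c s ∧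
      (∀ ℓ x es, s = .coreAlloc ℓ x es →
        Diodon.Prov K φ c (Diodon.PiG φ) (sp.preAllocAssn φ es) (.coreAlloc x es)
          (sp.postAllocAssn x es)) ∧
      (∀ ℓ k x es rs, s = .coreCall ℓ k x es rs →
        Diodon.Prov K φ c (Diodon.PiG φ) (sp.preCallAssn k x es) (.coreCall k x es rs)
          (sp.postCallAssn k x es rs))) :
    Diodon.Prov K φ c Diodon.emp (Diodon.lift (Diodon.spec φ)) (.seq Diodon.sInit (Diodon.ghost c))
      (fun _ _ => True) := by
  have hA : Diodon.Analysed K sp φ an c :=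
    { ssa := hssa
      one := hone
      restricted := hspec
      shallow := hshallow
      pts := hpts
      esc := hesc
      judgements := fun s hs => (hc s hs).1
      alloc := fun ℓ x es hs => (hc _ hs).2.1 ℓ x es rfl
      call := fun ℓ k x es rs hs => (hc _ hs).2.2 ℓ k x es rs rfl }
  exact Diodon.prov_program (Diodon.prov_ghost hspec c fun _ hs => hA.derivable hs)
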